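/- Let $\rho>-1/2$. Then there exist constants $a_0>0$ and $A>0$, depending only on $\rho$, such that the following holds. Let $\xi_1,\xi_2,\ldots$ be one-dependent real random variables on a probability space, i.e. for every $k\ge 1$ the families $(\xi_i)_{1\le i\le k}$ and $(\xi_j)_{j\ge k+2}$ are independent. Let $n\ge 1$ and put $$S_n=\sum_{i=1}^n\xi_i,\qquad V_n=\Big(\sum_{i=1}^n\xi_i^2\Big)^{1/2},\qquad \rho_n=\frac{\sum_{i=1}^{n-1}\mathbb E\,\xi_i\xi_{i+1}}{\sum_{i=1}^n\mathbb E\,\xi_i^2}.$$ Suppose that for some $a_1,a_2>0$ we have $\mathbb E\,\xi_i=0$, $\mathbb E\,\xi_i^4\le a_1^4$ and $\mathbb E\,\xi_i^2\ge a_2^2$ for $1\le i\le n$, and that $\rho_n\ge\rho$. Write $a=a_1/a_2$. Then for every $x\in(0,\,a_0a^{-2}n^{1/8})$ there is a real number $O_1$ with $|O_1|\le A$ such that $$\mathbb P(S_n>xV_n)=\Big[1-\Phi\Big(\frac{x}{\sqrt{1+2\rho_n}}\Big)\Big]\Big(1+O_1\,a^4\,\frac{(1+x)^2}{n^{1/4}}\Big),$$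 where $\Phi$ is the standard normal distribution function. -/

import Mathlib

open MeasureTheory ProbabilityTheory

noncomputable section

namespace SelfNormalized

variable {Ω : Type*} [MeasurableSpace Ω]

/-- The sequence `ξ 1, ξ 2, …` is one-dependent under `μ`: for every `k`, the families
`(ξ i)` with `1 ≤ i ≤ k` and `(ξ j)` with `j ≥ k + 2` are independent, that is, so are the
σ-algebras they generate. (The value `ξ 0` is not part of the sequence.) -/
def OneDependent (ξ : ℕ → Ω → ℝ) (μ : Measure Ω) : Prop :=
  ∀ k : ℕ, Indep
    (⨆ i ∈ Set.Icc 1 k, MeasurableSpace.comap (ξ i) inferInstance)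
    (⨆ j ∈ Set.Ici (k + 2), MeasurableSpace.comap (ξ j) inferInstance) μ

/-- `S_n = ξ_1 + ⋯ + ξ_n`. -/
def S (ξ : ℕ → Ω → ℝ) (n : ℕ) (ω : Ω) : ℝ := ∑ i ∈ Finset.Icc 1 n, ξ i ω

/-- `V_n = (ξ_1² + ⋯ + ξ_n²)^{1/2}`. -/
def V (ξ : ℕ → Ω → ℝ) (n : ℕ) (ω : Ω) : ℝ := Real.sqrt (∑ i ∈ Finset.Icc 1 n, ξ i ω ^ 2)

/-- `ρ_n = (∑_{i=1}^{n-1} E ξ_i ξ_{i+1}) / (∑_{i=1}^n E ξ_i²)`. -/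
def rho (ξ : ℕ → Ω → ℝ) (μ : Measure Ω) (n : ℕ) : ℝ :=
  (∑ i ∈ Finset.Ico 1 n, ∫ ω, ξ i ω * ξ (i + 1) ω ∂μ) /
    (∑ i ∈ Finset.Icc 1 n, ∫ ω, ξ i ω ^ 2 ∂μ)

/-- The standard normal distribution function `Φ`. -/
def Phi (x : ℝ) : ℝ := cdf (gaussianReal 0 1) x

end SelfNormalized

end

/-!
Write `X_i` for the variables divided by `B = (∑ E ξ_i ^ 2) ^ (1 / 2)`, put `ν = n ^ (1 / 16)`,
`D = a ^ 4 / ν ^ 4` and `κ = 1 + 2 ρ_n`; then `E X_i ^ 4 ≤ (a / ν ^ 8) ^ 4`, and `κ` is the variance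
of `∑ X_i`. The event `S_n > x V_n` is invariant under the scaling. Since the Gaussian tail at
`x / κ ^ (1 / 2)` is at least a constant times `exp (-x ^ 2 / (2 κ)) / (1 + x)`, it is enough to
bound the difference of the two tails by `C (1 + x) D exp (-x ^ 2 / (2 κ))`, and this only when
`(1 + x) a ^ 2` is a small multiple of `ν ^ 2`: otherwise the hypothesis on `x` forces `x < 1` and
`D` is bounded below.

The proof needs neither blocks nor a Berry-Esseen theorem. Truncate the `X_i` at level `ν ^ (-3)`,
and let `N` be the number of variables removed, which has expectation at most `D`. To first order
around `∑ X_i ^ 2 ≈ 1`, the event becomes `W > x` for the linear statistic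
`W = ∑ (Z_i - x / 2 (Z_i ^ 2 - E X_i ^ 2))` of the truncated variables `Z_i`.

* The Laplace transform of `W` is computed on a strip. For factors `1 + w_i` close to one that are
  functions of one-dependent variables, `f k = E ∏_{i ≤ k} (1 + w_i)` satisfies a perturbed linear
  recursion, because cutting out one factor makes the two sides independent; this yields
  `f n = exp (∑ E w_i + ∑ E w_i w_{i+1} + r)` with `r` of third order
  (`OneDependent.exists_integral_prod_eq_exp`). With `w_i = exp (z b_i) - 1`, where `b_i` is the
  `i`-th summand of `W`, it follows that `E exp (z W)` is `exp (κ z ^ 2 / 2)` up to a relative error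
  of order `D (1 + |z| ^ 2) (1 + |z| / ν ^ 4)` (`IsNormalized.exists_integral_exp_eq`,
  `exists_laplace_bounds`).
* Laplace inversion on the vertical line through `p = (1 + x) / κ`, after adding a Gaussian variable
  of standard deviation `a ^ 4 / ν ^ 6` to `W`, gives the tail of `W`. The line is close enough to
  the saddle point to produce the factor `exp (-x ^ 2 / (2 κ))`, and integrating the density along
  the half-line gains the factor `1 / p` (`abs_integral_gaussianTail_sub_le`,
  `exists_abs_measureReal_linStat_sub_le`).
* Passing from `S_n > x V_n` to `W > x` fails only if `∑ Z_i ^ 2` deviates from one by more than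
  `a ^ 2 / ν ^ 2`, which is exponentially unlikely, or if `N ≥ 1`. In the latter
  case `S_n > x V_n` still forces `W + 4 N / (1 + x)` to be essentially at least `x`, unless
  `N ≥ x ^ 2`, by the Cauchy-Schwarz inequality applied to the removed variables; and an
  exponential Chebyshev inequality with the factor `N` inserted costs only `E N ≤ D`, because `N` is
  a sum of indicators each of which interacts with three of the factors
  (`OneDependent.integral_mul_prod_le`, `IsAdmissible.measureReal_badEvent_le`).
-/

namespace SelfNormalized

/-! ### Products of functions of one-dependent variables -/

section

variable {Ω : Type*} [MeasurableSpace Ω]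

lemma measurable_iSup_comap {Ω' β : Type*} [MeasurableSpace β] {ξ : ℕ → Ω' → ℝ} {s : Set ℕ} {j : ℕ}
    (hj : j ∈ s) {G : ℝ → β} (hG : Measurable G) :
    Measurable[⨆ i ∈ s, MeasurableSpace.comap (ξ i) inferInstance] fun ω => G (ξ j ω) := by
  refine hG.comp ?_
  rw [measurable_iff_comap_le]
  exact le_iSup₂ (f := fun i (_ : i ∈ s) => MeasurableSpace.comap (ξ i) inferInstance) j hj

lemma measurable_prod_iSup_comap {Ω' 𝕜 : Type*} [RCLike 𝕜]
    {ξ : ℕ → Ω' → ℝ} {s : Set ℕ} {I : Finset ℕ} (hI : ∀ j ∈ I, j ∈ s) {G : ℕ → ℝ → 𝕜}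
    (hG : ∀ j, Measurable (G j)) :
    Measurable[⨆ i ∈ s, MeasurableSpace.comap (ξ i) inferInstance]
      fun ω => ∏ j ∈ I, G j (ξ j ω) :=
  Finset.measurable_fun_prod I fun j hj => measurable_iSup_comap (hI j hj) (hG j)

/-- Expectations of products factorise across a gap of the index set. -/
lemma OneDependent.integral_mul {𝕜 : Type*} [RCLike 𝕜]
    {μ : Measure Ω} {ξ : ℕ → Ω → ℝ} (h : OneDependent ξ μ) (hm : ∀ i, 1 ≤ i → Measurable (ξ i))
    (k : ℕ) {f g : Ω → 𝕜}
    (hf : Measurable[⨆ i ∈ Set.Icc 1 k, MeasurableSpace.comap (ξ i) inferInstance] f)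
    (hg : Measurable[⨆ j ∈ Set.Ici (k + 2), MeasurableSpace.comap (ξ j) inferInstance] g) :
    ∫ ω, f ω * g ω ∂μ = (∫ ω, f ω ∂μ) * ∫ ω, g ω ∂μ := by
  have hle1 : (⨆ i ∈ Set.Icc 1 k, MeasurableSpace.comap (ξ i) inferInstance) ≤
      (inferInstance : MeasurableSpace Ω) :=
    iSup₂_le fun i hi => (hm i hi.1).comap_le
  have hle2 : (⨆ j ∈ Set.Ici (k + 2), MeasurableSpace.comap (ξ j) inferInstance) ≤
      (inferInstance : MeasurableSpace Ω) :=
    iSup₂_le fun i hi => (hm i (le_trans (by omega) (Set.mem_Ici.1 hi))).comap_le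
  have hind : IndepFun f g μ := by
    rw [IndepFun_iff_Indep]
    exact indep_of_indep_of_le (h k) hf.comap_le hg.comap_le
  exact hind.integral_fun_mul_eq_mul_integral (hf.mono hle1 le_rfl).aestronglyMeasurable
    (hg.mono hle2 le_rfl).aestronglyMeasurable

lemma OneDependent.integral_prod_mul_prod {𝕜 : Type*} [RCLike 𝕜] {μ : Measure Ω}
    {ξ : ℕ → Ω → ℝ} (h : OneDependent ξ μ) (hm : ∀ i, 1 ≤ i → Measurable (ξ i))
    (k : ℕ) {I J : Finset ℕ}
    (hI : ∀ i ∈ I, 1 ≤ i ∧ i ≤ k) (hJ : ∀ j ∈ J, k + 2 ≤ j) {G H : ℕ → ℝ → 𝕜}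
    (hG : ∀ j, Measurable (G j)) (hH : ∀ j, Measurable (H j)) :
    ∫ ω, (∏ i ∈ I, G i (ξ i ω)) * ∏ j ∈ J, H j (ξ j ω) ∂μ =
      (∫ ω, ∏ i ∈ I, G i (ξ i ω) ∂μ) * ∫ ω, ∏ j ∈ J, H j (ξ j ω) ∂μ :=
  h.integral_mul hm k (measurable_prod_iSup_comap hI hG) (measurable_prod_iSup_comap hJ hH)

/-- Variables whose indices are pairwise non-adjacent behave as independent ones. -/
lemma OneDependent.integral_prod_of_sparse {𝕜 : Type*} [RCLike 𝕜] {μ : Measure Ω}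
    [IsProbabilityMeasure μ] {ξ : ℕ → Ω → ℝ} (h : OneDependent ξ μ)
    (hm : ∀ i, 1 ≤ i → Measurable (ξ i)) {G : ℕ → ℝ → 𝕜} (hG : ∀ j, Measurable (G j))
    (I : Finset ℕ) (h1 : ∀ i ∈ I, 1 ≤ i) (h2 : ∀ i ∈ I, i + 1 ∉ I) :
    ∫ ω, ∏ i ∈ I, G i (ξ i ω) ∂μ = ∏ i ∈ I, ∫ ω, G i (ξ i ω) ∂μ := by
  induction I using Finset.induction_on_max with
  | empty => simp
  | insert a s ha ih =>
    have has : a ∉ s := fun h => lt_irrefl _ (ha a h)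
    have ih' := ih (fun i hi => h1 i (Finset.mem_insert_of_mem hi)) fun i hi hi' =>
      h2 i (Finset.mem_insert_of_mem hi) (Finset.mem_insert_of_mem hi')
    simp only [Finset.prod_insert has]
    rw [← ih']
    have hgap : ∀ i ∈ s, i + 2 ≤ a := fun i hi => by
      have h3 := ha i hi
      have h4 := h2 i (Finset.mem_insert_of_mem hi)
      have : i + 1 ≠ a := fun h => h4 (h ▸ Finset.mem_insert_self a s)
      omega
    by_cases hs : s = ∅
    · subst hs; simp
    · obtain ⟨i, hi⟩ := Finset.nonempty_iff_ne_empty.2 hs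
      have := h.integral_prod_mul_prod hm (a - 2) (I := s) (J := {a})
        (fun i hi => ⟨h1 i (Finset.mem_insert_of_mem hi), by have := hgap i hi; omega⟩)
        (fun j hj => by have := hgap i hi; rw [Finset.mem_singleton] at hj; omega) hG hG
      simp only [Finset.prod_singleton] at this
      rw [mul_comm (∫ ω, G a (ξ a ω) ∂μ), ← this]
      simp only [mul_comm]

lemma integrable_of_measurable_of_bound {E : Type*} [NormedAddCommGroup E]
    [MeasurableSpace E] [BorelSpace E] [SecondCountableTopology E]
    {μ : Measure Ω} [IsFiniteMeasure μ] {f : Ω → E}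
    (hf : Measurable f) {K : ℝ} (hK : ∀ ω, ‖f ω‖ ≤ K) : Integrable f μ :=
  Integrable.of_bound hf.aestronglyMeasurable K (ae_of_all _ hK)

lemma exists_prod_bound {G : ℕ → ℝ → ℂ} (hb : ∀ j, ∃ K, ∀ y, ‖G j y‖ ≤ K) (I : Finset ℕ) :
    ∃ K, ∀ y : ℕ → ℝ, ‖∏ j ∈ I, G j (y j)‖ ≤ K := by
  choose K hK using hb
  refine ⟨∏ j ∈ I, K j, fun y => ?_⟩
  rw [norm_prod]
  exact Finset.prod_le_prod (fun _ _ => norm_nonneg _) fun j _ => hK j _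

lemma measurable_prod_comp {G : ℕ → ℝ → ℂ} (hG : ∀ j, Measurable (G j)) {ξ : ℕ → Ω → ℝ}
    (hm : ∀ i, 1 ≤ i → Measurable (ξ i)) {I : Finset ℕ} (h1 : ∀ i ∈ I, 1 ≤ i) :
    Measurable fun ω => ∏ j ∈ I, G j (ξ j ω) :=
  Finset.measurable_fun_prod I fun j hj => (hG j).comp (hm j (h1 j hj))

lemma integrable_prod_comp {μ : Measure Ω} [IsFiniteMeasure μ] {G : ℕ → ℝ → ℂ}
    (hG : ∀ j, Measurable (G j)) (hb : ∀ j, ∃ K, ∀ y, ‖G j y‖ ≤ K) {ξ : ℕ → Ω → ℝ}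
    (hm : ∀ i, 1 ≤ i → Measurable (ξ i)) {I : Finset ℕ} (h1 : ∀ i ∈ I, 1 ≤ i) :
    Integrable (fun ω => ∏ j ∈ I, G j (ξ j ω)) μ := by
  obtain ⟨K, hK⟩ := exists_prod_bound hb I
  exact integrable_of_measurable_of_bound (measurable_prod_comp hG hm h1) (K := K)
    fun ω => hK fun j => ξ j ω

lemma integral_mul_sq_le {μ : Measure Ω} [IsFiniteMeasure μ] {f g : Ω → ℝ} (hf : Measurable f)
    (hg : Measurable g) {K : ℝ} (hfK : ∀ ω, |f ω| ≤ K) (hgK : ∀ ω, |g ω| ≤ K) :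
    (∫ ω, f ω * g ω ∂μ) ^ 2 ≤ (∫ ω, f ω ^ 2 ∂μ) * ∫ ω, g ω ^ 2 ∂μ := by
  have hff : Integrable (fun ω => f ω ^ 2) μ :=
    integrable_of_measurable_of_bound (hf.pow_const 2) (K := K ^ 2) fun ω => by
      rw [Real.norm_eq_abs, abs_pow]; exact pow_le_pow_left₀ (abs_nonneg _) (hfK ω) 2
  have hgg : Integrable (fun ω => g ω ^ 2) μ :=
    integrable_of_measurable_of_bound (hg.pow_const 2) (K := K ^ 2) fun ω => by
      rw [Real.norm_eq_abs, abs_pow]; exact pow_le_pow_left₀ (abs_nonneg _) (hgK ω) 2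
  have hfg : Integrable (fun ω => f ω * g ω) μ :=
    integrable_of_measurable_of_bound (hf.mul hg) (K := K * K) fun ω => by
      rw [Real.norm_eq_abs, abs_mul]
      exact mul_le_mul (hfK ω) (hgK ω) (abs_nonneg _) ((abs_nonneg _).trans (hfK ω))
  have key : ∀ t : ℝ, 0 ≤ (∫ ω, f ω ^ 2 ∂μ) * (t * t) + 2 * (∫ ω, f ω * g ω ∂μ) * t +
      ∫ ω, g ω ^ 2 ∂μ := fun t => by
    have : (∫ ω, f ω ^ 2 ∂μ) * (t * t) + 2 * (∫ ω, f ω * g ω ∂μ) * t + ∫ ω, g ω ^ 2 ∂μ =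
        ∫ ω, (t * f ω + g ω) ^ 2 ∂μ := by
      have e : (fun ω => (t * f ω + g ω) ^ 2) =
          fun ω => (t * t) * f ω ^ 2 + (2 * t) * (f ω * g ω) + g ω ^ 2 := by ext ω; ring
      rw [e, integral_add (show Integrable (fun ω => (t * t) * f ω ^ 2 + (2 * t) * (f ω * g ω)) μ
          from (hff.const_mul _).add (hfg.const_mul _)) hgg,
        integral_add (hff.const_mul _) (hfg.const_mul _), integral_const_mul, integral_const_mul]
      ring
    rw [this]
    exact integral_nonneg fun ω => sq_nonneg _
  have := discrim_le_zero key
  rw [discrim] at this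
  nlinarith

/-- For a one-dependent sequence the second moments control products over arbitrary index sets:
the even and the odd indices are separated by Cauchy–Schwarz, and each parity class is
independent. -/
lemma OneDependent.norm_integral_prod_le {μ : Measure Ω} [IsProbabilityMeasure μ]
    {ξ : ℕ → Ω → ℝ} (h : OneDependent ξ μ) (hm : ∀ i, 1 ≤ i → Measurable (ξ i))
    {G : ℕ → ℝ → ℂ} (hG : ∀ j, Measurable (G j)) (hb : ∀ j, ∃ K, ∀ y, ‖G j y‖ ≤ K)
    {δ : ℝ} (hδ : 0 ≤ δ) (I : Finset ℕ) (h1 : ∀ i ∈ I, 1 ≤ i)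
    (h2 : ∀ i ∈ I, ∫ ω, ‖G i (ξ i ω)‖ ^ 2 ∂μ ≤ δ ^ 2) :
    ‖∫ ω, ∏ i ∈ I, G i (ξ i ω) ∂μ‖ ≤ δ ^ I.card := by
  set I₀ := I.filter Even
  set I₁ := I.filter fun i => ¬ Even i
  have hsplit : ∀ ω, ‖∏ i ∈ I, G i (ξ i ω)‖ =
      ‖∏ i ∈ I₀, G i (ξ i ω)‖ * ‖∏ i ∈ I₁, G i (ξ i ω)‖ := fun ω => by
    rw [← norm_mul, Finset.prod_filter_mul_prod_filter_not]
  have hcard : I.card = I₀.card + I₁.card :=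
    (Finset.card_filter_add_card_filter_not _).symm
  have hpar : ∀ J : Finset ℕ, J ⊆ I → (∀ i ∈ J, i + 1 ∉ J) →
      ∫ ω, ‖∏ i ∈ J, G i (ξ i ω)‖ ^ 2 ∂μ ≤ (δ ^ J.card) ^ 2 := fun J hJ hJ2 => by
    have := h.integral_prod_of_sparse (𝕜 := ℝ) hm (G := fun j y => ‖G j y‖ ^ 2)
      (fun j => (hG j).norm.pow_const 2) J (fun i hi => h1 i (hJ hi)) hJ2
    simp only [norm_prod, ← Finset.prod_pow]
    rw [this]
    calc ∏ i ∈ J, ∫ ω, ‖G i (ξ i ω)‖ ^ 2 ∂μ ≤ ∏ i ∈ J, δ ^ 2 :=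
          Finset.prod_le_prod (fun i _ => integral_nonneg fun ω => sq_nonneg _)
            fun i hi => h2 i (hJ hi)
      _ = _ := by rw [Finset.prod_const, ← pow_mul, ← pow_mul, mul_comm]
  have hI0 : I₀ ⊆ I := Finset.filter_subset _ _
  have hI1 : I₁ ⊆ I := Finset.filter_subset _ _
  have e0 := hpar I₀ hI0 fun i hi hi' => by
    rw [Finset.mem_filter] at hi hi'
    exact absurd hi'.2 (by rw [Nat.even_add_one]; simpa using hi.2)
  have e1 := hpar I₁ hI1 fun i hi hi' => by
    rw [Finset.mem_filter] at hi hi'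
    exact hi'.2 (by rw [Nat.even_add_one]; exact hi.2)
  obtain ⟨K0, hK0⟩ := exists_prod_bound hb I₀
  obtain ⟨K1, hK1⟩ := exists_prod_bound hb I₁
  have hCS := integral_mul_sq_le (μ := μ)
    (measurable_prod_comp hG hm fun i hi => h1 i (hI0 hi)).norm
    (measurable_prod_comp hG hm fun i hi => h1 i (hI1 hi)).norm (K := max K0 K1)
    (fun ω => by rw [abs_norm]; exact (hK0 fun j => ξ j ω).trans (le_max_left _ _))
    (fun ω => by rw [abs_norm]; exact (hK1 fun j => ξ j ω).trans (le_max_right _ _))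
  refine (norm_integral_le_integral_norm _).trans ?_
  simp only [hsplit]
  rw [hcard, pow_add]
  refine abs_le_of_sq_le_sq' ?_ (by positivity) |>.2
  refine hCS.trans ?_
  rw [mul_pow]
  exact mul_le_mul e0 e1 (integral_nonneg fun ω => sq_nonneg _) (by positivity)

end

/-! ### The logarithm of the expectation of a product of factors close to one -/

section

variable {Ω : Type*} [MeasurableSpace Ω]

/-- The triangular recursion satisfied by the expectations of products of a one-dependent
sequence: `f k` stands for `E ∏_{j ≤ k} (1 + w_j)`, `m s r` for `E (w_s ⋯ w_{s+r-1})` and `h l r`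
for `E (∏_{j ≤ l} (1 + w_j)) w_{l+1} ⋯ w_{l+r}`. If the `m s r` decay like `δ ^ r`, then so do the
`h l r` relative to `f`, and in particular `f` does not vanish. -/
lemma norm_mixed_moment_le {n : ℕ} {f : ℕ → ℂ} {m h : ℕ → ℕ → ℂ} {δ : ℝ} (hδ0 : 0 ≤ δ)
    (hδ : δ ≤ 1 / 8) (f0 : f 0 = 1) (hf : ∀ k, k < n → f (k + 1) = f k + h k 1)
    (h0 : ∀ r, h 0 r = m 1 r)
    (hh : ∀ l r, h (l + 1) r = f l * m (l + 2) r + h l (r + 1))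
    (hm : ∀ s r, 1 ≤ s → s + r ≤ n + 1 → ‖m s r‖ ≤ δ ^ r) :
    ∀ K, K < n → (∀ j ≤ K, ‖f j‖ ≤ 2 ^ (K - j) * ‖f K‖) ∧
      (∀ l r, l + r = K + 1 → ‖h l r‖ ≤ 2 * (2 * δ) ^ r * ‖f K‖) ∧
      ‖f K‖ ≤ 2 * ‖f (K + 1)‖ := by
  intro K
  induction K with
  | zero =>
    intro hn
    have e1 : ‖h 0 1‖ ≤ δ := by rw [h0]; simpa using hm 1 1 le_rfl (by omega)
    have e2 : ∀ l r, l + r = 0 + 1 → ‖h l r‖ ≤ 2 * (2 * δ) ^ r * ‖f 0‖ := by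
      intro l r hlr
      rw [f0, norm_one]
      obtain ⟨rfl, rfl⟩ | ⟨rfl, rfl⟩ : (l = 0 ∧ r = 1) ∨ (l = 1 ∧ r = 0) := by omega
      · linarith
      · have hh' := hh 0 0
        rw [zero_add] at hh'
        rw [hh', f0]
        have := hm 2 0 (by omega) (by omega)
        calc ‖1 * m (0 + 2) 0 + h 0 (0 + 1)‖ ≤ ‖m 2 0‖ + ‖h 0 1‖ := by
              simpa using norm_add_le (m 2 0) (h 0 1)
          _ ≤ 2 * (2 * δ) ^ 0 * 1 := by simp at this ⊢; linarith
    refine ⟨fun j hj => ?_, e2, ?_⟩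
    · obtain rfl : j = 0 := by omega
      simp
    · rw [hf 0 hn, f0, norm_one]
      have := norm_sub_le (1 + h 0 1) (h 0 1)
      simp only [add_sub_cancel_right, norm_one] at this
      linarith
  | succ K ih =>
    intro hn
    obtain ⟨ih1, -, ih3⟩ := ih (by omega)
    have A : ∀ j ≤ K + 1, ‖f j‖ ≤ 2 ^ (K + 1 - j) * ‖f (K + 1)‖ := by
      intro j hj
      obtain rfl | hj' := hj.eq_or_lt
      · simp
      · rw [show K + 1 - j = (K - j) + 1 by omega, pow_succ]
        have : (0 : ℝ) < 2 ^ (K - j) := by positivity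
        nlinarith [ih1 j (by omega)]
    have B : ∀ l r, l + r = K + 1 + 1 → ‖h l r‖ ≤ 2 * (2 * δ) ^ r * ‖f (K + 1)‖ := by
      intro l
      induction l with
      | zero =>
        intro r hr
        obtain rfl : r = K + 1 + 1 := by omega
        rw [h0]
        have e1 := hm 1 (K + 1 + 1) le_rfl (by omega)
        have e2 := A 0 (by omega)
        rw [f0, norm_one, Nat.sub_zero] at e2
        have e3 : 0 ≤ δ ^ (K + 1 + 1) := by positivity
        calc ‖m 1 (K + 1 + 1)‖ ≤ δ ^ (K + 1 + 1) * 1 := by linarith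
          _ ≤ δ ^ (K + 1 + 1) * (2 ^ (K + 1) * ‖f (K + 1)‖) := by gcongr
          _ ≤ δ ^ (K + 1 + 1) * (2 * 2 ^ (K + 1 + 1) * ‖f (K + 1)‖) := by
              gcongr
              rw [pow_succ 2 (K + 1)]
              have : (0 : ℝ) < 2 ^ (K + 1) := by positivity
              linarith
          _ = _ := by rw [mul_pow]; ring
      | succ l ihl =>
        intro r hr
        rw [hh]
        have e1 := ihl (r + 1) (by omega)
        have e2 := hm (l + 2) r (by omega) (by omega)
        have e3 := A l (by omega)
        rw [show K + 1 - l = r by omega] at e3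
        calc ‖f l * m (l + 2) r + h l (r + 1)‖ ≤ ‖f l‖ * ‖m (l + 2) r‖ + ‖h l (r + 1)‖ := by
              rw [← norm_mul]; exact norm_add_le _ _
          _ ≤ (2 ^ r * ‖f (K + 1)‖) * δ ^ r + 2 * (2 * δ) ^ (r + 1) * ‖f (K + 1)‖ := by
              gcongr
          _ = (2 * δ) ^ r * ‖f (K + 1)‖ * (1 + 4 * δ) := by rw [mul_pow]; ring
          _ ≤ (2 * δ) ^ r * ‖f (K + 1)‖ * 2 := by gcongr; linarith
          _ = _ := by ring
    refine ⟨A, B, ?_⟩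
    have e1 := B (K + 1) 1 rfl
    rw [hf (K + 1) hn]
    have := norm_sub_le (f (K + 1) + h (K + 1) 1) (h (K + 1) 1)
    simp only [add_sub_cancel_right] at this
    have : 2 * (2 * δ) ^ 1 * ‖f (K + 1)‖ ≤ 1 / 2 * ‖f (K + 1)‖ := by
      gcongr; linarith
    linarith

/-- The increment ratios `f (k + 1) / f k` of the recursion, up to third order in `δ`. -/
lemma norm_ratio_sub_le {n : ℕ} {f : ℕ → ℂ} {m h : ℕ → ℕ → ℂ} {δ : ℝ} (hδ0 : 0 ≤ δ)
    (hδ : δ ≤ 1 / 8) (f0 : f 0 = 1) (hf : ∀ k, k < n → f (k + 1) = f k + h k 1)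
    (h0 : ∀ r, h 0 r = m 1 r)
    (hh : ∀ l r, h (l + 1) r = f l * m (l + 2) r + h l (r + 1))
    (hm : ∀ s r, 1 ≤ s → s + r ≤ n + 1 → ‖m s r‖ ≤ δ ^ r)
    (hm1 : ∀ s, 1 ≤ s → s ≤ n → ‖m s 1‖ ≤ δ ^ 2) (K : ℕ) (hK : K < n) :
    ∃ u : ℂ, f (K + 1) = f K * (1 + u) ∧ ‖u‖ ≤ 10 * δ ^ 2 ∧
      ‖u - (m (K + 1) 1 + if 1 ≤ K then m K 2 else 0)‖ ≤ 26 * δ ^ 3 := by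
  have key := norm_mixed_moment_le hδ0 hδ f0 hf h0 hh hm
  have hne : ∀ K, K < n → 0 < ‖f K‖ := fun K hK => by
    have := (key K hK).1 0 (by omega)
    rw [f0, norm_one] at this
    by_contra h'
    have h'' : ‖f K‖ = 0 := le_antisymm (not_lt.1 h') (norm_nonneg _)
    rw [h''] at this; simp at this; linarith
  have hinc : ∀ K, K < n → ‖h K 1‖ ≤ 10 * δ ^ 2 * ‖f K‖ := by
    intro K hK
    obtain ⟨A, B, -⟩ := key K hK
    have hpos := norm_nonneg (f K)
    cases K with
    | zero =>
      rw [h0, f0, norm_one]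
      have := hm1 1 le_rfl (by omega)
      nlinarith [sq_nonneg δ]
    | succ l =>
      rw [hh]
      have e1 := A l (by omega)
      have e2 := B l 2 (by omega)
      have e3 := hm1 (l + 2) (by omega) (by omega)
      rw [show l + 1 - l = 1 by omega, pow_one] at e1
      calc ‖f l * m (l + 2) 1 + h l (1 + 1)‖ ≤ ‖f l‖ * ‖m (l + 2) 1‖ + ‖h l 2‖ := by
            rw [← norm_mul]; exact norm_add_le _ _
        _ ≤ (2 * ‖f (l + 1)‖) * δ ^ 2 + 2 * (2 * δ) ^ 2 * ‖f (l + 1)‖ := by gcongr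
        _ = _ := by ring
  have hfK := hne K hK
  have hfK0 : f K ≠ 0 := norm_pos_iff.1 hfK
  refine ⟨h K 1 / f K, ?_, ?_, ?_⟩
  · rw [hf K hK]; field_simp
  · rw [norm_div, div_le_iff₀ hfK]; exact hinc K hK
  have hδ3 : δ ^ 4 ≤ δ ^ 3 / 8 := by
    have : 0 ≤ δ ^ 3 := by positivity
    nlinarith
  suffices H : ‖h K 1 - f K * (m (K + 1) 1 + if 1 ≤ K then m K 2 else 0)‖ ≤
      26 * δ ^ 3 * ‖f K‖ by
    rwa [← div_le_iff₀ hfK, ← norm_div, sub_div, mul_div_cancel_left₀ _ hfK0] at H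
  obtain ⟨A, B, -⟩ := key K hK
  obtain _ | _ | l := K
  · simp only [nonpos_iff_eq_zero, one_ne_zero, if_false, add_zero, h0, f0, one_mul,
      zero_add, sub_self, norm_zero]
    positivity
  · rw [hh, h0, f0]
    simp only [zero_add, le_refl, if_true]
    have e1 := hinc 0 (by omega)
    rw [f0, norm_one] at e1
    have e2 : f 1 - 1 = h 0 1 := by rw [hf 0 (by omega), f0]; ring
    have e3 := hm1 2 (by omega) (by omega)
    have e4 := hm 1 2 (by omega) (by omega)
    have e5 := A 0 (by omega)
    rw [f0, norm_one] at e5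
    norm_num at e5 e3 e4 ⊢
    have : m 2 1 + m 1 2 - f 1 * (m 2 1 + m 1 2) = -(h 0 1 * (m 2 1 + m 1 2)) := by
      rw [← e2]; ring
    rw [this, norm_neg, norm_mul]
    calc ‖h 0 1‖ * ‖m 2 1 + m 1 2‖ ≤ (10 * δ ^ 2 * 1) * (δ ^ 2 + δ ^ 2) := by
          gcongr; exact (norm_add_le _ _).trans (add_le_add e3 e4)
      _ = 20 * δ ^ 4 := by ring
      _ ≤ 26 * (δ ^ 3 * (1 / 2)) := by nlinarith [pow_nonneg hδ0 3]
      _ ≤ 26 * δ ^ 3 * ‖f 1‖ := by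
          have : 0 ≤ δ ^ 3 := by positivity
          nlinarith
  · rw [if_pos (by omega), hh, hh]
    have a1 := A (l + 1) (by omega)
    have a2 := A l (by omega)
    rw [show l + 1 + 1 - (l + 1) = 1 by omega, pow_one] at a1
    rw [show l + 1 + 1 - l = 2 by omega] at a2
    have i1 := hinc (l + 1) (by omega)
    have i2 := hinc l (by omega)
    have d1 : ‖f (l + 1) - f (l + 1 + 1)‖ ≤ 20 * δ ^ 2 * ‖f (l + 1 + 1)‖ := by
      rw [hf (l + 1) (by omega), sub_add_cancel_left, norm_neg, ← hf (l + 1) (by omega)]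
      refine i1.trans ?_
      calc 10 * δ ^ 2 * ‖f (l + 1)‖ ≤ 10 * δ ^ 2 * (2 * ‖f (l + 1 + 1)‖) := by gcongr
        _ = _ := by ring
    have d2 : ‖f l - f (l + 1 + 1)‖ ≤ 60 * δ ^ 2 * ‖f (l + 1 + 1)‖ := by
      have : f l - f (l + 1 + 1) = (f (l + 1) - f (l + 1 + 1)) - h l 1 := by
        rw [hf l (by omega)]; ring
      rw [this]
      refine (norm_sub_le _ _).trans ?_
      calc _ ≤ 20 * δ ^ 2 * ‖f (l + 1 + 1)‖ + 10 * δ ^ 2 * (2 ^ 2 * ‖f (l + 1 + 1)‖) := by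
            gcongr; refine i2.trans ?_; gcongr
        _ = _ := by ring
    have e3 := hm1 (l + 1 + 1 + 1) (by omega) (by omega)
    have e4 := hm (l + 1 + 1) 2 (by omega) (by omega)
    have e5 := B l 3 (by omega)
    have : f (l + 1) * m (l + 1 + 2) 1 + (f l * m (l + 2) (1 + 1) + h l (1 + 1 + 1)) -
        f (l + 1 + 1) * (m (l + 1 + 1 + 1) 1 + m (l + 1 + 1) 2) =
        (f (l + 1) - f (l + 1 + 1)) * m (l + 1 + 1 + 1) 1 +
        (f l - f (l + 1 + 1)) * m (l + 1 + 1) 2 + h l 3 := by ring_nf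
    rw [this]
    refine (norm_add₃_le).trans ?_
    rw [norm_mul, norm_mul]
    calc _ ≤ (20 * δ ^ 2 * ‖f (l + 1 + 1)‖) * δ ^ 2 + (60 * δ ^ 2 * ‖f (l + 1 + 1)‖) * δ ^ 2 +
          2 * (2 * δ) ^ 3 * ‖f (l + 1 + 1)‖ := by gcongr
      _ = (80 * δ ^ 4 + 16 * δ ^ 3) * ‖f (l + 1 + 1)‖ := by ring
      _ ≤ 26 * δ ^ 3 * ‖f (l + 1 + 1)‖ := by gcongr; linarith

/-- Expectation of a product of one-dependent factors `1 + w_j` close to one: to leading order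
only the means `E w_j` and the neighbouring mixed moments `E w_j w_{j+1}` matter. -/
theorem OneDependent.exists_integral_prod_eq_exp {μ : Measure Ω} [IsProbabilityMeasure μ]
    {ξ : ℕ → Ω → ℝ} (h : OneDependent ξ μ) (hξ : ∀ i, 1 ≤ i → Measurable (ξ i))
    {F : ℕ → ℝ → ℂ} (hF : ∀ j, Measurable (F j)) (hb : ∀ j, ∃ K, ∀ y, ‖F j y‖ ≤ K)
    {n : ℕ} {δ : ℝ} (hδ0 : 0 ≤ δ) (hδ : δ ≤ 1 / 8)
    (h2 : ∀ i, 1 ≤ i → i ≤ n → ∫ ω, ‖F i (ξ i ω)‖ ^ 2 ∂μ ≤ δ ^ 2)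
    (h1 : ∀ i, 1 ≤ i → i ≤ n → ‖∫ ω, F i (ξ i ω) ∂μ‖ ≤ δ ^ 2) :
    ∃ r : ℂ, ‖r‖ ≤ 34 * n * δ ^ 3 ∧
      ∫ ω, ∏ j ∈ Finset.Icc 1 n, (1 + F j (ξ j ω)) ∂μ =
        Complex.exp ((∑ j ∈ Finset.Icc 1 n, ∫ ω, F j (ξ j ω) ∂μ) +
          (∑ j ∈ Finset.Ico 1 n, ∫ ω, F j (ξ j ω) * F (j + 1) (ξ (j + 1) ω) ∂μ) + r) := by
  set f : ℕ → ℂ := fun k => ∫ ω, ∏ j ∈ Finset.Icc 1 k, (1 + F j (ξ j ω)) ∂μ with hfdef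
  set m : ℕ → ℕ → ℂ := fun s r => ∫ ω, ∏ j ∈ Finset.Ico s (s + r), F j (ξ j ω) ∂μ with hmdef
  set H : ℕ → ℕ → ℂ := fun l r => ∫ ω, (∏ j ∈ Finset.Icc 1 l, (1 + F j (ξ j ω))) *
    ∏ j ∈ Finset.Ico (l + 1) (l + 1 + r), F j (ξ j ω) ∂μ with hHdef
  have hF1 : ∀ j, Measurable fun y => 1 + F j y := fun j => (hF j).const_add 1
  have hb1 : ∀ j, ∃ K, ∀ y, ‖1 + F j y‖ ≤ K := fun j => by
    obtain ⟨K, hK⟩ := hb j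
    exact ⟨1 + K, fun y => (norm_add_le _ _).trans (by simpa using hK y)⟩
  have intP : ∀ l s r : ℕ, 1 ≤ s → Integrable (fun ω =>
      (∏ j ∈ Finset.Icc 1 l, (1 + F j (ξ j ω))) * ∏ j ∈ Finset.Ico s (s + r), F j (ξ j ω)) μ := by
    intro l s r hs
    obtain ⟨K1, hK1⟩ := exists_prod_bound hb1 (Finset.Icc 1 l)
    obtain ⟨K2, hK2⟩ := exists_prod_bound hb (Finset.Ico s (s + r))
    refine integrable_of_measurable_of_bound (K := K1 * K2)
      ((measurable_prod_comp hF1 hξ fun i hi => (Finset.mem_Icc.1 hi).1).mul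
        (measurable_prod_comp hF hξ fun i hi => hs.trans (Finset.mem_Ico.1 hi).1)) fun ω => ?_
    rw [norm_mul]
    have a := hK1 fun j => ξ j ω
    have b := hK2 fun j => ξ j ω
    exact mul_le_mul a b (norm_nonneg _) ((norm_nonneg _).trans a)
  have f0 : f 0 = 1 := by simp [hfdef]
  have hsucc : ∀ k, Finset.Icc 1 (k + 1) = insert (k + 1) (Finset.Icc 1 k) := fun k => by
    ext j; simp only [Finset.mem_Icc, Finset.mem_insert]; omega
  have hnot : ∀ k, k + 1 ∉ Finset.Icc 1 k := fun k => by simp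
  have hf : ∀ k, k < n → f (k + 1) = f k + H k 1 := by
    intro k _
    simp only [hfdef, hHdef, Nat.Ico_succ_singleton, Finset.prod_singleton]
    rw [← integral_add]
    · refine integral_congr_ae (ae_of_all _ fun ω => ?_)
      simp only [hsucc, Finset.prod_insert (hnot k)]
      ring
    · exact integrable_prod_comp hF1 hb1 hξ fun i hi => (Finset.mem_Icc.1 hi).1
    · simpa [Nat.Ico_succ_singleton] using intP k (k + 1) 1 (by omega)
  have h0 : ∀ r, H 0 r = m 1 r := fun r => by simp [hHdef, hmdef]
  have hh : ∀ l r, H (l + 1) r = f l * m (l + 2) r + H l (r + 1) := by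
    intro l r
    have e := h.integral_prod_mul_prod hξ l (I := Finset.Icc 1 l)
      (J := Finset.Ico (l + 2) (l + 2 + r)) (fun i hi => Finset.mem_Icc.1 hi)
      (fun i hi => (Finset.mem_Ico.1 hi).1) hF1 hF
    simp only [hfdef, hmdef, hHdef]
    rw [← e, ← integral_add]
    · refine integral_congr_ae (ae_of_all _ fun ω => ?_)
      have : Finset.Ico (l + 1) (l + 1 + (r + 1)) =
          insert (l + 1) (Finset.Ico (l + 2) (l + 2 + r)) := by
        ext j; simp only [Finset.mem_Ico, Finset.mem_insert]; omega
      simp only [this, hsucc, Finset.prod_insert (hnot l)]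
      rw [Finset.prod_insert (by simp)]
      ring
    · exact intP l (l + 2) r (by omega)
    · exact intP l (l + 1) (r + 1) (by omega)
  have hm : ∀ s r, 1 ≤ s → s + r ≤ n + 1 → ‖m s r‖ ≤ δ ^ r := by
    intro s r hs hsr
    have := h.norm_integral_prod_le hξ hF hb hδ0 (Finset.Ico s (s + r))
      (fun i hi => hs.trans (Finset.mem_Ico.1 hi).1) (fun i hi => by
        rw [Finset.mem_Ico] at hi; exact h2 i (by omega) (by omega))
    simpa using this
  have hm1 : ∀ s, m s 1 = ∫ ω, F s (ξ s ω) ∂μ := fun s => by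
    simp [hmdef, Nat.Ico_succ_singleton]
  have hm2 : ∀ s, m s 2 = ∫ ω, F s (ξ s ω) * F (s + 1) (ξ (s + 1) ω) ∂μ := fun s => by
    simp only [hmdef]
    have : Finset.Ico s (s + 2) = {s, s + 1} := by
      ext j; simp only [Finset.mem_Ico, Finset.mem_insert, Finset.mem_singleton]; omega
    simp [this]
  have ratio := norm_ratio_sub_le hδ0 hδ f0 hf h0 hh hm
    (fun s hs hs' => by rw [hm1]; exact h1 s hs hs')
  have main : ∀ k ≤ n, ∃ r : ℂ, ‖r‖ ≤ 34 * k * δ ^ 3 ∧ f k =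
      Complex.exp ((∑ j ∈ Finset.Icc 1 k, m j 1) + (∑ j ∈ Finset.Ico 1 k, m j 2) + r) := by
    intro k
    induction k with
    | zero => exact fun _ => ⟨0, by simp, by simp [f0]⟩
    | succ k ih =>
      intro hk
      obtain ⟨r, hr, hfr⟩ := ih (by omega)
      obtain ⟨u, hu1, hu2, hu3⟩ := ratio k (by omega)
      set e := m (k + 1) 1 + if 1 ≤ k then m k 2 else 0 with he
      have hu4 : ‖u‖ ≤ 10 / 64 := by nlinarith
      have hlog := Complex.norm_log_one_add_sub_self_le (z := u) (by linarith)
      have hlog' : ‖Complex.log (1 + u) - u‖ ≤ 8 * δ ^ 3 := by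
        refine hlog.trans ?_
        have a1 : (1 - ‖u‖)⁻¹ ≤ 64 / 54 := by
          rw [inv_le_comm₀ (by linarith) (by norm_num)]; linarith
        have a2 : ‖u‖ ^ 2 ≤ (10 * δ ^ 2) ^ 2 := by gcongr
        calc ‖u‖ ^ 2 * (1 - ‖u‖)⁻¹ / 2 ≤ (10 * δ ^ 2) ^ 2 * (64 / 54) / 2 := by
              have : 0 ≤ (1 - ‖u‖)⁻¹ := inv_nonneg.2 (by linarith)
              gcongr
          _ = δ * δ ^ 3 * (6400 / 108) := by ring
          _ ≤ 1 / 8 * δ ^ 3 * (6400 / 108) := by gcongr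
          _ ≤ 8 * δ ^ 3 := by nlinarith [pow_nonneg hδ0 3]
      have hne : 1 + u ≠ 0 := fun h0 => by
        have : u = -1 := by linear_combination h0
        rw [this, norm_neg, norm_one] at hu4; norm_num at hu4
      refine ⟨r + (Complex.log (1 + u) - e), ?_, ?_⟩
      · calc ‖r + (Complex.log (1 + u) - e)‖ =
              ‖r + (Complex.log (1 + u) - u) + (u - e)‖ := by congr 1; ring
          _ ≤ 34 * k * δ ^ 3 + 8 * δ ^ 3 + 26 * δ ^ 3 := by
              refine (norm_add₃_le).trans ?_
              gcongr
          _ = _ := by push_cast; ring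
      · rw [hu1, hfr]
        nth_rewrite 1 [← Complex.exp_log hne]
        rw [← Complex.exp_add]
        congr 1
        rw [hsucc, Finset.sum_insert (hnot k), he]
        by_cases hk1 : 1 ≤ k
        · rw [Finset.sum_Ico_succ_top hk1, if_pos hk1]; ring
        · obtain rfl : k = 0 := by omega
          simp
          ring
  obtain ⟨r, hr, hfr⟩ := main n le_rfl
  refine ⟨r, hr, ?_⟩
  simp only [hm1, hm2] at hfr
  exact hfr

end

/-! ### Consequences of the product expansion -/

section

variable {Ω : Type*} [MeasurableSpace Ω]

/-- The product expansion as an upper bound: second moments and means of order `δ ^ 2` suffice for a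
bound of the independent type. -/
lemma OneDependent.norm_integral_prod_one_add_le {μ : Measure Ω} [IsProbabilityMeasure μ]
    {ξ : ℕ → Ω → ℝ} (h : OneDependent ξ μ) (hξ : ∀ i, 1 ≤ i → Measurable (ξ i))
    {F : ℕ → ℝ → ℂ} (hF : ∀ j, Measurable (F j)) (hb : ∀ j, ∃ K, ∀ y, ‖F j y‖ ≤ K)
    {n : ℕ} {δ : ℝ} (hδ0 : 0 ≤ δ) (hδ : δ ≤ 1 / 8)
    (h2 : ∀ i, 1 ≤ i → i ≤ n → ∫ ω, ‖F i (ξ i ω)‖ ^ 2 ∂μ ≤ δ ^ 2)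
    (h1 : ∀ i, 1 ≤ i → i ≤ n → ‖∫ ω, F i (ξ i ω) ∂μ‖ ≤ δ ^ 2) :
    ‖∫ ω, ∏ j ∈ Finset.Icc 1 n, (1 + F j (ξ j ω)) ∂μ‖ ≤ Real.exp (7 * (n * δ ^ 2)) := by
  obtain ⟨r, hr, he⟩ := h.exists_integral_prod_eq_exp hξ hF hb hδ0 hδ h2 h1
  rw [he, Complex.norm_exp]
  refine Real.exp_le_exp.2 ((Complex.re_le_norm _).trans ?_)
  have e1 : ‖∑ j ∈ Finset.Icc 1 n, ∫ ω, F j (ξ j ω) ∂μ‖ ≤ n * δ ^ 2 := by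
    refine (norm_sum_le_of_le _ fun j hj => ?_).trans (b := ∑ j ∈ Finset.Icc 1 n, δ ^ 2) ?_
    · rw [Finset.mem_Icc] at hj; exact h1 j hj.1 hj.2
    · simp
  have e2 : ‖∑ j ∈ Finset.Ico 1 n, ∫ ω, F j (ξ j ω) * F (j + 1) (ξ (j + 1) ω) ∂μ‖ ≤
      n * δ ^ 2 := by
    refine (norm_sum_le_of_le _ fun j hj => ?_).trans (b := ∑ j ∈ Finset.Ico 1 n, δ ^ 2) ?_
    · rw [Finset.mem_Ico] at hj
      have := h.norm_integral_prod_le hξ hF hb hδ0 {j, j + 1} (by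
        intro i hi; simp at hi; omega) (by
        intro i hi; simp at hi; exact h2 i (by omega) (by omega))
      simpa using this
    · simp only [Finset.sum_const, Nat.card_Ico, nsmul_eq_mul]
      gcongr; omega
  have e3 : 34 * n * δ ^ 3 ≤ 5 * (n * δ ^ 2) := by
    have : 0 ≤ n * δ ^ 2 := by positivity
    nlinarith
  refine (norm_add₃_le).trans ?_
  linarith

/-- Inserting `g (ξ i)` into an expectation of a product of factors bounded above and below
multiplies the expectation by at most `K ^ 6 * E g (ξ i)`: the three factors next to `i` are
replaced by constants, after which `ξ i` is independent of the rest. -/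
lemma OneDependent.integral_mul_prod_le {μ : Measure Ω} [IsProbabilityMeasure μ]
    {ξ : ℕ → Ω → ℝ} (h : OneDependent ξ μ) (hξ : ∀ i, 1 ≤ i → Measurable (ξ i))
    {F : ℕ → ℝ → ℝ} (hF : ∀ j, Measurable (F j)) {K : ℝ} (hK : 1 ≤ K)
    (hF1 : ∀ j y, K⁻¹ ≤ F j y) (hF2 : ∀ j y, F j y ≤ K) {g : ℝ → ℝ} (hg : Measurable g)
    (hg0 : ∀ y, 0 ≤ g y) (hg1 : ∀ y, g y ≤ 1) {n i : ℕ} (hi : 1 ≤ i) :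
    ∫ ω, g (ξ i ω) * ∏ j ∈ Finset.Icc 1 n, F j (ξ j ω) ∂μ ≤
      K ^ 6 * (∫ ω, g (ξ i ω) ∂μ) * ∫ ω, ∏ j ∈ Finset.Icc 1 n, F j (ξ j ω) ∂μ := by
  have hK0 : 0 < K := by linarith
  have hFpos : ∀ j y, 0 < F j y := fun j y => (inv_pos.2 hK0).trans_le (hF1 j y)
  set I₁ := (Finset.Icc 1 n).filter fun j => j + 2 ≤ i
  set J := (Finset.Icc 1 n).filter fun j => ¬ j + 2 ≤ i
  set I₂ := J.filter fun j => i + 2 ≤ j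
  set M := J.filter fun j => ¬ i + 2 ≤ j
  have hsplit : ∀ ω, ∏ j ∈ Finset.Icc 1 n, F j (ξ j ω) =
      (∏ j ∈ I₁, F j (ξ j ω)) * (∏ j ∈ I₂, F j (ξ j ω)) * ∏ j ∈ M, F j (ξ j ω) := fun ω => by
    rw [mul_assoc, Finset.prod_filter_mul_prod_filter_not, Finset.prod_filter_mul_prod_filter_not]
  have hMcard : M.card ≤ 3 := by
    have : M ⊆ Finset.Icc (i - 1) (i + 1) := by
      intro j hj
      simp only [M, J, Finset.mem_filter, Finset.mem_Icc] at hj ⊢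
      omega
    refine (Finset.card_le_card this).trans ?_
    simp; omega
  have hM1 : ∀ ω, ∏ j ∈ M, F j (ξ j ω) ≤ K ^ 3 := fun ω =>
    calc ∏ j ∈ M, F j (ξ j ω) ≤ ∏ j ∈ M, K :=
          Finset.prod_le_prod (fun j _ => (hFpos _ _).le) fun j _ => hF2 _ _
      _ = K ^ M.card := by simp
      _ ≤ K ^ 3 := pow_le_pow_right₀ hK hMcard
  have hM2 : ∀ ω, 1 ≤ K ^ 3 * ∏ j ∈ M, F j (ξ j ω) := fun ω =>
    calc 1 ≤ K ^ 3 * (K⁻¹) ^ M.card := by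
          rw [inv_pow, ← div_eq_mul_inv, one_le_div (by positivity)]
          exact pow_le_pow_right₀ hK hMcard
      _ = K ^ 3 * ∏ j ∈ M, K⁻¹ := by simp
      _ ≤ _ := by
          refine mul_le_mul_of_nonneg_left ?_ (by positivity)
          exact Finset.prod_le_prod (fun j _ => by positivity) fun j _ => hF1 _ _
  have pos : ∀ (I : Finset ℕ) ω, 0 < ∏ j ∈ I, F j (ξ j ω) := fun I ω =>
    Finset.prod_pos fun j _ => hFpos _ _
  have hI1 : ∀ j ∈ I₁, 1 ≤ j ∧ j + 2 ≤ i := fun j hj => by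
    simp only [I₁, Finset.mem_filter, Finset.mem_Icc] at hj; omega
  have hI2 : ∀ j ∈ I₂, i + 2 ≤ j := fun j hj => by
    simp only [I₂, Finset.mem_filter] at hj; omega
  have hmeas : ∀ I : Finset ℕ, (∀ j ∈ I, 1 ≤ j) → Measurable fun ω => ∏ j ∈ I, F j (ξ j ω) :=
    fun I hI => Finset.measurable_fun_prod I fun j hj => (hF j).comp (hξ j (hI j hj))
  have hbd : ∀ (I : Finset ℕ) ω, |∏ j ∈ I, F j (ξ j ω)| ≤ K ^ I.card := fun I ω => by
    rw [abs_of_pos (pos I ω)]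
    calc ∏ j ∈ I, F j (ξ j ω) ≤ ∏ j ∈ I, K :=
          Finset.prod_le_prod (fun j _ => (hFpos _ _).le) fun j _ => hF2 _ _
      _ = _ := by simp
  have m1 := hmeas I₁ fun j hj => (hI1 j hj).1
  have m2 := hmeas I₂ fun j hj => by have := hI2 j hj; omega
  have m := hmeas (Finset.Icc 1 n) fun j hj => (Finset.mem_Icc.1 hj).1
  have mg : Measurable fun ω => g (ξ i ω) := hg.comp (hξ i hi)
  have i12 : Integrable (fun ω => (∏ j ∈ I₁, F j (ξ j ω)) * ∏ j ∈ I₂, F j (ξ j ω)) μ :=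
    integrable_of_measurable_of_bound (m1.mul m2) (K := K ^ I₁.card * K ^ I₂.card) fun ω => by
      rw [norm_mul]
      exact mul_le_mul (hbd _ _) (hbd _ _) (norm_nonneg _) (by positivity)
  have i0 : Integrable (fun ω => ∏ j ∈ Finset.Icc 1 n, F j (ξ j ω)) μ :=
    integrable_of_measurable_of_bound m (hbd _)
  have ig12 : Integrable (fun ω => (∏ j ∈ I₁, F j (ξ j ω)) * g (ξ i ω) *
      ∏ j ∈ I₂, F j (ξ j ω)) μ := by
    refine i12.mono ((m1.mul mg).mul m2).aestronglyMeasurable (ae_of_all _ fun ω => ?_)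
    rw [norm_mul, norm_mul, norm_mul, mul_right_comm]
    refine mul_le_of_le_one_right (by positivity) ?_
    rw [Real.norm_eq_abs, abs_of_nonneg (hg0 _)]; exact hg1 _
  have ig0 : Integrable (fun ω => g (ξ i ω) * ∏ j ∈ Finset.Icc 1 n, F j (ξ j ω)) μ := by
    refine i0.mono (mg.mul m).aestronglyMeasurable (ae_of_all _ fun ω => ?_)
    rw [norm_mul]
    refine mul_le_of_le_one_left (by positivity) ?_
    rw [Real.norm_eq_abs, abs_of_nonneg (hg0 _)]; exact hg1 _
  have s1 : ∫ ω, g (ξ i ω) * ∏ j ∈ Finset.Icc 1 n, F j (ξ j ω) ∂μ ≤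
      K ^ 3 * ∫ ω, (∏ j ∈ I₁, F j (ξ j ω)) * g (ξ i ω) * ∏ j ∈ I₂, F j (ξ j ω) ∂μ := by
    rw [← integral_const_mul]
    refine integral_mono ig0 (ig12.const_mul _) fun ω => ?_
    simp only [hsplit]
    have := hM1 ω
    have h0 : 0 ≤ g (ξ i ω) * ((∏ j ∈ I₁, F j (ξ j ω)) * ∏ j ∈ I₂, F j (ξ j ω)) :=
      mul_nonneg (hg0 _) (mul_nonneg (pos _ _).le (pos _ _).le)
    nlinarith [mul_le_mul_of_nonneg_left this h0]
  have s2 : ∫ ω, (∏ j ∈ I₁, F j (ξ j ω)) * ∏ j ∈ I₂, F j (ξ j ω) ∂μ ≤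
      K ^ 3 * ∫ ω, ∏ j ∈ Finset.Icc 1 n, F j (ξ j ω) ∂μ := by
    rw [← integral_const_mul]
    refine integral_mono i12 (i0.const_mul _) fun ω => ?_
    simp only [hsplit]
    have h0 : 0 ≤ (∏ j ∈ I₁, F j (ξ j ω)) * ∏ j ∈ I₂, F j (ξ j ω) :=
      mul_nonneg (pos _ _).le (pos _ _).le
    nlinarith [mul_le_mul_of_nonneg_left (hM2 ω) h0]
  have f1 : ∫ ω, (∏ j ∈ I₁, F j (ξ j ω)) * g (ξ i ω) * ∏ j ∈ I₂, F j (ξ j ω) ∂μ =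
      (∫ ω, (∏ j ∈ I₁, F j (ξ j ω)) * g (ξ i ω) ∂μ) * ∫ ω, ∏ j ∈ I₂, F j (ξ j ω) ∂μ :=
    h.integral_mul (𝕜 := ℝ) hξ i
      ((measurable_prod_iSup_comap (s := Set.Icc 1 i)
          (fun j hj => ⟨(hI1 j hj).1, by have := hI1 j hj; omega⟩) hF).mul
        (measurable_iSup_comap (Set.mem_Icc.2 ⟨hi, le_rfl⟩) hg))
      (measurable_prod_iSup_comap hI2 hF)
  have f2 : ∫ ω, (∏ j ∈ I₁, F j (ξ j ω)) * g (ξ i ω) ∂μ =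
      (∫ ω, ∏ j ∈ I₁, F j (ξ j ω) ∂μ) * ∫ ω, g (ξ i ω) ∂μ := by
    by_cases hI : I₁ = ∅
    · simp [hI]
    · obtain ⟨j₀, hj₀⟩ := Finset.nonempty_iff_ne_empty.2 hI
      have := hI1 j₀ hj₀
      exact h.integral_mul (𝕜 := ℝ) hξ (i - 2)
        (measurable_prod_iSup_comap (s := Set.Icc 1 (i - 2))
          (fun j hj => by have := hI1 j hj; exact ⟨by omega, by omega⟩) hF)
        (measurable_iSup_comap (Set.mem_Ici.2 (by omega)) hg)
  have f3 : ∫ ω, (∏ j ∈ I₁, F j (ξ j ω)) * ∏ j ∈ I₂, F j (ξ j ω) ∂μ =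
      (∫ ω, ∏ j ∈ I₁, F j (ξ j ω) ∂μ) * ∫ ω, ∏ j ∈ I₂, F j (ξ j ω) ∂μ :=
    h.integral_prod_mul_prod (𝕜 := ℝ) hξ i (fun j hj => by have := hI1 j hj; omega) hI2 hF hF
  have hgi : 0 ≤ ∫ ω, g (ξ i ω) ∂μ := integral_nonneg fun ω => hg0 _
  calc _ ≤ K ^ 3 * ((∫ ω, g (ξ i ω) ∂μ) *
        ∫ ω, (∏ j ∈ I₁, F j (ξ j ω)) * ∏ j ∈ I₂, F j (ξ j ω) ∂μ) := by
        refine s1.trans_eq ?_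
        rw [f1, f2, f3]; ring
    _ ≤ K ^ 3 * ((∫ ω, g (ξ i ω) ∂μ) * (K ^ 3 * ∫ ω, ∏ j ∈ Finset.Icc 1 n, F j (ξ j ω) ∂μ)) := by
        gcongr
    _ = _ := by ring

end

/-! ### Truncation and pointwise expansion of the exponential factors -/

section

lemma norm_exp_sub_sum_le {v : ℂ} {R : ℝ} (hR : 0 ≤ R) (hv : v.re ≤ R) :
    ‖Complex.exp v - 1‖ ≤ 4 * Real.exp R * ‖v‖ ∧
    ‖Complex.exp v - 1 - v‖ ≤ 4 * Real.exp R * ‖v‖ ^ 2 ∧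
    ‖Complex.exp v - 1 - v - v ^ 2 / 2‖ ≤ 4 * Real.exp R * ‖v‖ ^ 3 := by
  have hE : 1 ≤ Real.exp R := Real.one_le_exp hR
  have h0 : 0 ≤ ‖v‖ := norm_nonneg v
  rcases le_or_gt ‖v‖ 1 with h1 | h1
  · have he : Real.exp ‖v‖ ≤ 4 * Real.exp R := by
      have := Real.exp_one_lt_d9
      have := Real.exp_le_exp.2 h1
      linarith
    have key : ∀ k : ℕ, ‖v‖ ^ k * Real.exp ‖v‖ ≤ 4 * Real.exp R * ‖v‖ ^ k := fun k => by
      rw [mul_comm]; gcongr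
    have a1 := (Complex.norm_exp_sub_sum_le_norm_mul_exp v 1).trans (key 1)
    have a2 := (Complex.norm_exp_sub_sum_le_norm_mul_exp v 2).trans (key 2)
    have a3 := (Complex.norm_exp_sub_sum_le_norm_mul_exp v 3).trans (key 3)
    simp only [Finset.sum_range_succ, Finset.sum_range_zero, pow_zero, pow_one, zero_add,
      Nat.factorial, Nat.cast_one, div_one, mul_one, Nat.mul_one] at a1 a2 a3
    refine ⟨a1, by rwa [sub_sub], by rwa [sub_sub, sub_sub, ← add_assoc]⟩
  · have he : ‖Complex.exp v‖ ≤ Real.exp R := by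
      rw [Complex.norm_exp]; exact Real.exp_le_exp.2 hv
    have hv2 : ‖v‖ ≤ ‖v‖ ^ 2 := by nlinarith
    have hv3 : ‖v‖ ^ 2 ≤ ‖v‖ ^ 3 := by nlinarith [sq_nonneg ‖v‖]
    have b1 : ‖Complex.exp v - 1‖ ≤ Real.exp R + 1 :=
      (norm_sub_le _ _).trans (by rw [norm_one]; linarith)
    have b2 : ‖Complex.exp v - 1 - v‖ ≤ Real.exp R + 1 + ‖v‖ :=
      (norm_sub_le _ _).trans (by linarith)
    have b3 : ‖Complex.exp v - 1 - v - v ^ 2 / 2‖ ≤ Real.exp R + 1 + ‖v‖ + ‖v‖ ^ 2 / 2 :=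
      (norm_sub_le _ _).trans (by rw [norm_div, norm_pow]; norm_num; linarith)
    have c1 : Real.exp R ≤ Real.exp R * ‖v‖ := by nlinarith
    have c2 : Real.exp R * ‖v‖ ≤ Real.exp R * ‖v‖ ^ 2 := by gcongr
    have c3 : Real.exp R * ‖v‖ ^ 2 ≤ Real.exp R * ‖v‖ ^ 3 := by gcongr
    have d1 : ‖v‖ ≤ Real.exp R * ‖v‖ := by nlinarith
    have d2 : ‖v‖ ^ 2 ≤ Real.exp R * ‖v‖ ^ 2 := by nlinarith [sq_nonneg ‖v‖]
    refine ⟨by linarith, by linarith, by linarith⟩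

/-- Truncation at level `τ`. -/
noncomputable def trunc (τ y : ℝ) : ℝ := if |y| ≤ τ then y else 0

/-- The indicator of the values beyond the truncation level. -/
noncomputable def exceed (τ y : ℝ) : ℝ := if |y| ≤ τ then 0 else 1

/-- The summand of the linearised statistic: with `Z = trunc τ y`, the inequality
`∑ Z > x (∑ Z ^ 2) ^ (1 / 2)` is, to first order around `∑ Z ^ 2 ≈ ∑ s = 1`, the inequality
`∑ (Z - x / 2 * (Z ^ 2 - s)) > x`. -/
noncomputable def linTerm (τ x s y : ℝ) : ℝ := trunc τ y - x / 2 * (trunc τ y ^ 2 - s)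

/-- The deviation from one of the factors whose product is `exp (z W + c N)`, where `W` is the sum
of the linearised terms and `N` the number of values beyond the truncation level. -/
noncomputable def twist (z : ℂ) (c τ x s y : ℝ) : ℂ :=
  Complex.exp (z * linTerm τ x s y + c * exceed τ y) - 1

lemma measurableSet_abs_le (τ : ℝ) : MeasurableSet {y : ℝ | |y| ≤ τ} :=
  measurableSet_le measurable_id.abs measurable_const

lemma measurable_trunc (τ : ℝ) : Measurable (trunc τ) :=
  Measurable.ite (measurableSet_abs_le τ) measurable_id measurable_const

lemma measurable_exceed (τ : ℝ) : Measurable (exceed τ) :=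
  Measurable.ite (measurableSet_abs_le τ) measurable_const measurable_const

lemma measurable_linTerm (τ x s : ℝ) : Measurable (linTerm τ x s) := by
  have := measurable_trunc τ
  unfold linTerm
  fun_prop

lemma measurable_twist (z : ℂ) (c τ x s : ℝ) : Measurable (twist z c τ x s) := by
  have := measurable_linTerm τ x s
  have := measurable_exceed τ
  unfold twist
  fun_prop

lemma exceed_nonneg (τ y : ℝ) : 0 ≤ exceed τ y := by
  unfold exceed; split_ifs <;> norm_num

lemma exceed_le_one (τ y : ℝ) : exceed τ y ≤ 1 := by
  unfold exceed; split_ifs <;> norm_num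

lemma abs_trunc_le {τ : ℝ} (hτ : 0 ≤ τ) (y : ℝ) : |trunc τ y| ≤ τ := by
  unfold trunc; split_ifs with h
  · exact h
  · simpa using hτ

section Pointwise

variable {τ x s α y h : ℝ}

lemma exceed_le_div (hτ : 0 < τ) (hh : |y| ≤ h) (k : ℕ) : exceed τ y ≤ h ^ k / τ ^ k := by
  have h0 : 0 ≤ h := (abs_nonneg y).trans hh
  unfold exceed; split_ifs with hy
  · positivity
  · rw [one_le_div (by positivity)]
    exact pow_le_pow_left₀ hτ.le (by linarith [not_le.1 hy]) k

lemma abs_trunc_sq_sub_le (hτ : 0 < τ) (hh : |y| ≤ h) :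
    |trunc τ y ^ 2 - y ^ 2| ≤ h ^ 4 / τ ^ 2 := by
  have h0 : 0 ≤ h := (abs_nonneg y).trans hh
  unfold trunc; split_ifs with hy
  · simp; positivity
  · have hy' := not_le.1 hy
    rw [le_div_iff₀ (by positivity)]
    have : |(0 : ℝ) ^ 2 - y ^ 2| = |y| ^ 2 := by simp
    rw [this]
    calc |y| ^ 2 * τ ^ 2 ≤ h ^ 2 * h ^ 2 := by gcongr; linarith
      _ = h ^ 4 := by ring

lemma abs_linTerm_le (hτ : 0 < τ) (hs : 0 ≤ s) (hsα : s ≤ α ^ 2) (hα : 0 ≤ α) (hατ : α ≤ τ)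
    (hx : 0 ≤ x) (hxτ : x * τ ≤ 1) : |linTerm τ x s y| ≤ 2 * τ := by
  have h1 := abs_le.1 (abs_trunc_le hτ.le y)
  set Z := trunc τ y
  have e1 : Z ^ 2 ≤ τ ^ 2 := sq_le_sq' h1.1 h1.2
  have e2 : s ≤ τ ^ 2 := hsα.trans (by gcongr)
  have e3 : x * Z ^ 2 ≤ τ := by nlinarith
  have e4 : x * s ≤ τ := by nlinarith
  have e5 : 0 ≤ x * s := by positivity
  have e6 : 0 ≤ x * Z ^ 2 := by positivity
  unfold linTerm
  rw [abs_le]; constructor <;> nlinarith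

lemma abs_linTerm_le_two_mul (hτ : 0 < τ) (hs : 0 ≤ s) (hsα : s ≤ α ^ 2) (hα : 0 ≤ α)
    (hατ : α ≤ τ) (hx : 0 ≤ x) (hxτ : x * τ ≤ 1) (hh : |y| + α ≤ h) :
    |linTerm τ x s y| ≤ 2 * h := by
  have h1 := abs_trunc_le hτ.le y
  have h2 : |trunc τ y| ≤ |y| := by unfold trunc; split_ifs <;> simp
  unfold linTerm
  set Z := trunc τ y
  have e3 : x * Z ^ 2 ≤ |y| := by
    rw [← sq_abs]
    calc x * |Z| ^ 2 = x * |Z| * |Z| := by ring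
      _ ≤ x * τ * |y| := by gcongr
      _ ≤ 1 * |y| := by gcongr
      _ = _ := one_mul _
  have e4 : x * s ≤ α := by
    calc x * s ≤ x * (α * α) := by gcongr; linarith [sq α]
      _ = x * α * α := by ring
      _ ≤ x * τ * α := by gcongr
      _ ≤ 1 * α := by gcongr
      _ = _ := one_mul _
  have e5 : 0 ≤ x * s := by positivity
  have e6 : 0 ≤ x * Z ^ 2 := by positivity
  have := abs_le.1 h2
  have := abs_nonneg y
  rw [abs_le]; constructor <;> nlinarith

lemma abs_linTerm_sub_le (hτ : 0 < τ) (hx : 0 ≤ x) (hxτ : x * τ ≤ 1) (hh : |y| ≤ h) :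
    |linTerm τ x s y - (y - x / 2 * (y ^ 2 - s))| ≤ 2 * (h ^ 4 / τ ^ 3) := by
  have h0 : 0 ≤ h := (abs_nonneg y).trans hh
  unfold linTerm trunc; split_ifs with hy
  · simp; positivity
  · have hy' := not_le.1 hy
    have e : (0 : ℝ) - x / 2 * (0 ^ 2 - s) - (y - x / 2 * (y ^ 2 - s)) = x / 2 * y ^ 2 - y := by
      ring
    rw [e, ← mul_div_assoc, le_div_iff₀ (by positivity)]
    have e1 : |x / 2 * y ^ 2 - y| ≤ x / 2 * |y| ^ 2 + |y| := by
      refine (abs_sub _ _).trans ?_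
      rw [sq_abs, abs_of_nonneg (by positivity : 0 ≤ x / 2 * y ^ 2)]
    calc |x / 2 * y ^ 2 - y| * τ ^ 3 ≤ (x / 2 * |y| ^ 2 + |y|) * τ ^ 3 := by gcongr
      _ = (x * τ) / 2 * (|y| ^ 2 * τ ^ 2) + |y| * τ ^ 3 := by ring
      _ ≤ 1 / 2 * (h ^ 2 * h ^ 2) + h * h ^ 3 := by
          have : τ ≤ h := by linarith
          gcongr
      _ ≤ 2 * h ^ 4 := by nlinarith [pow_nonneg h0 4]

lemma abs_linTerm_sub_self_le (hτ : 0 < τ) (hs : 0 ≤ s) (hsα : s ≤ α ^ 2) (hα : 0 ≤ α)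
    (hx : 0 ≤ x) (hh : |y| + α ≤ h) :
    |linTerm τ x s y - y| ≤ h ^ 3 / τ ^ 2 + x * h ^ 2 := by
  have hy0 := abs_nonneg y
  have h0 : 0 ≤ h := by linarith
  have e2 : s ≤ h ^ 2 := hsα.trans (by gcongr; linarith)
  have e1 : y ^ 2 ≤ h ^ 2 := by rw [← sq_abs]; gcongr; linarith
  have e3 : 0 ≤ h ^ 3 / τ ^ 2 := by positivity
  unfold linTerm trunc; split_ifs with hy
  · have : y - x / 2 * (y ^ 2 - s) - y = x / 2 * (s - y ^ 2) := by ring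
    rw [this, abs_mul, abs_of_nonneg (by positivity : 0 ≤ x / 2)]
    have : |s - y ^ 2| ≤ h ^ 2 := by rw [abs_le]; constructor <;> nlinarith [sq_nonneg y]
    have : x / 2 * |s - y ^ 2| ≤ x / 2 * h ^ 2 := by gcongr
    nlinarith [mul_nonneg hx (sq_nonneg h)]
  · have hy' := not_le.1 hy
    have e4 : |y| ≤ h ^ 3 / τ ^ 2 := by
      rw [le_div_iff₀ (by positivity)]
      calc |y| * τ ^ 2 ≤ h * h ^ 2 := by gcongr <;> linarith
        _ = h ^ 3 := by ring
    have : (0 : ℝ) - x / 2 * (0 ^ 2 - s) - y = x / 2 * s - y := by ring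
    rw [this]
    refine (abs_sub _ _).trans ?_
    rw [abs_of_nonneg (by positivity : 0 ≤ x / 2 * s)]
    have : x / 2 * s ≤ x / 2 * h ^ 2 := by gcongr
    nlinarith [mul_nonneg hx (sq_nonneg h)]

lemma abs_linTerm_mul_sub_le {s' y' : ℝ} (hτ : 0 < τ) (hs : 0 ≤ s) (hsα : s ≤ α ^ 2)
    (hs' : 0 ≤ s') (hsα' : s' ≤ α ^ 2) (hα : 0 ≤ α) (hατ : α ≤ τ)
    (hx : 0 ≤ x) (hxτ : x * τ ≤ 1) (hh : |y| + α ≤ h) (hh' : |y'| + α ≤ h) :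
    |linTerm τ x s y * linTerm τ x s' y' - y * y'| ≤ 3 * (h ^ 4 / τ ^ 2 + x * h ^ 3) := by
  have h0 : 0 ≤ h := by linarith [abs_nonneg y]
  have a1 := abs_linTerm_sub_self_le hτ hs hsα hα hx hh
  have a2 := abs_linTerm_sub_self_le hτ hs' hsα' hα hx hh'
  have a3 := abs_linTerm_le_two_mul hτ hs' hsα' hα hατ hx hxτ hh'
  have e : linTerm τ x s y * linTerm τ x s' y' - y * y' =
      (linTerm τ x s y - y) * linTerm τ x s' y' + y * (linTerm τ x s' y' - y') := by ring
  rw [e]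
  refine (abs_add_le _ _).trans ?_
  rw [abs_mul, abs_mul]
  calc _ ≤ (h ^ 3 / τ ^ 2 + x * h ^ 2) * (2 * h) + h * (h ^ 3 / τ ^ 2 + x * h ^ 2) := by
        gcongr; linarith
    _ = _ := by ring

/-- The size of all the error terms in the expansion of the factors `1 + twist z c τ x s y`, as a
function of a common bound `h` for `|y|` and the moment scale. -/
noncomputable def expansionError (Z τ x h : ℝ) : ℝ :=
  Z ^ 3 * h ^ 3 + Z ^ 2 * (h ^ 4 / τ ^ 2 + x * h ^ 3) + Z * (h ^ 4 / τ ^ 3) + h ^ 4 / τ ^ 4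

variable {z : ℂ} {c R : ℝ}

lemma norm_twist_sub_exp_le (hR : 0 ≤ R) (hz : |z.re| * (2 * τ) ≤ R) (hc : 0 ≤ c) (hcR : c ≤ R)
    (hb : |linTerm τ x s y| ≤ 2 * τ) :
    (z * linTerm τ x s y).re ≤ R ∧
    ‖twist z c τ x s y - (Complex.exp (z * linTerm τ x s y) - 1)‖ ≤
      Real.exp (2 * R) * exceed τ y ∧ ‖twist z c τ x s y‖ ≤ 2 * Real.exp (2 * R) := by
  have hre : (z * linTerm τ x s y).re ≤ R := by
    rw [Complex.re_mul_ofReal]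
    refine (le_abs_self _).trans ?_
    rw [abs_mul]
    exact (mul_le_mul_of_nonneg_left hb (abs_nonneg _)).trans hz
  have hn : ‖Complex.exp (z * linTerm τ x s y)‖ ≤ Real.exp R := by
    rw [Complex.norm_exp]; exact Real.exp_le_exp.2 hre
  refine ⟨hre, ?_, ?_⟩
  · unfold twist exceed
    split_ifs with hy
    · simp
    · have e : Complex.exp (z * linTerm τ x s y + c * (1 : ℝ)) - 1 -
          (Complex.exp (z * linTerm τ x s y) - 1) =
          Complex.exp (z * linTerm τ x s y) * ((Real.exp c - 1 : ℝ) : ℂ) := by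
        rw [Complex.exp_add]; push_cast; ring_nf
      rw [e, norm_mul, Complex.norm_real, Real.norm_eq_abs,
        abs_of_nonneg (by linarith [Real.one_le_exp hc]), mul_one, two_mul, Real.exp_add]
      have : Real.exp c ≤ Real.exp R := Real.exp_le_exp.2 hcR
      have : 0 ≤ Real.exp c - 1 := by linarith [Real.one_le_exp hc]
      exact mul_le_mul hn (by linarith) this (Real.exp_pos _).le
  · unfold twist
    refine (norm_sub_le _ _).trans ?_
    rw [Complex.norm_exp, norm_one, Complex.add_re, Complex.re_mul_ofReal, Complex.re_mul_ofReal]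
    rw [Complex.re_mul_ofReal] at hre
    have e1 : (c : ℂ).re * exceed τ y ≤ R := by
      rw [Complex.ofReal_re]
      exact (mul_le_of_le_one_right hc (exceed_le_one _ _)).trans hcR
    have e2 : Real.exp (z.re * linTerm τ x s y + (c : ℂ).re * exceed τ y) ≤ Real.exp (2 * R) :=
      Real.exp_le_exp.2 (by linarith)
    have e3 : 1 ≤ Real.exp (2 * R) := Real.one_le_exp (by linarith)
    linarith

lemma norm_twist_le (hR : 0 ≤ R) (hz : |z.re| * (2 * τ) ≤ R) (hc : 0 ≤ c) (hcR : c ≤ R)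
    (hτ : 0 < τ) (hs : 0 ≤ s) (hsα : s ≤ α ^ 2) (hα : 0 ≤ α) (hατ : α ≤ τ)
    (hx : 0 ≤ x) (hxτ : x * τ ≤ 1) (hh : |y| + α ≤ h) :
    ‖twist z c τ x s y‖ ≤ Real.exp (2 * R) * (8 * ‖z‖ * h + exceed τ y) := by
  have hb := abs_linTerm_le (y := y) hτ hs hsα hα hατ hx hxτ
  have hb' := abs_linTerm_le_two_mul hτ hs hsα hα hατ hx hxτ hh
  obtain ⟨h1, h2, -⟩ := norm_twist_sub_exp_le hR hz hc hcR hb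
  have h3 := (norm_exp_sub_sum_le hR h1).1
  have h4 : ‖z * linTerm τ x s y‖ ≤ ‖z‖ * (2 * h) := by
    rw [norm_mul, Complex.norm_real, Real.norm_eq_abs]; gcongr
  have h5 : Real.exp R ≤ Real.exp (2 * R) := Real.exp_le_exp.2 (by linarith)
  calc ‖twist z c τ x s y‖ = ‖(twist z c τ x s y - (Complex.exp (z * linTerm τ x s y) - 1)) +
        (Complex.exp (z * linTerm τ x s y) - 1)‖ := by congr 1; ring
    _ ≤ Real.exp (2 * R) * exceed τ y + 4 * Real.exp (2 * R) * (‖z‖ * (2 * h)) := by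
        refine (norm_add_le _ _).trans (add_le_add h2 (h3.trans ?_))
        gcongr
    _ = _ := by ring

lemma norm_twist_sq_le (hR : 0 ≤ R) (hz : |z.re| * (2 * τ) ≤ R) (hc : 0 ≤ c) (hcR : c ≤ R)
    (hτ : 0 < τ) (hs : 0 ≤ s) (hsα : s ≤ α ^ 2) (hα : 0 ≤ α) (hατ : α ≤ τ)
    (hx : 0 ≤ x) (hxτ : x * τ ≤ 1) (hh : |y| + α ≤ h) :
    ‖twist z c τ x s y‖ ^ 2 ≤
      128 * Real.exp (2 * R) ^ 2 * (‖z‖ ^ 2 * h ^ 2 + h ^ 4 / τ ^ 4) := by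
  have hy0 := abs_nonneg y
  have h1 := norm_twist_le (c := c) hR hz hc hcR hτ hs hsα hα hατ hx hxτ hh
  have h2 := exceed_le_div (y := y) (h := h) hτ (by linarith) 4
  have h3 := exceed_nonneg τ y
  have h4 := exceed_le_one τ y
  have h5 : exceed τ y ^ 2 ≤ h ^ 4 / τ ^ 4 := by nlinarith
  have h0 : 0 ≤ ‖z‖ * h := mul_nonneg (norm_nonneg _) (by linarith)
  calc ‖twist z c τ x s y‖ ^ 2 ≤ (Real.exp (2 * R) * (8 * ‖z‖ * h + exceed τ y)) ^ 2 := by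
        gcongr
    _ = Real.exp (2 * R) ^ 2 * (8 * (‖z‖ * h) + exceed τ y) ^ 2 := by ring
    _ ≤ Real.exp (2 * R) ^ 2 * (128 * (‖z‖ * h) ^ 2 + 2 * exceed τ y ^ 2) := by
        gcongr; nlinarith [sq_nonneg (8 * (‖z‖ * h) - exceed τ y)]
    _ ≤ Real.exp (2 * R) ^ 2 * (128 * (‖z‖ * h) ^ 2 + 128 * (h ^ 4 / τ ^ 4)) := by
        gcongr; nlinarith [sq_nonneg (exceed τ y)]
    _ = _ := by ring

/-- Expansion of one factor to second order. The truncation is undone at the cost of fourth powers,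
and the quadratic term of `linTerm` enters only through its first-order contribution. -/
lemma norm_twist_sub_le (hR : 0 ≤ R) (hz : |z.re| * (2 * τ) ≤ R) (hc : 0 ≤ c) (hcR : c ≤ R)
    (hτ : 0 < τ) (hs : 0 ≤ s) (hsα : s ≤ α ^ 2) (hα : 0 ≤ α) (hατ : α ≤ τ)
    (hx : 0 ≤ x) (hxτ : x * τ ≤ 1) (hh : |y| + α ≤ h) :
    ‖twist z c τ x s y - (z * ((y - x / 2 * (y ^ 2 - s) : ℝ) : ℂ) + z ^ 2 / 2 * ((y ^ 2 : ℝ) : ℂ))‖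
      ≤ 40 * Real.exp (2 * R) ^ 2 * expansionError ‖z‖ τ x h := by
  have hy0 := abs_nonneg y
  have h0 : 0 ≤ h := by linarith
  have hb := abs_linTerm_le (y := y) hτ hs hsα hα hατ hx hxτ
  have hb' := abs_linTerm_le_two_mul hτ hs hsα hα hατ hx hxτ hh
  obtain ⟨h1, h2, -⟩ := norm_twist_sub_exp_le hR hz hc hcR hb
  have h3 := (norm_exp_sub_sum_le hR h1).2.2
  have hK : 1 ≤ Real.exp (2 * R) := Real.one_le_exp (by linarith)
  have h5 : Real.exp R ≤ Real.exp (2 * R) := Real.exp_le_exp.2 (by linarith)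
  set K := Real.exp (2 * R)
  have h4 : ‖z * linTerm τ x s y‖ ≤ ‖z‖ * (2 * h) := by
    rw [norm_mul, Complex.norm_real, Real.norm_eq_abs]; gcongr
  have h6 := exceed_le_div (y := y) (h := h) hτ (by linarith) 4
  have h7 := abs_linTerm_sub_le (s := s) (h := h) hτ hx hxτ (show |y| ≤ h by linarith)
  have h8 := abs_linTerm_mul_sub_le hτ hs hsα hs hsα hα hατ hx hxτ hh hh
  have e : twist z c τ x s y -
      (z * ((y - x / 2 * (y ^ 2 - s) : ℝ) : ℂ) + z ^ 2 / 2 * ((y ^ 2 : ℝ) : ℂ)) =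
      ((twist z c τ x s y - (Complex.exp (z * linTerm τ x s y) - 1)) +
      (Complex.exp (z * linTerm τ x s y) - 1 - z * linTerm τ x s y -
        (z * linTerm τ x s y) ^ 2 / 2)) +
      z * ((linTerm τ x s y - (y - x / 2 * (y ^ 2 - s)) : ℝ) : ℂ) +
      z ^ 2 / 2 * ((linTerm τ x s y * linTerm τ x s y - y * y : ℝ) : ℂ) := by
    push_cast; ring
  rw [e]
  refine (norm_add₃_le).trans ?_
  rw [norm_mul, norm_mul, Complex.norm_real, Complex.norm_real, norm_div, norm_pow,
    Real.norm_eq_abs, Real.norm_eq_abs]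
  have n2 : ‖(2 : ℂ)‖ = 2 := by norm_num
  rw [n2]
  have hz0 := norm_nonneg z
  calc _ ≤ (K * (h ^ 4 / τ ^ 4) + 4 * K * (‖z‖ * (2 * h)) ^ 3) + ‖z‖ * (2 * (h ^ 4 / τ ^ 3)) +
        ‖z‖ ^ 2 / 2 * (3 * (h ^ 4 / τ ^ 2 + x * h ^ 3)) := by
        gcongr
        refine (norm_add_le _ _).trans (add_le_add (h2.trans (by gcongr)) (h3.trans ?_))
        gcongr
    _ ≤ K * (32 * expansionError ‖z‖ τ x h) + 2 * expansionError ‖z‖ τ x h := by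
        unfold expansionError
        have p1 : 0 ≤ ‖z‖ ^ 3 * h ^ 3 := by positivity
        have p2 : 0 ≤ ‖z‖ ^ 2 * (h ^ 4 / τ ^ 2 + x * h ^ 3) := by positivity
        have p3 : 0 ≤ ‖z‖ * (h ^ 4 / τ ^ 3) := by positivity
        have p4 : 0 ≤ h ^ 4 / τ ^ 4 := by positivity
        have q2 := mul_le_mul_of_nonneg_right hK p2
        have q3 := mul_le_mul_of_nonneg_right hK p3
        have q4 := mul_le_mul_of_nonneg_right hK p4
        have q1 := mul_le_mul_of_nonneg_right hK p1
        linarith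
    _ ≤ 40 * K ^ 2 * expansionError ‖z‖ τ x h := by
        have : 0 ≤ expansionError ‖z‖ τ x h := by unfold expansionError; positivity
        nlinarith [mul_le_mul_of_nonneg_right hK this,
          mul_le_mul_of_nonneg_right (show K ≤ K ^ 2 by nlinarith) this]

/-- Only the product of the linear parts survives in the mixed second-order term. -/
lemma norm_twist_mul_sub_le {s' y' : ℝ} (hR : 0 ≤ R) (hz : |z.re| * (2 * τ) ≤ R) (hc : 0 ≤ c)
    (hcR : c ≤ R) (hτ : 0 < τ) (hs : 0 ≤ s) (hsα : s ≤ α ^ 2) (hs' : 0 ≤ s') (hsα' : s' ≤ α ^ 2)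
    (hα : 0 ≤ α) (hατ : α ≤ τ) (hx : 0 ≤ x) (hxτ : x * τ ≤ 1) (hh : |y| + α ≤ h)
    (hh' : |y'| + α ≤ h) :
    ‖twist z c τ x s y * twist z c τ x s' y' - z ^ 2 * ((y * y' : ℝ) : ℂ)‖
      ≤ 300 * Real.exp (2 * R) ^ 2 * expansionError ‖z‖ τ x h := by
  have hy0 := abs_nonneg y
  have h0 : 0 ≤ h := by linarith
  have hb := abs_linTerm_le (y := y) hτ hs hsα hα hατ hx hxτ
  have hb2 := abs_linTerm_le_two_mul hτ hs hsα hα hατ hx hxτ hh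
  have hb' := abs_linTerm_le (y := y') hτ hs' hsα' hα hατ hx hxτ
  have hb2' := abs_linTerm_le_two_mul hτ hs' hsα' hα hατ hx hxτ hh'
  have hK : 1 ≤ Real.exp (2 * R) := Real.one_le_exp (by linarith)
  have h5 : Real.exp R ≤ Real.exp (2 * R) := Real.exp_le_exp.2 (by linarith)
  -- the second-order remainder of a single factor
  have rem : ∀ {s y}, |linTerm τ x s y| ≤ 2 * τ → |linTerm τ x s y| ≤ 2 * h →
      ‖twist z c τ x s y - z * linTerm τ x s y‖ ≤
        Real.exp (2 * R) * (16 * ‖z‖ ^ 2 * h ^ 2 + exceed τ y) := by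
    intro s y hb hb2
    obtain ⟨h1, h2, -⟩ := norm_twist_sub_exp_le hR hz hc hcR hb
    have h3 := (norm_exp_sub_sum_le hR h1).2.1
    have h4 : ‖z * linTerm τ x s y‖ ≤ ‖z‖ * (2 * h) := by
      rw [norm_mul, Complex.norm_real, Real.norm_eq_abs]; gcongr
    calc ‖twist z c τ x s y - z * linTerm τ x s y‖ =
          ‖(twist z c τ x s y - (Complex.exp (z * linTerm τ x s y) - 1)) +
          (Complex.exp (z * linTerm τ x s y) - 1 - z * linTerm τ x s y)‖ := by congr 1; ring
      _ ≤ Real.exp (2 * R) * exceed τ y + 4 * Real.exp (2 * R) * (‖z‖ * (2 * h)) ^ 2 := by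
          refine (norm_add_le _ _).trans (add_le_add h2 (h3.trans ?_))
          gcongr
      _ = _ := by ring
  have r1 := rem hb hb2
  have r2 := rem hb' hb2'
  have t1 := norm_twist_le (c := c) hR hz hc hcR hτ hs' hsα' hα hατ hx hxτ hh'
  have t2 := (norm_twist_sub_exp_le hR hz hc hcR hb').2.2
  have h8 := abs_linTerm_mul_sub_le hτ hs hsα hs' hsα' hα hατ hx hxτ hh hh'
  set K := Real.exp (2 * R)
  have h4 : ‖z * linTerm τ x s y‖ ≤ ‖z‖ * (2 * h) := by
    rw [norm_mul, Complex.norm_real, Real.norm_eq_abs]; gcongr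
  have x4 := exceed_le_div (y := y) (h := h) hτ (by linarith) 4
  have x2' := exceed_le_div (y := y') (h := h) hτ (by linarith [abs_nonneg y']) 2
  have x3' := exceed_le_div (y := y') (h := h) hτ (by linarith [abs_nonneg y']) 3
  have hz0 := norm_nonneg z
  have e : twist z c τ x s y * twist z c τ x s' y' - z ^ 2 * ((y * y' : ℝ) : ℂ) =
      (twist z c τ x s y - z * linTerm τ x s y) * twist z c τ x s' y' +
      (z * linTerm τ x s y) * (twist z c τ x s' y' - z * linTerm τ x s' y') +
      z ^ 2 * ((linTerm τ x s y * linTerm τ x s' y' - y * y' : ℝ) : ℂ) := by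
    push_cast; ring
  have b1 : ‖(twist z c τ x s y - z * linTerm τ x s y) * twist z c τ x s' y'‖ ≤
      K ^ 2 * (16 * ‖z‖ ^ 2 * h ^ 2 * (8 * ‖z‖ * h + h ^ 2 / τ ^ 2) + 2 * (h ^ 4 / τ ^ 4)) := by
    rw [norm_mul]
    calc _ ≤ (K * (16 * ‖z‖ ^ 2 * h ^ 2 + exceed τ y)) * ‖twist z c τ x s' y'‖ := by gcongr
      _ = K * (16 * ‖z‖ ^ 2 * h ^ 2) * ‖twist z c τ x s' y'‖ +
          K * exceed τ y * ‖twist z c τ x s' y'‖ := by ring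
      _ ≤ K * (16 * ‖z‖ ^ 2 * h ^ 2) * (K * (8 * ‖z‖ * h + h ^ 2 / τ ^ 2)) +
          K * (h ^ 4 / τ ^ 4) * (2 * K) := by
          gcongr
          exact t1.trans (by gcongr)
      _ = _ := by ring
  have b2 : ‖(z * linTerm τ x s y) * (twist z c τ x s' y' - z * linTerm τ x s' y')‖ ≤
      K * (2 * ‖z‖ * h * (16 * ‖z‖ ^ 2 * h ^ 2 + h ^ 3 / τ ^ 3)) := by
    rw [norm_mul]
    calc _ ≤ (‖z‖ * (2 * h)) * (K * (16 * ‖z‖ ^ 2 * h ^ 2 + h ^ 3 / τ ^ 3)) := by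
          gcongr
          exact r2.trans (by gcongr)
      _ = _ := by ring
  have b3 : ‖z ^ 2 * ((linTerm τ x s y * linTerm τ x s' y' - y * y' : ℝ) : ℂ)‖ ≤
      ‖z‖ ^ 2 * (3 * (h ^ 4 / τ ^ 2 + x * h ^ 3)) := by
    rw [norm_mul, norm_pow, Complex.norm_real, Real.norm_eq_abs]; gcongr
  rw [e]
  refine (norm_add₃_le.trans (add_le_add_three b1 b2 b3)).trans ?_
  have hK2 : 1 ≤ K ^ 2 := one_le_pow₀ hK
  have hKK : K ≤ K ^ 2 := by nlinarith
  have p1 : 0 ≤ ‖z‖ ^ 3 * h ^ 3 := by positivity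
  have p2 : 0 ≤ ‖z‖ ^ 2 * (h ^ 4 / τ ^ 2 + x * h ^ 3) := by positivity
  have p2a : 0 ≤ ‖z‖ ^ 2 * (h ^ 4 / τ ^ 2) := by positivity
  have p2b : 0 ≤ ‖z‖ ^ 2 * (x * h ^ 3) := by positivity
  have p3 : 0 ≤ ‖z‖ * (h ^ 4 / τ ^ 3) := by positivity
  have p4 : 0 ≤ h ^ 4 / τ ^ 4 := by positivity
  calc _ ≤ K ^ 2 * (16 * ‖z‖ ^ 2 * h ^ 2 * (8 * ‖z‖ * h + h ^ 2 / τ ^ 2) + 2 * (h ^ 4 / τ ^ 4)) +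
        K ^ 2 * (2 * ‖z‖ * h * (16 * ‖z‖ ^ 2 * h ^ 2 + h ^ 3 / τ ^ 3)) +
        K ^ 2 * (‖z‖ ^ 2 * (3 * (h ^ 4 / τ ^ 2 + x * h ^ 3))) := by
        refine add_le_add_three le_rfl (mul_le_mul_of_nonneg_right hKK (by positivity))
          (le_mul_of_one_le_left (by positivity) hK2)
    _ = K ^ 2 * (160 * (‖z‖ ^ 3 * h ^ 3) + 19 * (‖z‖ ^ 2 * (h ^ 4 / τ ^ 2)) +
        3 * (‖z‖ ^ 2 * (x * h ^ 3)) + 2 * (‖z‖ * (h ^ 4 / τ ^ 3)) + 2 * (h ^ 4 / τ ^ 4)) := by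
        ring
    _ ≤ K ^ 2 * (300 * expansionError ‖z‖ τ x h) := by
        refine mul_le_mul_of_nonneg_left ?_ (by positivity)
        unfold expansionError
        rw [mul_add (‖z‖ ^ 2)]
        linarith
    _ = _ := by ring

end Pointwise

end

/-! ### Moment estimates and the Laplace transform of the linearised statistic -/

section

variable {Ω : Type*} [MeasurableSpace Ω]

section Moments

variable {μ : Measure Ω} [IsProbabilityMeasure μ] {X Y : Ω → ℝ} {α : ℝ}

lemma integrable_pow_of_integrable_pow_four {f : Ω → ℝ} (hf : Measurable f)
    (hf4 : Integrable (fun ω => f ω ^ 4) μ) {k : ℕ} (hk : k ≤ 4) :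
    Integrable (fun ω => f ω ^ k) μ := by
  refine Integrable.mono' ((integrable_const (1 : ℝ)).add hf4)
    (hf.pow_const k).aestronglyMeasurable (ae_of_all _ fun ω => ?_)
  have h4 : f ω ^ 4 = |f ω| ^ 4 := by rw [← abs_pow, abs_of_nonneg (by positivity)]
  rw [Real.norm_eq_abs, abs_pow, Pi.add_apply, h4]
  rcases le_total |f ω| 1 with h | h
  · have := pow_le_one₀ (n := k) (abs_nonneg (f ω)) h
    have : 0 ≤ |f ω| ^ 4 := by positivity
    linarith
  · have := pow_le_pow_right₀ h hk
    linarith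

lemma integral_sq_le_of_integral_pow_four_le (hα : 0 < α) (hX : Measurable X)
    (hX4 : Integrable (fun ω => X ω ^ 4) μ) (hXα : ∫ ω, X ω ^ 4 ∂μ ≤ α ^ 4) :
    ∫ ω, X ω ^ 2 ∂μ ≤ α ^ 2 := by
  have e : ∫ ω, (2 * α ^ 2) * X ω ^ 2 ∂μ ≤ ∫ ω, (X ω ^ 4 + α ^ 4) ∂μ :=
    integral_mono ((integrable_pow_of_integrable_pow_four hX hX4 (by norm_num)).const_mul _)
      (hX4.add (integrable_const _)) fun ω => by nlinarith [sq_nonneg (X ω ^ 2 - α ^ 2)]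
  rw [integral_const_mul, integral_add hX4 (integrable_const _)] at e
  simp only [integral_const, probReal_univ, smul_eq_mul, one_mul] at e
  have : 2 * α ^ 2 * ∫ ω, X ω ^ 2 ∂μ ≤ 2 * α ^ 2 * α ^ 2 := by nlinarith
  exact le_of_mul_le_mul_left this (by positivity)

/-- All the moments of order at most four of the common majorant `|X| + |Y| + α` are controlled at
once, because this majorant is at least `α`. -/
lemma integral_majorant_pow_le (hα : 0 < α) (hX : Measurable X) (hY : Measurable Y)
    (hX4 : Integrable (fun ω => X ω ^ 4) μ) (hXα : ∫ ω, X ω ^ 4 ∂μ ≤ α ^ 4)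
    (hY4 : Integrable (fun ω => Y ω ^ 4) μ) (hYα : ∫ ω, Y ω ^ 4 ∂μ ≤ α ^ 4) {k : ℕ} (hk : k ≤ 4) :
    Integrable (fun ω => (|X ω| + |Y ω| + α) ^ k) μ ∧
      ∫ ω, (|X ω| + |Y ω| + α) ^ k ∂μ ≤ 81 * α ^ k := by
  have hm : Measurable fun ω => |X ω| + |Y ω| + α := (hX.abs.add hY.abs).add_const α
  have hpt : ∀ ω, (|X ω| + |Y ω| + α) ^ 4 ≤ 27 * (X ω ^ 4 + Y ω ^ 4 + α ^ 4) := fun ω => by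
    have hx : X ω ^ 4 = |X ω| ^ 4 := by rw [← abs_pow, abs_of_nonneg (by positivity)]
    have hy : Y ω ^ 4 = |Y ω| ^ 4 := by rw [← abs_pow, abs_of_nonneg (by positivity)]
    rw [hx, hy]
    set u := |X ω|
    set v := |Y ω|
    have q : (u + v + α) ^ 2 ≤ 3 * (u ^ 2 + v ^ 2 + α ^ 2) := by
      nlinarith [sq_nonneg (u - v), sq_nonneg (u - α), sq_nonneg (v - α)]
    calc (u + v + α) ^ 4 = ((u + v + α) ^ 2) ^ 2 := by ring
      _ ≤ (3 * (u ^ 2 + v ^ 2 + α ^ 2)) ^ 2 := by gcongr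
      _ ≤ _ := by
        nlinarith [sq_nonneg (u ^ 2 - v ^ 2), sq_nonneg (u ^ 2 - α ^ 2), sq_nonneg (v ^ 2 - α ^ 2)]
  have hint : Integrable (fun ω => 27 * (X ω ^ 4 + Y ω ^ 4 + α ^ 4)) μ :=
    ((hX4.add hY4).add (integrable_const _)).const_mul _
  have h4 : Integrable (fun ω => (|X ω| + |Y ω| + α) ^ 4) μ :=
    hint.mono' (hm.pow_const 4).aestronglyMeasurable (ae_of_all _ fun ω => by
      rw [Real.norm_eq_abs, abs_of_nonneg (by positivity)]; exact hpt ω)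
  have hk4 := integrable_pow_of_integrable_pow_four hm h4 hk
  refine ⟨hk4, ?_⟩
  have e4 : ∫ ω, (|X ω| + |Y ω| + α) ^ 4 ∂μ ≤ 81 * α ^ 4 := by
    refine (integral_mono h4 hint hpt).trans ?_
    rw [integral_const_mul, integral_add
      (show Integrable (fun ω => X ω ^ 4 + Y ω ^ 4) μ from hX4.add hY4) (integrable_const _),
      integral_add hX4 hY4]
    simp only [integral_const, probReal_univ, smul_eq_mul, one_mul]
    linarith
  have e : α ^ (4 - k) * ∫ ω, (|X ω| + |Y ω| + α) ^ k ∂μ ≤ α ^ (4 - k) * (81 * α ^ k) := by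
    calc α ^ (4 - k) * ∫ ω, (|X ω| + |Y ω| + α) ^ k ∂μ
        = ∫ ω, α ^ (4 - k) * (|X ω| + |Y ω| + α) ^ k ∂μ := (integral_const_mul _ _).symm
      _ ≤ ∫ ω, (|X ω| + |Y ω| + α) ^ 4 ∂μ := by
          refine integral_mono (hk4.const_mul _) h4 fun ω => ?_
          simp only
          calc α ^ (4 - k) * (|X ω| + |Y ω| + α) ^ k ≤
                (|X ω| + |Y ω| + α) ^ (4 - k) * (|X ω| + |Y ω| + α) ^ k := by
                gcongr
                linarith [abs_nonneg (X ω), abs_nonneg (Y ω)]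
            _ = _ := by rw [← pow_add]; congr 1; omega
      _ ≤ 81 * α ^ 4 := e4
      _ = _ := by
          rw [show α ^ 4 = α ^ (4 - k) * α ^ k by rw [← pow_add]; congr 1; omega]; ring
  exact le_of_mul_le_mul_left e (by positivity)

lemma integral_expansionError_le {Z τ x : ℝ} (hZ : 0 ≤ Z) (hτ : 0 < τ) (hx : 0 ≤ x)
    (hα : 0 < α) (hX : Measurable X) (hY : Measurable Y)
    (hX4 : Integrable (fun ω => X ω ^ 4) μ) (hXα : ∫ ω, X ω ^ 4 ∂μ ≤ α ^ 4)
    (hY4 : Integrable (fun ω => Y ω ^ 4) μ) (hYα : ∫ ω, Y ω ^ 4 ∂μ ≤ α ^ 4) :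
    Integrable (fun ω => expansionError Z τ x (|X ω| + |Y ω| + α)) μ ∧
      ∫ ω, expansionError Z τ x (|X ω| + |Y ω| + α) ∂μ ≤ 81 * expansionError Z τ x α := by
  obtain ⟨i3, b3⟩ := integral_majorant_pow_le hα hX hY hX4 hXα hY4 hYα (k := 3) (by norm_num)
  obtain ⟨i4, b4⟩ := integral_majorant_pow_le hα hX hY hX4 hXα hY4 hYα (k := 4) le_rfl
  have e : (fun ω => expansionError Z τ x (|X ω| + |Y ω| + α)) = fun ω =>
      (Z ^ 3 + Z ^ 2 * x) * (|X ω| + |Y ω| + α) ^ 3 +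
      (Z ^ 2 / τ ^ 2 + Z / τ ^ 3 + 1 / τ ^ 4) * (|X ω| + |Y ω| + α) ^ 4 := by
    ext ω; unfold expansionError; ring
  rw [e]
  refine ⟨(i3.const_mul _).add (i4.const_mul _), ?_⟩
  rw [integral_add (i3.const_mul _) (i4.const_mul _), integral_const_mul, integral_const_mul]
  calc _ ≤ (Z ^ 3 + Z ^ 2 * x) * (81 * α ^ 3) +
        (Z ^ 2 / τ ^ 2 + Z / τ ^ 3 + 1 / τ ^ 4) * (81 * α ^ 4) := by gcongr
    _ = _ := by unfold expansionError; ring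

variable {τ x R c : ℝ} {z : ℂ}

lemma integrable_twist (hR : 0 ≤ R) (hz : |z.re| * (2 * τ) ≤ R) (hc : 0 ≤ c)
    (hcR : c ≤ R) (hτ : 0 < τ) {s : ℝ} (hs : 0 ≤ s) (hsα : s ≤ α ^ 2) (hα : 0 < α) (hατ : α ≤ τ)
    (hx : 0 ≤ x) (hxτ : x * τ ≤ 1) (hX : Measurable X) :
    Integrable (fun ω => twist z c τ x s (X ω)) μ :=
  integrable_of_measurable_of_bound ((measurable_twist _ _ _ _ _).comp hX) fun _ =>
    (norm_twist_sub_exp_le hR hz hc hcR (abs_linTerm_le hτ hs hsα hα.le hατ hx hxτ)).2.2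

lemma norm_integral_twist_sub_le (hR : 0 ≤ R) (hz : |z.re| * (2 * τ) ≤ R) (hc : 0 ≤ c)
    (hcR : c ≤ R) (hτ : 0 < τ) (hα : 0 < α) (hατ : α ≤ τ) (hx : 0 ≤ x) (hxτ : x * τ ≤ 1)
    (hX : Measurable X) (hX4 : Integrable (fun ω => X ω ^ 4) μ)
    (hXα : ∫ ω, X ω ^ 4 ∂μ ≤ α ^ 4) (hX0 : ∫ ω, X ω ∂μ = 0) :
    ‖∫ ω, twist z c τ x (∫ ω, X ω ^ 2 ∂μ) (X ω) ∂μ - z ^ 2 / 2 * ((∫ ω, X ω ^ 2 ∂μ : ℝ) : ℂ)‖ ≤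
      3240 * Real.exp (2 * R) ^ 2 * expansionError ‖z‖ τ x α := by
  set s := ∫ ω, X ω ^ 2 ∂μ with hsdef
  have hs : 0 ≤ s := integral_nonneg fun ω => sq_nonneg _
  have hsα : s ≤ α ^ 2 := integral_sq_le_of_integral_pow_four_le hα hX hX4 hXα
  obtain ⟨iE, bE⟩ := integral_expansionError_le (norm_nonneg z) hτ hx hα hX
    (measurable_const (a := (0 : ℝ))) hX4 hXα (by simp) (by simp; positivity)
  have i1 : Integrable X μ := by
    simpa using integrable_pow_of_integrable_pow_four hX hX4 (k := 1) (by norm_num)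
  have i2 : Integrable (fun ω => X ω ^ 2) μ :=
    integrable_pow_of_integrable_pow_four hX hX4 (by norm_num)
  have it : Integrable (fun ω => twist z c τ x s (X ω)) μ :=
    integrable_twist hR hz hc hcR hτ hs hsα hα hατ hx hxτ hX
  have il : Integrable (fun ω => X ω - x / 2 * (X ω ^ 2 - s)) μ :=
    i1.sub ((i2.sub (integrable_const _)).const_mul _)
  have e1 : ∫ ω, (X ω - x / 2 * (X ω ^ 2 - s)) ∂μ = 0 := by
    rw [integral_sub i1 (show Integrable (fun ω => x / 2 * (X ω ^ 2 - s)) μ from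
      (i2.sub (integrable_const _)).const_mul _), integral_const_mul,
      integral_sub i2 (integrable_const _), hX0]
    simp [hsdef]
  have i3 : Integrable (fun ω => z * ((X ω - x / 2 * (X ω ^ 2 - s) : ℝ) : ℂ) +
      z ^ 2 / 2 * ((X ω ^ 2 : ℝ) : ℂ)) μ :=
    (il.ofReal.const_mul _).add (i2.ofReal.const_mul _)
  have e2 : ∫ ω, (z * ((X ω - x / 2 * (X ω ^ 2 - s) : ℝ) : ℂ) +
      z ^ 2 / 2 * ((X ω ^ 2 : ℝ) : ℂ)) ∂μ = z ^ 2 / 2 * (s : ℂ) := by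
    rw [integral_add (il.ofReal.const_mul _) (i2.ofReal.const_mul _), integral_const_mul,
      integral_const_mul, integral_complex_ofReal, integral_complex_ofReal, e1]
    simp [hsdef]
  rw [← e2, ← integral_sub it i3]
  calc _ ≤ ∫ ω, 40 * Real.exp (2 * R) ^ 2 *
        expansionError ‖z‖ τ x (|X ω| + |(0 : ℝ)| + α) ∂μ := by
        refine norm_integral_le_of_norm_le (iE.const_mul _) (ae_of_all _ fun ω => ?_)
        exact norm_twist_sub_le hR hz hc hcR hτ hs hsα hα.le hατ hx hxτ (by simp)
    _ ≤ 40 * Real.exp (2 * R) ^ 2 * (81 * expansionError ‖z‖ τ x α) := by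
        rw [integral_const_mul]; gcongr
    _ = _ := by ring

lemma integral_norm_twist_sq_le (hR : 0 ≤ R) (hz : |z.re| * (2 * τ) ≤ R) (hc : 0 ≤ c)
    (hcR : c ≤ R) (hτ : 0 < τ) (hα : 0 < α) (hατ : α ≤ τ) (hx : 0 ≤ x) (hxτ : x * τ ≤ 1)
    (hX : Measurable X) (hX4 : Integrable (fun ω => X ω ^ 4) μ)
    (hXα : ∫ ω, X ω ^ 4 ∂μ ≤ α ^ 4) :
    ∫ ω, ‖twist z c τ x (∫ ω, X ω ^ 2 ∂μ) (X ω)‖ ^ 2 ∂μ ≤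
      10368 * Real.exp (2 * R) ^ 2 * (‖z‖ ^ 2 * α ^ 2 + α ^ 4 / τ ^ 4) := by
  set s := ∫ ω, X ω ^ 2 ∂μ with hsdef
  have hs : 0 ≤ s := integral_nonneg fun ω => sq_nonneg _
  have hsα : s ≤ α ^ 2 := integral_sq_le_of_integral_pow_four_le hα hX hX4 hXα
  obtain ⟨i2, b2⟩ := integral_majorant_pow_le hα hX (measurable_const (a := (0 : ℝ))) hX4 hXα
    (by simp) (by simp; positivity) (k := 2) (by norm_num)
  obtain ⟨i4, b4⟩ := integral_majorant_pow_le hα hX (measurable_const (a := (0 : ℝ))) hX4 hXα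
    (by simp) (by simp; positivity) (k := 4) le_rfl
  have hm : Measurable fun ω => ‖twist z c τ x s (X ω)‖ ^ 2 :=
    ((measurable_twist _ _ _ _ _).comp hX).norm.pow_const 2
  have hdom : Integrable (fun ω => 128 * Real.exp (2 * R) ^ 2 *
      (‖z‖ ^ 2 * (|X ω| + |(0 : ℝ)| + α) ^ 2 + (|X ω| + |(0 : ℝ)| + α) ^ 4 / τ ^ 4)) μ :=
    ((i2.const_mul _).add (i4.div_const _)).const_mul _
  have hpt : ∀ ω, ‖twist z c τ x s (X ω)‖ ^ 2 ≤ 128 * Real.exp (2 * R) ^ 2 *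
      (‖z‖ ^ 2 * (|X ω| + |(0 : ℝ)| + α) ^ 2 + (|X ω| + |(0 : ℝ)| + α) ^ 4 / τ ^ 4) := fun ω =>
    norm_twist_sq_le hR hz hc hcR hτ hs hsα hα.le hατ hx hxτ (by simp)
  have hint : Integrable (fun ω => ‖twist z c τ x s (X ω)‖ ^ 2) μ :=
    hdom.mono' hm.aestronglyMeasurable (ae_of_all _ fun ω => by
      rw [Real.norm_eq_abs, abs_of_nonneg (by positivity)]; exact hpt ω)
  refine (integral_mono hint hdom hpt).trans ?_
  rw [integral_const_mul, integral_add (i2.const_mul _) (i4.div_const _), integral_const_mul,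
    integral_div]
  calc _ ≤ 128 * Real.exp (2 * R) ^ 2 * (‖z‖ ^ 2 * (81 * α ^ 2) + 81 * α ^ 4 / τ ^ 4) := by
        gcongr
    _ = _ := by ring

lemma norm_integral_twist_mul_sub_le (hR : 0 ≤ R) (hz : |z.re| * (2 * τ) ≤ R) (hc : 0 ≤ c)
    (hcR : c ≤ R) (hτ : 0 < τ) (hα : 0 < α) (hατ : α ≤ τ) (hx : 0 ≤ x) (hxτ : x * τ ≤ 1)
    (hX : Measurable X) (hX4 : Integrable (fun ω => X ω ^ 4) μ)
    (hXα : ∫ ω, X ω ^ 4 ∂μ ≤ α ^ 4) (hY : Measurable Y)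
    (hY4 : Integrable (fun ω => Y ω ^ 4) μ) (hYα : ∫ ω, Y ω ^ 4 ∂μ ≤ α ^ 4) :
    ‖∫ ω, twist z c τ x (∫ ω, X ω ^ 2 ∂μ) (X ω) * twist z c τ x (∫ ω, Y ω ^ 2 ∂μ) (Y ω) ∂μ -
        z ^ 2 * ((∫ ω, X ω * Y ω ∂μ : ℝ) : ℂ)‖ ≤
      24300 * Real.exp (2 * R) ^ 2 * expansionError ‖z‖ τ x α := by
  set s := ∫ ω, X ω ^ 2 ∂μ with hsdef
  set s' := ∫ ω, Y ω ^ 2 ∂μ with hsdef'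
  have hs : 0 ≤ s := integral_nonneg fun ω => sq_nonneg _
  have hsα : s ≤ α ^ 2 := integral_sq_le_of_integral_pow_four_le hα hX hX4 hXα
  have hs' : 0 ≤ s' := integral_nonneg fun ω => sq_nonneg _
  have hsα' : s' ≤ α ^ 2 := integral_sq_le_of_integral_pow_four_le hα hY hY4 hYα
  obtain ⟨iE, bE⟩ := integral_expansionError_le (norm_nonneg z) hτ hx hα hX hY hX4 hXα hY4 hYα
  have iX2 := integrable_pow_of_integrable_pow_four hX hX4 (k := 2) (by norm_num)
  have iY2 := integrable_pow_of_integrable_pow_four hY hY4 (k := 2) (by norm_num)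
  have iXY : Integrable (fun ω => X ω * Y ω) μ :=
    (iX2.add iY2).mono' (hX.mul hY).aestronglyMeasurable (ae_of_all _ fun ω => by
      rw [Real.norm_eq_abs, abs_le, Pi.add_apply]
      constructor <;> nlinarith [sq_nonneg (X ω + Y ω), sq_nonneg (X ω - Y ω)])
  have it : Integrable (fun ω => twist z c τ x s (X ω) * twist z c τ x s' (Y ω)) μ := by
    refine integrable_of_measurable_of_bound (((measurable_twist _ _ _ _ _).comp hX).mul
      ((measurable_twist _ _ _ _ _).comp hY))
      (K := 2 * Real.exp (2 * R) * (2 * Real.exp (2 * R))) fun ω => ?_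
    rw [norm_mul]
    exact mul_le_mul
      (norm_twist_sub_exp_le hR hz hc hcR (abs_linTerm_le hτ hs hsα hα.le hατ hx hxτ)).2.2
      (norm_twist_sub_exp_le hR hz hc hcR (abs_linTerm_le hτ hs' hsα' hα.le hατ hx hxτ)).2.2
      (norm_nonneg _) (by positivity)
  have e2 : ∫ ω, z ^ 2 * ((X ω * Y ω : ℝ) : ℂ) ∂μ = z ^ 2 * ((∫ ω, X ω * Y ω ∂μ : ℝ) : ℂ) := by
    rw [integral_const_mul, integral_complex_ofReal]
  rw [← e2, ← integral_sub it
    (show Integrable (fun ω => z ^ 2 * ((X ω * Y ω : ℝ) : ℂ)) μ from iXY.ofReal.const_mul _)]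
  calc _ ≤ ∫ ω, 300 * Real.exp (2 * R) ^ 2 *
        expansionError ‖z‖ τ x (|X ω| + |Y ω| + α) ∂μ := by
        refine norm_integral_le_of_norm_le (iE.const_mul _) (ae_of_all _ fun ω => ?_)
        exact norm_twist_mul_sub_le hR hz hc hcR hτ hs hsα hs' hsα' hα.le hατ hx hxτ
          (by linarith [abs_nonneg (Y ω)]) (by linarith [abs_nonneg (X ω)])
    _ ≤ 300 * Real.exp (2 * R) ^ 2 * (81 * expansionError ‖z‖ τ x α) := by
        rw [integral_const_mul]; gcongr
    _ = _ := by ring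

end Moments

/-- The standing hypotheses after division by `(∑ E ξ_i ^ 2) ^ (1 / 2)`: the variances add up to
one and the fourth moments are at most `α ^ 4` with `α = a / n ^ (1 / 2)`. The sample size enters
through `ν = n ^ (1 / 16)`, so that all the scales of the proof are integral powers of `ν`. -/
structure IsNormalized (ξ : ℕ → Ω → ℝ) (μ : Measure Ω) (n : ℕ) (a ν : ℝ) : Prop where
  measurable : ∀ i, 1 ≤ i → Measurable (ξ i)
  dep : OneDependent ξ μ
  one_le_ν : 1 ≤ ν
  ν_pow : ν ^ 16 = n
  one_le_a : 1 ≤ a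
  a_le : a ≤ ν
  integrable : ∀ i, 1 ≤ i → i ≤ n → Integrable (fun ω => ξ i ω ^ 4) μ
  mean : ∀ i, 1 ≤ i → i ≤ n → ∫ ω, ξ i ω ∂μ = 0
  fourth : ∀ i, 1 ≤ i → i ≤ n → ∫ ω, ξ i ω ^ 4 ∂μ ≤ (a / ν ^ 8) ^ 4
  sum_sq : ∑ i ∈ Finset.Icc 1 n, ∫ ω, ξ i ω ^ 2 ∂μ = 1

/-- The linearised statistic, truncated at level `ν ^ (-3)`. -/
noncomputable def linStat (ξ : ℕ → Ω → ℝ) (μ : Measure Ω) (n : ℕ) (ν x : ℝ) (ω : Ω) : ℝ :=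
  ∑ j ∈ Finset.Icc 1 n, linTerm (ν ^ 3)⁻¹ x (∫ ω, ξ j ω ^ 2 ∂μ) (ξ j ω)

/-- The number of variables beyond the truncation level `ν ^ (-3)`. -/
noncomputable def numExceed (ξ : ℕ → Ω → ℝ) (n : ℕ) (ν : ℝ) (ω : Ω) : ℝ :=
  ∑ j ∈ Finset.Icc 1 n, exceed (ν ^ 3)⁻¹ (ξ j ω)

/-- The variance `1 + 2 ∑ E ξ_i ξ_{i+1}` of a normalised one-dependent sum. -/
noncomputable def sumVar (ξ : ℕ → Ω → ℝ) (μ : Measure Ω) (n : ℕ) : ℝ :=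
  1 + 2 * ∑ i ∈ Finset.Ico 1 n, ∫ ω, ξ i ω * ξ (i + 1) ω ∂μ

lemma natCast_mul_expansionError_le {n : ℕ} {a ν x Z : ℝ} (hν : 1 ≤ ν) (hn : ν ^ 16 = n)
    (ha : 1 ≤ a) (hx : x ≤ ν ^ 2) (hZ : 0 ≤ Z) :
    n * expansionError Z (ν ^ 3)⁻¹ x (a / ν ^ 8) ≤
      3 * (a ^ 4 / ν ^ 4 * (1 + Z ^ 2) * (1 + Z / ν ^ 4)) := by
  have hν0 : 0 < ν := by linarith
  have e : n * expansionError Z (ν ^ 3)⁻¹ x (a / ν ^ 8) =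
      a ^ 3 / ν ^ 4 * (Z ^ 3 / ν ^ 4) + Z ^ 2 *
          (a ^ 4 / ν ^ 4 / ν ^ 6 + a ^ 3 / ν ^ 4 * (x / ν ^ 4)) +
      Z * (a ^ 4 / ν ^ 4 / ν ^ 3) + a ^ 4 / ν ^ 4 := by
    rw [← hn]; unfold expansionError; field_simp
  have h34 : a ^ 3 / ν ^ 4 ≤ a ^ 4 / ν ^ 4 :=
    div_le_div_of_nonneg_right (pow_le_pow_right₀ ha (by norm_num)) (by positivity)
  have hxν : x / ν ^ 4 ≤ 1 := by
    rw [div_le_one (by positivity)]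
    exact hx.trans (pow_le_pow_right₀ hν (by norm_num))
  set D := a ^ 4 / ν ^ 4
  have hD : 0 ≤ D := by positivity
  have h6 : D / ν ^ 6 ≤ D := div_le_self hD (one_le_pow₀ hν)
  have h3 : D / ν ^ 3 ≤ D := div_le_self hD (one_le_pow₀ hν)
  have hq : 0 ≤ a ^ 3 / ν ^ 4 := by positivity
  rw [e]
  calc _ ≤ D * (Z ^ 3 / ν ^ 4) + Z ^ 2 * (D + D * 1) + Z * D + D := by
        have : a ^ 3 / ν ^ 4 * (x / ν ^ 4) ≤ D * 1 :=
          (mul_le_mul_of_nonneg_left hxν hq).trans (mul_le_mul_of_nonneg_right h34 zero_le_one)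
        gcongr
    _ ≤ _ := by
        have : 0 ≤ D * (Z / ν ^ 4) := by positivity
        have : 0 ≤ D * (Z ^ 3 / ν ^ 4) := by positivity
        have e2 : 3 * (D * (1 + Z ^ 2) * (1 + Z / ν ^ 4)) = 3 * D + 3 * (D * Z ^ 2) +
          3 * (D * (Z / ν ^ 4)) + 3 * (D * (Z ^ 3 / ν ^ 4)) := by ring
        rw [e2]
        nlinarith [mul_nonneg hD (sq_nonneg (Z - 1))]

namespace IsNormalized

variable {ξ : ℕ → Ω → ℝ} {μ : Measure Ω} {n : ℕ} {a ν : ℝ}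

lemma ν_pos (H : IsNormalized ξ μ n a ν) : 0 < ν := zero_lt_one.trans_le H.one_le_ν

lemma a_pos (H : IsNormalized ξ μ n a ν) : 0 < a := zero_lt_one.trans_le H.one_le_a

lemma scale_pos (H : IsNormalized ξ μ n a ν) : 0 < a / ν ^ 8 :=
  div_pos H.a_pos (pow_pos H.ν_pos 8)

lemma scale_le (H : IsNormalized ξ μ n a ν) : a / ν ^ 8 ≤ (ν ^ 3)⁻¹ := by
  have := H.ν_pos
  rw [div_le_iff₀ (by positivity), show (ν ^ 3)⁻¹ * ν ^ 8 = ν ^ 5 by field_simp]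
  calc a ≤ ν ^ 1 := by simpa using H.a_le
    _ ≤ ν ^ 5 := pow_le_pow_right₀ H.one_le_ν (by norm_num)

variable [IsProbabilityMeasure μ]

lemma sq_le (H : IsNormalized ξ μ n a ν) {i : ℕ} (h1 : 1 ≤ i) (h2 : i ≤ n) :
    ∫ ω, ξ i ω ^ 2 ∂μ ≤ (a / ν ^ 8) ^ 2 :=
  integral_sq_le_of_integral_pow_four_le H.scale_pos (H.measurable i h1) (H.integrable i h1 h2)
    (H.fourth i h1 h2)

set_option maxHeartbeats 1000000 in
/-- The Laplace transform of the linearised statistic, on a vertical strip: it is Gaussian up to a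
small relative error in the exponent. The term `c N` allows for a bounded penalty for each variable
beyond the truncation level. -/
theorem exists_integral_exp_eq (H : IsNormalized ξ μ n a ν) {x R c : ℝ} {z : ℂ} (hx : 0 ≤ x)
    (hxν : x ≤ ν ^ 2) (hR : 0 ≤ R) (hz : |z.re| * (2 * (ν ^ 3)⁻¹) ≤ R) (hc : 0 ≤ c) (hcR : c ≤ R)
    (hδ : 120 * Real.exp (2 * R) * (a / ν ^ 8) * (1 + ‖z‖) ≤ 1 / 8) :
    ∃ r : ℂ, ‖r‖ ≤ 2 * 10 ^ 8 * Real.exp (2 * R) ^ 3 *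
        (a ^ 4 / ν ^ 4 * (1 + ‖z‖ ^ 2) * (1 + ‖z‖ / ν ^ 4)) ∧
      ∫ ω, Complex.exp (z * linStat ξ μ n ν x ω + c * numExceed ξ n ν ω) ∂μ =
        Complex.exp (sumVar ξ μ n * z ^ 2 / 2 + r) := by
  have hν0 := H.ν_pos
  have ha0 := H.a_pos
  have hν1 := H.one_le_ν
  have hα := H.scale_pos
  have hατ := H.scale_le
  have hτ : 0 < (ν ^ 3)⁻¹ := by positivity
  have hxτ : x * (ν ^ 3)⁻¹ ≤ 1 := by
    rw [← div_eq_mul_inv, div_le_one (by positivity)]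
    exact hxν.trans (pow_le_pow_right₀ hν1 (by norm_num))
  set τ := (ν ^ 3)⁻¹ with hτdef
  set α := a / ν ^ 8 with hαdef
  set K := Real.exp (2 * R) with hKdef
  have hK : 1 ≤ K := Real.one_le_exp (by linarith)
  have hz0 := norm_nonneg z
  set F : ℕ → ℝ → ℂ := fun j => if 1 ≤ j ∧ j ≤ n then twist z c τ x (∫ ω, ξ j ω ^ 2 ∂μ)
    else fun _ => 0 with hFdef
  have hFj : ∀ {j}, 1 ≤ j → j ≤ n → F j = twist z c τ x (∫ ω, ξ j ω ^ 2 ∂μ) :=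
    fun h1 h2 => if_pos ⟨h1, h2⟩
  have hs : ∀ j, 0 ≤ ∫ ω, ξ j ω ^ 2 ∂μ := fun j => integral_nonneg fun ω => sq_nonneg _
  have hF : ∀ j, Measurable (F j) := fun j => by
    by_cases hj : 1 ≤ j ∧ j ≤ n
    · rw [hFj hj.1 hj.2]; exact measurable_twist _ _ _ _ _
    · simp only [hFdef, if_neg hj]; exact measurable_const
  have hb : ∀ j, ∃ K, ∀ y, ‖F j y‖ ≤ K := fun j => by
    by_cases hj : 1 ≤ j ∧ j ≤ n
    · refine ⟨2 * K, fun y => ?_⟩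
      rw [hFj hj.1 hj.2]
      exact (norm_twist_sub_exp_le hR hz hc hcR
        (abs_linTerm_le hτ (hs j) (H.sq_le hj.1 hj.2) hα.le hατ hx hxτ)).2.2
    · exact ⟨0, fun y => by simp [hFdef, if_neg hj]⟩
  -- the second moments of the factors
  have hα4 : α ^ 4 / τ ^ 4 ≤ α ^ 2 := by
    have : α ^ 4 / τ ^ 4 = α ^ 2 * (a ^ 2 / ν ^ 4) := by
      rw [hαdef, hτdef]; field_simp
    rw [this]
    refine mul_le_of_le_one_right (by positivity) ?_
    rw [div_le_one (by positivity)]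
    calc a ^ 2 ≤ ν ^ 2 := by gcongr; exact H.a_le
      _ ≤ ν ^ 4 := pow_le_pow_right₀ hν1 (by norm_num)
  have hδ0 : 0 ≤ 120 * K * α * (1 + ‖z‖) := by positivity
  have h2 : ∀ i, 1 ≤ i → i ≤ n → ∫ ω, ‖F i (ξ i ω)‖ ^ 2 ∂μ ≤ (120 * K * α * (1 + ‖z‖)) ^ 2 := by
    intro i h1 h2
    rw [hFj h1 h2]
    refine (integral_norm_twist_sq_le hR hz hc hcR hτ hα hατ hx hxτ (H.measurable i h1)
      (H.integrable i h1 h2) (H.fourth i h1 h2)).trans ?_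
    calc 10368 * K ^ 2 * (‖z‖ ^ 2 * α ^ 2 + α ^ 4 / τ ^ 4)
        ≤ 10368 * K ^ 2 * (‖z‖ ^ 2 * α ^ 2 + α ^ 2) := by gcongr
      _ = 10368 * (K * α) ^ 2 * (‖z‖ ^ 2 + 1) := by ring
      _ ≤ 14400 * (K * α) ^ 2 * (1 + ‖z‖) ^ 2 := by gcongr; norm_num; nlinarith
      _ = _ := by ring
  have hErr : expansionError ‖z‖ τ x α ≤ 3 * α ^ 2 * (1 + ‖z‖) ^ 2 := by
    have c1 : ‖z‖ * α ≤ 1 := by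
      have : α * (1 + ‖z‖) ≤ 120 * K * α * (1 + ‖z‖) := by
        have : 0 ≤ α * (1 + ‖z‖) := by positivity
        nlinarith
      nlinarith
    have c2 : α ^ 4 / τ ^ 2 ≤ α ^ 2 := by
      rw [div_le_iff₀ (by positivity)]
      calc α ^ 4 = α ^ 2 * α ^ 2 := by ring
        _ ≤ _ := by gcongr
    have c3 : x * α ^ 3 ≤ α ^ 2 := by
      calc x * α ^ 3 = α ^ 2 * (x * α) := by ring
        _ ≤ α ^ 2 * 1 := by
          gcongr; exact (mul_le_mul_of_nonneg_left hατ hx).trans hxτ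
        _ = _ := mul_one _
    have c4 : α ^ 4 / τ ^ 3 ≤ α ^ 2 := by
      refine le_trans ?_ hα4
      have : τ ≤ 1 := inv_le_one_of_one_le₀ (one_le_pow₀ hν1)
      exact div_le_div_of_nonneg_left (by positivity) (by positivity)
        (pow_le_pow_of_le_one hτ.le this (by norm_num))
    have t1 : ‖z‖ ^ 3 * α ^ 3 ≤ ‖z‖ ^ 2 * α ^ 2 := by
      calc ‖z‖ ^ 3 * α ^ 3 = ‖z‖ ^ 2 * α ^ 2 * (‖z‖ * α) := by ring
        _ ≤ _ := mul_le_of_le_one_right (by positivity) c1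
    have t2 : ‖z‖ ^ 2 * (α ^ 4 / τ ^ 2 + x * α ^ 3) ≤ ‖z‖ ^ 2 * (α ^ 2 + α ^ 2) :=
      mul_le_mul_of_nonneg_left (add_le_add c2 c3) (sq_nonneg _)
    have t3 : ‖z‖ * (α ^ 4 / τ ^ 3) ≤ ‖z‖ * α ^ 2 := mul_le_mul_of_nonneg_left c4 hz0
    have t4 : 0 ≤ α ^ 2 * ‖z‖ := by positivity
    unfold expansionError
    nlinarith
  have hmean : ∀ i, 1 ≤ i → i ≤ n →
      ‖∫ ω, F i (ξ i ω) ∂μ - z ^ 2 / 2 * ((∫ ω, ξ i ω ^ 2 ∂μ : ℝ) : ℂ)‖ ≤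
        3240 * K ^ 2 * expansionError ‖z‖ τ x α := by
    intro i h1 h2
    rw [hFj h1 h2]
    exact norm_integral_twist_sub_le hR hz hc hcR hτ hα hατ hx hxτ (H.measurable i h1)
      (H.integrable i h1 h2) (H.fourth i h1 h2) (H.mean i h1 h2)
  have hcross : ∀ i, 1 ≤ i → i < n →
      ‖∫ ω, F i (ξ i ω) * F (i + 1) (ξ (i + 1) ω) ∂μ -
        z ^ 2 * ((∫ ω, ξ i ω * ξ (i + 1) ω ∂μ : ℝ) : ℂ)‖ ≤
        24300 * K ^ 2 * expansionError ‖z‖ τ x α := by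
    intro i h1 h2
    rw [hFj h1 h2.le, hFj (by omega : 1 ≤ i + 1) h2]
    exact norm_integral_twist_mul_sub_le hR hz hc hcR hτ hα hατ hx hxτ (H.measurable i h1)
      (H.integrable i h1 h2.le) (H.fourth i h1 h2.le) (H.measurable _ (by omega))
      (H.integrable _ (by omega) h2) (H.fourth _ (by omega) h2)
  have h1 : ∀ i, 1 ≤ i → i ≤ n → ‖∫ ω, F i (ξ i ω) ∂μ‖ ≤ (120 * K * α * (1 + ‖z‖)) ^ 2 := by
    intro i h1 h2
    have e1 := hmean i h1 h2
    have e2 : ‖z ^ 2 / 2 * ((∫ ω, ξ i ω ^ 2 ∂μ : ℝ) : ℂ)‖ ≤ ‖z‖ ^ 2 / 2 * α ^ 2 := by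
      rw [norm_mul, norm_div, norm_pow, Complex.norm_real, Real.norm_eq_abs, abs_of_nonneg (hs i)]
      have := H.sq_le h1 h2
      norm_num
      gcongr
    calc ‖∫ ω, F i (ξ i ω) ∂μ‖ = ‖(∫ ω, F i (ξ i ω) ∂μ -
          z ^ 2 / 2 * ((∫ ω, ξ i ω ^ 2 ∂μ : ℝ) : ℂ)) +
          z ^ 2 / 2 * ((∫ ω, ξ i ω ^ 2 ∂μ : ℝ) : ℂ)‖ := by congr 1; ring
      _ ≤ 3240 * K ^ 2 * (3 * α ^ 2 * (1 + ‖z‖) ^ 2) + ‖z‖ ^ 2 / 2 * α ^ 2 := by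
          refine (norm_add_le _ _).trans (add_le_add (e1.trans ?_) e2)
          gcongr
      _ ≤ 9720 * K ^ 2 * (α ^ 2 * (1 + ‖z‖) ^ 2) + K ^ 2 * (α ^ 2 * (1 + ‖z‖) ^ 2) := by
          refine add_le_add (le_of_eq (by ring)) ?_
          calc ‖z‖ ^ 2 / 2 * α ^ 2 = 1 * (α ^ 2 * (‖z‖ ^ 2 / 2)) := by ring
            _ ≤ K ^ 2 * (α ^ 2 * (1 + ‖z‖) ^ 2) := by
              gcongr
              · exact one_le_pow₀ hK
              · nlinarith
      _ ≤ 14400 * (K ^ 2 * (α ^ 2 * (1 + ‖z‖) ^ 2)) := by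
          have : 0 ≤ K ^ 2 * (α ^ 2 * (1 + ‖z‖) ^ 2) := by positivity
          linarith
      _ = _ := by ring
  obtain ⟨r, hr, he⟩ := H.dep.exists_integral_prod_eq_exp H.measurable hF hb hδ0 hδ h2 h1
  set A := ∑ j ∈ Finset.Icc 1 n, ∫ ω, F j (ξ j ω) ∂μ with hA
  set B := ∑ j ∈ Finset.Ico 1 n, ∫ ω, F j (ξ j ω) * F (j + 1) (ξ (j + 1) ω) ∂μ with hB
  have hAn : ‖A - z ^ 2 / 2‖ ≤ n * (3240 * K ^ 2 * expansionError ‖z‖ τ x α) := by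
    have : A - z ^ 2 / 2 = ∑ j ∈ Finset.Icc 1 n, (∫ ω, F j (ξ j ω) ∂μ -
        z ^ 2 / 2 * ((∫ ω, ξ j ω ^ 2 ∂μ : ℝ) : ℂ)) := by
      rw [Finset.sum_sub_distrib, ← hA, ← Finset.mul_sum, ← Complex.ofReal_sum, H.sum_sq]
      simp
    rw [this]
    refine (norm_sum_le_of_le _ fun j hj => ?_).trans
      (b := ∑ j ∈ Finset.Icc 1 n, 3240 * K ^ 2 * expansionError ‖z‖ τ x α) ?_
    · rw [Finset.mem_Icc] at hj; exact hmean j hj.1 hj.2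
    · simp
  have hBn : ‖B - z ^ 2 * ((∑ i ∈ Finset.Ico 1 n, ∫ ω, ξ i ω * ξ (i + 1) ω ∂μ : ℝ) : ℂ)‖ ≤
      n * (24300 * K ^ 2 * expansionError ‖z‖ τ x α) := by
    rw [Complex.ofReal_sum, Finset.mul_sum, hB, ← Finset.sum_sub_distrib]
    refine (norm_sum_le_of_le _ fun j hj => ?_).trans
      (b := ∑ j ∈ Finset.Ico 1 n, 24300 * K ^ 2 * expansionError ‖z‖ τ x α) ?_
    · rw [Finset.mem_Ico] at hj; exact hcross j hj.1 hj.2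
    · simp only [Finset.sum_const, Nat.card_Ico, nsmul_eq_mul]
      have : 0 ≤ expansionError ‖z‖ τ x α := by unfold expansionError; positivity
      gcongr; omega
  refine ⟨r + (A - z ^ 2 / 2) +
    (B - z ^ 2 * ((∑ i ∈ Finset.Ico 1 n, ∫ ω, ξ i ω * ξ (i + 1) ω ∂μ : ℝ) : ℂ)), ?_, ?_⟩
  · have hE := natCast_mul_expansionError_le hν1 H.ν_pow H.one_le_a hxν hz0
    rw [← hτdef, ← hαdef] at hE
    set Q := a ^ 4 / ν ^ 4 * (1 + ‖z‖ ^ 2) * (1 + ‖z‖ / ν ^ 4) with hQ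
    have hQ0 : 0 ≤ Q := by positivity
    have hr' : 34 * n * (120 * K * α * (1 + ‖z‖)) ^ 3 ≤ 117504000 * K ^ 3 * Q := by
      have : 34 * n * (120 * K * α * (1 + ‖z‖)) ^ 3 =
          58752000 * K ^ 3 * (a ^ 3 / ν ^ 4 * (1 + ‖z‖) ^ 2 * ((1 + ‖z‖) / ν ^ 4)) := by
        rw [← H.ν_pow, hαdef]; field_simp; ring
      rw [this]
      have p1 : a ^ 3 ≤ a ^ 4 := pow_le_pow_right₀ H.one_le_a (by norm_num)
      have p2 : (1 + ‖z‖) ^ 2 ≤ 2 * (1 + ‖z‖ ^ 2) := by nlinarith [sq_nonneg (‖z‖ - 1)]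
      have p3 : (1 + ‖z‖) / ν ^ 4 ≤ 1 + ‖z‖ / ν ^ 4 := by
        rw [add_div]; gcongr; exact div_le_one_of_le₀ (one_le_pow₀ hν1) (by positivity)
      calc _ ≤ 58752000 * K ^ 3 *
            (a ^ 4 / ν ^ 4 * (2 * (1 + ‖z‖ ^ 2)) * (1 + ‖z‖ / ν ^ 4)) := by gcongr
        _ = _ := by rw [hQ]; ring
    have hK23 : K ^ 2 ≤ K ^ 3 := pow_le_pow_right₀ hK (by norm_num)
    have hEn : 0 ≤ n * expansionError ‖z‖ τ x α := by
      have : 0 ≤ expansionError ‖z‖ τ x α := by unfold expansionError; positivity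
      positivity
    have hm : K ^ 2 * (n * expansionError ‖z‖ τ x α) ≤ K ^ 3 * (3 * Q) := by gcongr
    have hKQ : 0 ≤ K ^ 3 * Q := by positivity
    refine norm_add₃_le.trans ?_
    calc _ ≤ 117504000 * K ^ 3 * Q + n * (3240 * K ^ 2 * expansionError ‖z‖ τ x α) +
          n * (24300 * K ^ 2 * expansionError ‖z‖ τ x α) := by
          gcongr; exact hr.trans hr'
      _ = 117504000 * (K ^ 3 * Q) + 27540 * (K ^ 2 * (n * expansionError ‖z‖ τ x α)) := by ring
      _ ≤ _ := by linarith
  · have e1 : ∀ ω, Complex.exp (z * linStat ξ μ n ν x ω + c * numExceed ξ n ν ω) =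
        ∏ j ∈ Finset.Icc 1 n, (1 + F j (ξ j ω)) := fun ω => by
      unfold linStat numExceed
      rw [Complex.ofReal_sum, Complex.ofReal_sum, Finset.mul_sum, Finset.mul_sum,
        ← Finset.sum_add_distrib, Complex.exp_sum]
      refine Finset.prod_congr rfl fun j hj => ?_
      rw [Finset.mem_Icc] at hj
      rw [hFj hj.1 hj.2, twist]
      ring
    simp only [e1, he]
    congr 1
    unfold sumVar
    push_cast
    ring

end IsNormalized

end

/-! ### Gaussian smoothing and Laplace inversion -/

section

open scoped NNReal

/-- The tail of the centred Gaussian law of variance `v`. -/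
noncomputable def gaussianTail (v : ℝ≥0) (y : ℝ) : ℝ := ∫ u in Set.Ioi y, gaussianPDFReal 0 v u

lemma norm_exp_vertical (v : ℝ) (p t u : ℝ) :
    ‖Complex.exp (v * (p + t * Complex.I) ^ 2 / 2 - (p + t * Complex.I) * u)‖ =
      Real.exp (v * (p ^ 2 - t ^ 2) / 2 - p * u) := by
  rw [Complex.norm_exp]
  congr 1
  simp [pow_two]

/-- Bromwich's formula for the Gaussian density: Laplace inversion on the line `Re z = p`. -/
lemma gaussianPDFReal_eq_integral {v : ℝ≥0} (hv : 0 < v) (p u : ℝ) :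
    Integrable (fun t : ℝ => Complex.exp (v * (p + t * Complex.I) ^ 2 / 2 -
      (p + t * Complex.I) * u)) ∧
    (gaussianPDFReal 0 v u : ℂ) = (2 * Real.pi : ℂ)⁻¹ *
      ∫ t : ℝ, Complex.exp (v * (p + t * Complex.I) ^ 2 / 2 - (p + t * Complex.I) * u) := by
  have hv' : (0 : ℝ) < v := by exact_mod_cast hv
  have hvC : (v : ℂ) ≠ 0 := by exact_mod_cast hv'.ne'
  have hb : (-((v : ℝ) : ℂ) / 2).re < 0 := by
    rw [← Complex.ofReal_neg, show (2 : ℂ) = ((2 : ℝ) : ℂ) by norm_num, ← Complex.ofReal_div,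
      Complex.ofReal_re]
    linarith
  have e : ∀ t : ℝ, Complex.exp (v * (p + t * Complex.I) ^ 2 / 2 - (p + t * Complex.I) * u) =
      Complex.exp ((-((v : ℝ) : ℂ) / 2) * t ^ 2 + (((v * p - u : ℝ) : ℂ) * Complex.I) * t +
        ((v * p ^ 2 / 2 - p * u : ℝ) : ℂ)) := fun t => by
    congr 1
    push_cast
    linear_combination ((v : ℂ) * t ^ 2 / 2) * Complex.I_sq
  simp only [e]
  refine ⟨integrable_cexp_quadratic' hb _ _, ?_⟩
  rw [integral_cexp_quadratic hb]
  have e1 : ((v * p ^ 2 / 2 - p * u : ℝ) : ℂ) - (((v * p - u : ℝ) : ℂ) * Complex.I) ^ 2 /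
      (4 * (-((v : ℝ) : ℂ) / 2)) = ((-u ^ 2 / (2 * v) : ℝ) : ℂ) := by
    rw [mul_pow, Complex.I_sq]
    push_cast
    field_simp
    ring
  have e2 : (Real.pi : ℂ) / -(-((v : ℝ) : ℂ) / 2) = ((2 * Real.pi / v : ℝ) : ℂ) := by
    push_cast; field_simp
  have e3 : ((2 * Real.pi / v : ℝ) : ℂ) ^ (1 / 2 : ℂ) =
      ((Real.sqrt (2 * Real.pi / v) : ℝ) : ℂ) := by
    rw [Real.sqrt_eq_rpow, Complex.ofReal_cpow (by positivity)]
    norm_num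
  rw [e1, e2, e3, ← Complex.ofReal_exp, gaussianPDFReal]
  rw [show (2 * Real.pi : ℂ)⁻¹ = (((2 * Real.pi)⁻¹ : ℝ) : ℂ) by push_cast; rfl]
  norm_cast
  rw [sub_zero, ← mul_assoc]
  congr 1
  have h2 : Real.sqrt (2 * Real.pi / v) * Real.sqrt (2 * Real.pi * v) = 2 * Real.pi := by
    rw [← Real.sqrt_mul (by positivity),
      show 2 * Real.pi / v * (2 * Real.pi * v) = (2 * Real.pi) ^ 2 by field_simp]
    exact Real.sqrt_sq (by positivity)
  have h3 : 0 < Real.sqrt (2 * Real.pi * v) := Real.sqrt_pos.2 (by positivity)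
  have : Real.sqrt (2 * Real.pi / v) = 2 * Real.pi / Real.sqrt (2 * Real.pi * v) := by
    rw [eq_div_iff h3.ne', h2]
  rw [this]
  field_simp

variable {Ω : Type*} [MeasurableSpace Ω] {μ : Measure Ω} [IsProbabilityMeasure μ]

/-- Local estimate behind the smoothing inequality: closeness of the Laplace transform of `W` on
the line `Re z = p` to that of a Gaussian law gives closeness of the smoothed densities, with the
exponential weight `exp (-p u)`. -/
lemma abs_integral_gaussianPDFReal_sub_le {W : Ω → ℝ} (hW : Measurable W) {B : ℝ}
    (hB : ∀ ω, |W ω| ≤ B) {κ v : ℝ≥0} (hv : 0 < v) {p : ℝ} {H : ℝ → ℝ}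
    (hH : Integrable H)
    (hbound : ∀ t : ℝ, ‖∫ ω, Complex.exp ((p + t * Complex.I) * W ω) ∂μ -
      Complex.exp (κ * (p + t * Complex.I) ^ 2 / 2)‖ * Real.exp (v * (p ^ 2 - t ^ 2) / 2) ≤ H t)
    (u : ℝ) :
    |∫ ω, gaussianPDFReal 0 v (u - W ω) ∂μ - gaussianPDFReal 0 (κ + v) u| ≤
      Real.exp (-(p * u)) * ((2 * Real.pi)⁻¹ * ∫ t, H t) := by
  set E : ℝ → ℂ := fun t => Complex.exp (v * (p + t * Complex.I) ^ 2 / 2 -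
    (p + t * Complex.I) * u) with hE
  set G : Ω → ℝ → ℂ := fun ω t => Complex.exp (v * (p + t * Complex.I) ^ 2 / 2 -
    (p + t * Complex.I) * ((u - W ω : ℝ) : ℂ)) with hG
  have hGE : ∀ ω t, G ω t = E t * Complex.exp ((p + t * Complex.I) * W ω) := fun ω t => by
    simp only [hG, hE, ← Complex.exp_add]; congr 1; push_cast; ring
  have hEint : Integrable E := (gaussianPDFReal_eq_integral hv p u).1
  have hGint : Integrable (Function.uncurry G) (μ.prod volume) := by
    have hd : Integrable (fun q : Ω × ℝ => Real.exp (|p| * B) * ‖E q.2‖) (μ.prod volume) :=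
      (hEint.norm.comp_snd μ).const_mul _
    refine hd.mono' ?_ (ae_of_all _ fun q => ?_)
    · refine Measurable.aestronglyMeasurable ?_
      simp only [hG, Function.uncurry_def]
      fun_prop
    · simp only [Function.uncurry_def, hGE, norm_mul]
      rw [mul_comm]
      gcongr
      rw [Complex.norm_exp]
      gcongr
      have : ((p + q.2 * Complex.I) * (W q.1 : ℂ)).re = p * W q.1 := by simp
      rw [this]
      refine (le_abs_self _).trans ?_
      rw [abs_mul]
      gcongr
      exact hB _
  have e1 : ((∫ ω, gaussianPDFReal 0 v (u - W ω) ∂μ : ℝ) : ℂ) =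
      (2 * Real.pi : ℂ)⁻¹ * ∫ t, E t * ∫ ω, Complex.exp ((p + t * Complex.I) * W ω) ∂μ := by
    rw [← integral_complex_ofReal]
    simp only [fun ω => (gaussianPDFReal_eq_integral hv p (u - W ω)).2]
    rw [integral_const_mul]
    congr 1
    rw [integral_integral_swap hGint]
    refine integral_congr_ae (ae_of_all _ fun t => ?_)
    simp only [hGE]
    rw [integral_const_mul]
  have e2 : (gaussianPDFReal 0 (κ + v) u : ℂ) =
      (2 * Real.pi : ℂ)⁻¹ * ∫ t, E t * Complex.exp (κ * (p + t * Complex.I) ^ 2 / 2) := by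
    rw [(gaussianPDFReal_eq_integral (by positivity : 0 < κ + v) p u).2]
    congr 1
    refine integral_congr_ae (ae_of_all _ fun t => ?_)
    simp only [hE, ← Complex.exp_add]
    congr 1
    push_cast
    ring
  have i1 : Integrable fun t => E t * ∫ ω, Complex.exp ((p + t * Complex.I) * W ω) ∂μ := by
    have := hGint.integral_prod_right
    refine this.congr (ae_of_all _ fun t => ?_)
    simp only [Function.uncurry_def, hGE]
    rw [integral_const_mul]
  have i2 : Integrable fun t => E t * Complex.exp (κ * (p + t * Complex.I) ^ 2 / 2) := by
    refine ((gaussianPDFReal_eq_integral (by positivity : 0 < κ + v) p u).1).congr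
      (ae_of_all _ fun t => ?_)
    simp only [hE, ← Complex.exp_add]
    congr 1
    push_cast
    ring
  rw [← Real.norm_eq_abs, ← Complex.norm_real, Complex.ofReal_sub, e1, e2, ← mul_sub,
    ← integral_sub i1 i2, norm_mul]
  have e3 : ‖(2 * Real.pi : ℂ)⁻¹‖ = (2 * Real.pi)⁻¹ := by
    rw [norm_inv, norm_mul, Complex.norm_real, Real.norm_of_nonneg Real.pi_pos.le]; norm_num
  rw [e3, mul_left_comm]
  gcongr
  rw [← integral_const_mul]
  refine norm_integral_le_of_norm_le (hH.const_mul _) (ae_of_all _ fun t => ?_)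
  rw [← mul_sub, norm_mul]
  have e4 : ‖E t‖ = Real.exp (-(p * u)) * Real.exp (v * (p ^ 2 - t ^ 2) / 2) := by
    simp only [hE]
    rw [← Real.exp_add]
    have := norm_exp_vertical v p t u
    rw [this]; congr 1; ring
  rw [e4, mul_assoc, mul_comm (Real.exp (v * (p ^ 2 - t ^ 2) / 2))]
  gcongr
  exact hbound t

lemma integrable_gaussianPDFReal_sub (v : ℝ≥0) (w : ℝ) :
    Integrable fun u => gaussianPDFReal 0 v (u - w) := by
  simpa only [gaussianPDFReal_sub, zero_add] using integrable_gaussianPDFReal w v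

lemma gaussianTail_sub (v : ℝ≥0) (y w : ℝ) :
    gaussianTail v (y - w) = ∫ u in Set.Ioi y, gaussianPDFReal 0 v (u - w) := by
  unfold gaussianTail
  rw [← integral_indicator measurableSet_Ioi, ← integral_indicator measurableSet_Ioi,
    ← integral_sub_right_eq_self _ w]
  refine integral_congr_ae (ae_of_all _ fun u => ?_)
  simp [Set.indicator]

lemma gaussianTail_nonneg (v : ℝ≥0) (y : ℝ) : 0 ≤ gaussianTail v y :=
  setIntegral_nonneg measurableSet_Ioi fun u _ => gaussianPDFReal_nonneg 0 v u

lemma gaussianTail_anti (v : ℝ≥0) : Antitone (gaussianTail v) := fun _ _ h =>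
  setIntegral_mono_set (integrable_gaussianPDFReal 0 v).integrableOn
    (ae_of_all _ fun u => gaussianPDFReal_nonneg 0 v u) (Set.Ioi_subset_Ioi h).eventuallyLE

/-- The smoothing inequality on the half-line: the Gaussian regularisation of the tail of `W` is
compared with a Gaussian tail by integrating the local estimate. -/
theorem abs_integral_gaussianTail_sub_le {W : Ω → ℝ} (hW : Measurable W) {B : ℝ}
    (hB : ∀ ω, |W ω| ≤ B) {κ v : ℝ≥0} (hv : 0 < v) {p : ℝ} (hp : 0 < p) {H : ℝ → ℝ}
    (hH : Integrable H)
    (hbound : ∀ t : ℝ, ‖∫ ω, Complex.exp ((p + t * Complex.I) * W ω) ∂μ -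
      Complex.exp (κ * (p + t * Complex.I) ^ 2 / 2)‖ * Real.exp (v * (p ^ 2 - t ^ 2) / 2) ≤ H t)
    (y : ℝ) :
    |∫ ω, gaussianTail v (y - W ω) ∂μ - gaussianTail (κ + v) y| ≤
      Real.exp (-(p * y)) / p * ((2 * Real.pi)⁻¹ * ∫ t, H t) := by
  have hm : Measurable (Function.uncurry fun (ω : Ω) u => gaussianPDFReal 0 v (u - W ω)) :=
    (measurable_gaussianPDFReal 0 v).comp (by fun_prop)
  have hint : Integrable (Function.uncurry fun ω u => gaussianPDFReal 0 v (u - W ω))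
      (μ.prod (volume.restrict (Set.Ioi y))) := by
    rw [integrable_prod_iff hm.aestronglyMeasurable]
    refine ⟨ae_of_all _ fun ω => (integrable_gaussianPDFReal_sub v (W ω)).integrableOn, ?_⟩
    refine Integrable.of_bound (C := 1)
      (hm.aestronglyMeasurable.norm.integral_prod_right' (μ := μ)
        (ν := volume.restrict (Set.Ioi y))) (ae_of_all _ fun ω => ?_)
    simp only [Function.uncurry_def, Real.norm_eq_abs, abs_of_nonneg (gaussianPDFReal_nonneg _ _ _)]
    rw [abs_of_nonneg (integral_nonneg fun u => gaussianPDFReal_nonneg _ _ _)]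
    refine (setIntegral_le_integral (integrable_gaussianPDFReal_sub v (W ω))
      (ae_of_all _ fun u => gaussianPDFReal_nonneg _ _ _)).trans ?_
    simp only [gaussianPDFReal_sub]
    exact (integral_gaussianPDFReal_eq_one _ hv.ne').le
  have e1 : ∫ ω, gaussianTail v (y - W ω) ∂μ =
      ∫ u in Set.Ioi y, ∫ ω, gaussianPDFReal 0 v (u - W ω) ∂μ := by
    simp only [gaussianTail_sub]
    exact integral_integral_swap hint
  have i1 : IntegrableOn (fun u => ∫ ω, gaussianPDFReal 0 v (u - W ω) ∂μ) (Set.Ioi y) :=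
    hint.integral_prod_right
  rw [e1, gaussianTail, ← integral_sub i1 (integrable_gaussianPDFReal _ _).integrableOn,
    ← Real.norm_eq_abs]
  set C := (2 * Real.pi)⁻¹ * ∫ t, H t
  have hexp := integrableOn_exp_mul_Ioi (neg_lt_zero.2 hp) y
  have hexp' := integral_exp_mul_Ioi (neg_lt_zero.2 hp) y
  calc _ ≤ ∫ u in Set.Ioi y, Real.exp (-p * u) * C := by
        refine norm_integral_le_of_norm_le (hexp.mul_const _) (ae_of_all _ fun u => ?_)
        rw [neg_mul]
        exact abs_integral_gaussianPDFReal_sub_le hW hB hv hH hbound u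
    _ = _ := by
        rw [integral_mul_const, hexp', neg_mul, neg_div_neg_eq]

end

/-! ### Gaussian tails -/

section

open scoped NNReal

lemma gaussianTail_eq_real {v : ℝ≥0} (hv : v ≠ 0) (y : ℝ) :
    gaussianTail v y = (gaussianReal 0 v).real (Set.Ioi y) := by
  rw [Measure.real, gaussianReal_apply_eq_integral 0 hv, ENNReal.toReal_ofReal]
  · rfl
  · exact gaussianTail_nonneg v y

lemma gaussianTail_one_eq (y : ℝ) : gaussianTail 1 y = 1 - Phi y := by
  rw [gaussianTail_eq_real one_ne_zero, Phi, cdf_eq_real, ← Set.compl_Iic,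
    probReal_compl_eq_one_sub measurableSet_Iic]

lemma gaussianTail_eq_gaussianTail_one {v : ℝ≥0} (hv : 0 < v) (y : ℝ) :
    gaussianTail v y = gaussianTail 1 (y / Real.sqrt v) := by
  have hs : 0 < Real.sqrt v := Real.sqrt_pos.2 (by exact_mod_cast hv)
  have h := gaussianReal_map_const_mul (μ := 0) (v := 1) (Real.sqrt v)
  have hv2 : NNReal.mk (Real.sqrt v ^ 2) (sq_nonneg _) * 1 = v := by
    ext; simp
  rw [mul_zero, hv2] at h
  rw [gaussianTail_eq_real hv.ne', gaussianTail_eq_real one_ne_zero, ← h,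
    map_measureReal_apply (by fun_prop) measurableSet_Ioi]
  congr 1
  ext u
  simp [div_lt_iff₀ hs, mul_comm]

lemma gaussianTail_neg {v : ℝ≥0} (hv : v ≠ 0) (y : ℝ) :
    gaussianTail v (-y) = 1 - gaussianTail v y := by
  have hna : NullSingletonClass (gaussianReal 0 v) := nullSingletonClass_gaussianReal hv
  have h := gaussianReal_map_neg (μ := 0) (v := v)
  rw [neg_zero] at h
  rw [gaussianTail_eq_real hv, gaussianTail_eq_real hv]
  nth_rewrite 1 [← h]
  rw [map_measureReal_apply (by fun_prop) measurableSet_Ioi,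
    ← probReal_compl_eq_one_sub measurableSet_Ioi]
  have e : (fun x : ℝ => -x) ⁻¹' Set.Ioi (-y) = Set.Iio y := by ext u; simp
  rw [e, Set.compl_Ioi, measureReal_congr Iio_ae_eq_Iic]

lemma gaussianTail_le_exp {v : ℝ≥0} (hv : 0 < v) {δ : ℝ} (hδ : 0 ≤ δ) :
    gaussianTail v δ ≤ Real.exp (-(δ ^ 2 / (2 * v))) := by
  have hv' : (0 : ℝ) < v := by exact_mod_cast hv
  have h := measure_ge_le_exp_mul_mgf (μ := gaussianReal 0 v) (X := id) δ
    (t := δ / v) (by positivity)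
    (by simpa using integrable_exp_mul_gaussianReal (μ := 0) (v := v) (δ / v))
  rw [gaussianTail_eq_real hv.ne']
  have hsub : Set.Ioi δ ⊆ {ω | δ ≤ id ω} := fun u hu => (Set.mem_Ioi.1 hu).le
  refine (measureReal_mono hsub).trans (h.trans_eq ?_)
  rw [mgf_id_gaussianReal, ← Real.exp_add]
  congr 1
  field_simp
  ring

lemma gaussianTail_one_sub (y y' : ℝ) :
    gaussianTail 1 y - gaussianTail 1 y' = ∫ u in y..y', gaussianPDFReal 0 1 u := by
  have hi := integrable_gaussianPDFReal 0 1
  rw [gaussianTail, gaussianTail]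
  exact intervalIntegral.integral_Ioi_sub_Ioi' hi.integrableOn hi.integrableOn

lemma gaussianPDFReal_std (u : ℝ) :
    gaussianPDFReal 0 1 u = (Real.sqrt (2 * Real.pi))⁻¹ * Real.exp (-u ^ 2 / 2) := by
  simp [gaussianPDFReal]

lemma abs_gaussianTail_one_sub_le (X X' : ℝ) :
    |gaussianTail 1 X' - gaussianTail 1 X| ≤
      |X' - X| * Real.exp (|X| * |X' - X|) * Real.exp (-(X ^ 2 / 2)) := by
  rw [gaussianTail_one_sub, ← Real.norm_eq_abs]
  refine (intervalIntegral.norm_integral_le_of_norm_le_const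
    (C := Real.exp (|X| * |X' - X|) * Real.exp (-(X ^ 2 / 2))) fun u hu => ?_).trans_eq ?_
  · rw [gaussianPDFReal_std, Real.norm_eq_abs, abs_of_nonneg (by positivity), ← Real.exp_add]
    have h1 : (Real.sqrt (2 * Real.pi))⁻¹ ≤ 1 := by
      refine inv_le_one_of_one_le₀ (Real.one_le_sqrt.2 ?_)
      linarith [Real.pi_gt_three]
    have h2 : |u - X| ≤ |X' - X| := by
      rw [Set.uIoc_comm] at hu
      exact Set.abs_sub_left_of_mem_uIcc (Set.uIoc_subset_uIcc hu)
    have h3 : -(X * (u - X)) ≤ |X| * |X' - X| := by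
      refine (neg_le_abs _).trans ?_
      rw [abs_mul]; gcongr
    calc _ ≤ 1 * Real.exp (|X| * |X' - X| + -(X ^ 2 / 2)) := by
          gcongr
          nlinarith [sq_nonneg (u - X)]
      _ = _ := one_mul _
  · rw [abs_sub_comm]; ring

lemma le_gaussianTail_one {X : ℝ} (hX : 0 ≤ X) :
    1 / 15 * (Real.exp (-(X ^ 2 / 2)) / (1 + X)) ≤ gaussianTail 1 X := by
  have hi := integrable_gaussianPDFReal 0 1
  have hX1 : 0 < 1 + X := by linarith
  have hw : 0 < 1 / (1 + X) := by positivity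
  have hpi : Real.sqrt (2 * Real.pi) ≤ 3 := by
    rw [Real.sqrt_le_left (by norm_num)]; linarith [Real.pi_lt_four, Real.pi_lt_d2]
  have he : Real.exp (3 / 2) ≤ 5 := by
    have h1 : Real.exp (3 / 2) ^ 2 = Real.exp 1 ^ 3 := by
      rw [← Real.exp_nat_mul, ← Real.exp_nat_mul]; norm_num
    have h2 : Real.exp 1 ^ 3 ≤ 2.7182818286 ^ 3 :=
      pow_le_pow_left₀ (Real.exp_pos 1).le Real.exp_one_lt_d9.le 3
    nlinarith [Real.exp_pos (3 / 2 : ℝ)]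
  have h0 := gaussianTail_nonneg 1 (X + 1 / (1 + X))
  have h1 := gaussianTail_one_sub X (X + 1 / (1 + X))
  have h2 : ∫ _ in X..(X + 1 / (1 + X)), (1 / 15 * Real.exp (-(X ^ 2 / 2))) ≤
      ∫ u in X..(X + 1 / (1 + X)), gaussianPDFReal 0 1 u := by
    refine intervalIntegral.integral_mono_on (by linarith) (by simp)
      hi.intervalIntegrable fun u hu => ?_
    rw [gaussianPDFReal_std]
    have hsq : 0 < Real.sqrt (2 * Real.pi) := Real.sqrt_pos.2 (by positivity)
    have e1 : (1 / 3 : ℝ) ≤ (Real.sqrt (2 * Real.pi))⁻¹ := by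
      rw [one_div]; exact inv_anti₀ hsq hpi
    have e2 : 1 / 5 ≤ Real.exp (-(3 / 2)) := by
      rw [Real.exp_neg, one_div]; exact inv_anti₀ (Real.exp_pos _) he
    have e3 : u ^ 2 ≤ X ^ 2 + 3 := by
      have : u ≤ X + 1 / (1 + X) := hu.2
      have hu0 : 0 ≤ u := hX.trans hu.1
      have a1 : X * (1 / (1 + X)) ≤ 1 := by
        rw [mul_one_div, div_le_one hX1]; linarith
      have a2 : 1 / (1 + X) ≤ 1 := by rw [div_le_one hX1]; linarith
      calc u ^ 2 ≤ (X + 1 / (1 + X)) ^ 2 := by gcongr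
        _ = X ^ 2 + 2 * (X * (1 / (1 + X))) + (1 / (1 + X)) ^ 2 := by ring
        _ ≤ X ^ 2 + 3 := by nlinarith
    calc 1 / 15 * Real.exp (-(X ^ 2 / 2)) = 1 / 3 * (1 / 5 * Real.exp (-(X ^ 2 / 2))) := by ring
      _ ≤ (Real.sqrt (2 * Real.pi))⁻¹ * (Real.exp (-(3 / 2)) * Real.exp (-(X ^ 2 / 2))) := by
          gcongr
      _ ≤ (Real.sqrt (2 * Real.pi))⁻¹ * Real.exp (-u ^ 2 / 2) := by
          rw [← Real.exp_add]; gcongr; linarith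
  rw [intervalIntegral.integral_const, smul_eq_mul] at h2
  have : 1 / 15 * (Real.exp (-(X ^ 2 / 2)) / (1 + X)) =
      (X + 1 / (1 + X) - X) * (1 / 15 * Real.exp (-(X ^ 2 / 2))) := by field_simp; ring
  linarith

variable {Ω : Type*} [MeasurableSpace Ω] {μ : Measure Ω} [IsProbabilityMeasure μ]

/-- The tail of `W` is squeezed between shifts of its Gaussian regularisation. -/
lemma measureReal_gt_smoothing {W : Ω → ℝ} (hW : Measurable W) {v : ℝ≥0} (hv : 0 < v) (δ y : ℝ) :
    μ.real {ω | y < W ω} ≤ ∫ ω, gaussianTail v (y - δ - W ω) ∂μ + gaussianTail v δ ∧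
    ∫ ω, gaussianTail v (y + δ - W ω) ∂μ - gaussianTail v δ ≤ μ.real {ω | y < W ω} := by
  have hle1 : ∀ y, gaussianTail v y ≤ 1 := fun y => by
    rw [gaussianTail_eq_real hv.ne']; exact measureReal_le_one
  have hanti := gaussianTail_anti v
  have hset : MeasurableSet {ω | y < W ω} := measurableSet_lt measurable_const hW
  have hint : ∀ c : ℝ, Integrable (fun ω => gaussianTail v (c - W ω)) μ := fun c =>
    integrable_of_measurable_of_bound (hanti.measurable.comp (hW.const_sub c)) (K := 1)
      fun ω => by rw [Real.norm_of_nonneg (gaussianTail_nonneg _ _)]; exact hle1 _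
  have hind : ∫ ω, Set.indicator {ω | y < W ω} (1 : Ω → ℝ) ω ∂μ = μ.real {ω | y < W ω} :=
    integral_indicator_one hset
  have hindi : Integrable (Set.indicator {ω | y < W ω} (1 : Ω → ℝ)) μ :=
    (integrable_const (1 : ℝ)).indicator hset
  have hneg := gaussianTail_neg hv.ne' δ
  have h0 := gaussianTail_nonneg v
  rw [← hind]
  have hc : ∀ c : ℝ, ∫ _, c ∂μ = c := fun c => by simp
  constructor
  · rw [← hc (gaussianTail v δ), ← integral_add (hint _) (integrable_const _)]
    refine integral_mono hindi ((hint _).add (integrable_const _)) fun ω => ?_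
    by_cases h : y < W ω
    · have := hanti (show y - δ - W ω ≤ -δ by linarith)
      simp [Set.indicator, h]; linarith
    · simp [Set.indicator, h]; linarith [h0 (y - δ - W ω), h0 δ]
  · rw [← hc (gaussianTail v δ), ← integral_sub (hint _) (integrable_const _)]
    refine integral_mono ((hint _).sub (integrable_const _)) hindi fun ω => ?_
    by_cases h : y < W ω
    · simp [Set.indicator, h]; linarith [hle1 (y + δ - W ω), h0 δ]
    · have := hanti (show δ ≤ y + δ - W ω by linarith)
      simp [Set.indicator, h]; linarith

end

/-! ### Quantitative bounds for the Laplace transform -/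

section

open scoped NNReal

universe u

/-- Consequences of the smallness condition `(1 + x) a ^ 2 ≤ ε ν ^ 2` used throughout. -/
lemma smallness_consequences {ε a ν q : ℝ} (hν : 1 ≤ ν) (ha : 1 ≤ a) (hq : 1 ≤ q)
    (h : q * a ^ 2 ≤ ε * ν ^ 2) :
    q ≤ ε * ν ^ 2 ∧ a ^ 4 / ν ^ 4 * q ^ 2 ≤ ε ^ 2 ∧ a ^ 4 / ν ^ 4 ≤ ε ^ 2 := by
  have hν0 : 0 < ν := by linarith
  have ha2 : 1 ≤ a ^ 2 := one_le_pow₀ ha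
  have h1 : a ^ 4 / ν ^ 4 * q ^ 2 ≤ ε ^ 2 := by
    rw [div_mul_eq_mul_div, div_le_iff₀ (by positivity)]
    calc a ^ 4 * q ^ 2 = (q * a ^ 2) ^ 2 := by ring
      _ ≤ (ε * ν ^ 2) ^ 2 := by gcongr
      _ = _ := by ring
  refine ⟨by nlinarith, h1, le_trans ?_ h1⟩
  exact le_mul_of_one_le_right (by positivity) (one_le_pow₀ hq)

lemma exists_cube_mul_exp_le {b : ℝ} (hb : 0 < b) :
    ∃ C : ℝ, 0 < C ∧ ∀ t : ℝ, (1 + |t|) ^ 3 * Real.exp (-(2 * b * t ^ 2)) ≤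
      C * Real.exp (-b * t ^ 2) := by
  refine ⟨6 * Real.exp (1 + 1 / b), by positivity, fun t => ?_⟩
  have h1 : (1 + |t|) ^ 3 ≤ 6 * Real.exp (1 + |t|) := by
    have := Real.pow_div_factorial_le_exp (x := 1 + |t|) (by positivity) 3
    rw [div_le_iff₀ (by positivity)] at this
    norm_num [Nat.factorial] at this
    linarith
  have h2 : |t| ≤ 1 / b + b * t ^ 2 := by
    rw [← sq_abs t]
    have : 1 / b + b * |t| ^ 2 - |t| = (1 / b) * ((b * |t| - 1 / 2) ^ 2 + 3 / 4) := by
      field_simp; ring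
    have : 0 ≤ (1 / b) * ((b * |t| - 1 / 2) ^ 2 + 3 / 4) := by positivity
    linarith
  calc (1 + |t|) ^ 3 * Real.exp (-(2 * b * t ^ 2))
      ≤ 6 * Real.exp (1 + |t|) * Real.exp (-(2 * b * t ^ 2)) := by gcongr
    _ = 6 * Real.exp (1 + |t| + -(2 * b * t ^ 2)) := by rw [mul_assoc, ← Real.exp_add]
    _ ≤ 6 * Real.exp (1 + 1 / b + -b * t ^ 2) :=
        mul_le_mul_of_nonneg_left (Real.exp_le_exp.2 (by linarith)) (by norm_num)
    _ = _ := by rw [mul_assoc, ← Real.exp_add]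

/-- A normalised sequence together with a level `x` in the range where the expansions are effective:
`(1 + x) a ^ 2` is at most a small multiple `ε` of `ν ^ 2 = n ^ (1 / 8)`, and the variance of the
sum lies between `c₀ > 0` and `3`. -/
structure IsAdmissible {Ω : Type*} [MeasurableSpace Ω] (ξ : ℕ → Ω → ℝ) (μ : Measure Ω) (n : ℕ)
    (a ν x c₀ ε : ℝ) : Prop extends IsNormalized ξ μ n a ν where
  c₀_pos : 0 < c₀
  le_sumVar : c₀ ≤ sumVar ξ μ n
  sumVar_le : sumVar ξ μ n ≤ 3
  x_nonneg : 0 ≤ x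
  small : (1 + x) * a ^ 2 ≤ ε * ν ^ 2
  ε_pos : 0 < ε
  ε_le_one : 100 * ε ≤ 1
  ε_le : 100 * ε ≤ c₀

set_option maxHeartbeats 1000000 in
/-- The parameters of the argument: `ε` measures the smallness of `(1 + x) a ^ 2 / ν ^ 2`, and the
Laplace transform is expanded for imaginary parts up to `c₁ ν ^ 8 / a ^ 4`. -/
theorem exists_laplace_bounds {c₀ : ℝ} (hc₀ : 0 < c₀) :
    ∃ ε c₁ C : ℝ, 0 < ε ∧ 100 * ε ≤ 1 ∧ 100 * ε ≤ c₀ ∧ 0 < c₁ ∧ 0 < C ∧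
      ∀ {Ω : Type u} [MeasurableSpace Ω] {μ : Measure Ω} [IsProbabilityMeasure μ]
        {ξ : ℕ → Ω → ℝ} {n : ℕ} {a ν x : ℝ}, IsAdmissible ξ μ n a ν x c₀ ε →
        (∀ p c : ℝ, 0 ≤ p → p ≤ (1 + x) / sumVar ξ μ n → 0 ≤ c → c ≤ 4 / c₀ →
          ∫ ω, Real.exp (p * linStat ξ μ n ν x ω + c * numExceed ξ n ν ω) ∂μ ≤
            3 * Real.exp (sumVar ξ μ n * p ^ 2 / 2)) ∧
        (∀ p : ℝ, p = (1 + x) / sumVar ξ μ n → ∀ t : ℝ, |t| ≤ c₁ * (ν ^ 8 / a ^ 4) →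
          ‖∫ ω, Complex.exp ((p + t * Complex.I) * linStat ξ μ n ν x ω) ∂μ -
            Complex.exp (sumVar ξ μ n * (p + t * Complex.I) ^ 2 / 2)‖ ≤
          Real.exp (sumVar ξ μ n * p ^ 2 / 2) *
            (C * (a ^ 4 / ν ^ 4 * (1 + x) ^ 2) * Real.exp (-(c₀ / 8) * t ^ 2))) := by
  obtain ⟨Cg, hCg, hcube⟩ := exists_cube_mul_exp_le (b := c₀ / 8) (by positivity)
  set R : ℝ := 2 + 4 / c₀ with hR
  set C₃ : ℝ := 2 * 10 ^ 8 * Real.exp (2 * R) ^ 3 with hC₃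
  set L : ℝ := 1 + 1 / c₀ with hL
  set m : ℝ := min 1 c₀ with hm
  have hR0 : 0 ≤ R := by positivity
  have hE : 1 ≤ Real.exp (2 * R) := Real.one_le_exp (by positivity)
  have hC₃E : 2 * 10 ^ 8 * Real.exp (2 * R) ≤ C₃ := by
    rw [hC₃]; gcongr
    exact le_self_pow₀ hE (by norm_num)
  have hC₃1 : 1 ≤ C₃ := by linarith
  have hL1 : 1 ≤ L := by rw [hL]; have : 0 < 1 / c₀ := by positivity
                         linarith
  have hm0 : 0 < m := lt_min one_pos hc₀
  have hm1 : m ≤ 1 := min_le_left _ _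
  have hmc : m ≤ c₀ := min_le_right _ _
  set c₁ : ℝ := m / (8 * C₃) with hc₁
  set ε : ℝ := m / (100 * C₃ * L ^ 2) with hε
  have hc₁0 : 0 < c₁ := by positivity
  have hε0 : 0 < ε := by positivity
  have hC₃L : 1 ≤ C₃ * L ^ 2 := one_le_mul_of_one_le_of_one_le hC₃1 (one_le_pow₀ hL1)
  have hεm' : 100 * ε ≤ m := by
    rw [hε, show 100 * (m / (100 * C₃ * L ^ 2)) = m / (C₃ * L ^ 2) by field_simp]
    exact div_le_self hm0.le hC₃L
  have hεm : ε ≤ m := by linarith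
  have hCε : C₃ * (ε * L ^ 2) = m / 100 := by rw [hε]; field_simp
  have hCc : C₃ * c₁ = m / 8 := by rw [hc₁]; field_simp
  clear_value C₃ L m c₁ ε R
  refine ⟨ε, c₁, 2 * C₃ * L ^ 2 * Real.exp 1 * Cg, hε0, hεm'.trans hm1, hεm'.trans hmc, hc₁0,
    by positivity, ?_⟩
  intro Ω _ μ _ ξ n a ν x ⟨H, _, hκ0, hκ3, hx, hsmall, _, _, _⟩
  set κ := sumVar ξ μ n with hκ
  have hν1 := H.one_le_ν
  have ha1 := H.one_le_a
  have hν0 := H.ν_pos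
  have ha0 := H.a_pos
  have hκpos : 0 < κ := hc₀.trans_le hκ0
  set q := 1 + x with hq
  have hq1 : 1 ≤ q := by linarith
  obtain ⟨hqν, hDq, hDε⟩ := smallness_consequences hν1 ha1 hq1 hsmall
  set D := a ^ 4 / ν ^ 4 with hD
  have hD0 : 0 ≤ D := by positivity
  clear_value D q
  have hxν : x ≤ ν ^ 2 := by
    have : ε * ν ^ 2 ≤ 1 * ν ^ 2 := by gcongr; exact hεm.trans hm1
    linarith
  have hqκ : q / κ ≤ q / c₀ := by gcongr
  -- bounds for all real parts up to `q / κ`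
  have hp_le : ∀ p, 0 ≤ p → p ≤ q / κ → p ≤ q * (1 / c₀) ∧ p / ν ^ 4 ≤ 1 ∧
      p * (2 * (ν ^ 3)⁻¹) ≤ R ∧ D * (1 + p ^ 2) ≤ ε * L ^ 2 ∧ 1 + p ≤ q * L := by
    intro p hp0 hp
    have h1 : p ≤ q * (1 / c₀) := by rw [mul_one_div]; exact hp.trans hqκ
    have h2 : p ≤ ν ^ 2 := by
      have : p ≤ q / c₀ := hp.trans hqκ
      rw [le_div_iff₀ hc₀] at this
      have h3 : ε * ν ^ 2 ≤ c₀ * ν ^ 2 := by gcongr; exact hεm.trans hmc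
      have : p * c₀ ≤ ν ^ 2 * c₀ := by linarith
      exact le_of_mul_le_mul_right this hc₀
    have h5 : 1 + p ≤ q * L := by rw [hL]; linarith
    refine ⟨h1, ?_, ?_, ?_, h5⟩
    · rw [div_le_one (by positivity)]
      exact h2.trans (pow_le_pow_right₀ hν1 (by norm_num))
    · have : p * (ν ^ 3)⁻¹ ≤ 1 := by
        rw [← div_eq_mul_inv, div_le_one (by positivity)]
        exact h2.trans (pow_le_pow_right₀ hν1 (by norm_num))
      have : 0 < 4 / c₀ := by positivity
      rw [hR]; linarith
    · have e1 : 1 + p ^ 2 ≤ (q * L) ^ 2 :=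
        le_trans (by linarith [add_sq 1 p]) (pow_le_pow_left₀ (by linarith) h5 2)
      have e2 : ε ^ 2 ≤ ε := pow_le_of_le_one hε0.le (hεm.trans hm1) two_ne_zero
      calc D * (1 + p ^ 2) ≤ D * (q * L) ^ 2 := by gcongr
        _ = D * q ^ 2 * L ^ 2 := by ring
        _ ≤ ε * L ^ 2 := by gcongr; exact hDq.trans e2
  -- the expansion applies up to imaginary part `c₁ ν ^ 8 / a ^ 4`
  have hδ : ∀ (z : ℂ) (p t : ℝ), 0 ≤ p → p ≤ q / κ → |t| ≤ c₁ * (ν ^ 8 / a ^ 4) →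
      ‖z‖ ≤ p + |t| → 120 * Real.exp (2 * R) * (a / ν ^ 8) * (1 + ‖z‖) ≤ 1 / 8 := by
    intro z p t hp0 hp ht hz
    obtain ⟨-, -, -, -, h5⟩ := hp_le p hp0 hp
    have e1 : a / ν ^ 8 * (1 + ‖z‖) ≤ ε * L ^ 2 + c₁ := by
      calc a / ν ^ 8 * (1 + ‖z‖) ≤ a / ν ^ 8 * (q * L + c₁ * (ν ^ 8 / a ^ 4)) :=
            mul_le_mul_of_nonneg_left (by linarith) (by positivity)
        _ = (q * a) / ν ^ 8 * L + c₁ * (1 / a ^ 3) := by field_simp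
        _ ≤ ε * L ^ 2 + c₁ * 1 := by
            refine add_le_add ?_ (mul_le_mul_of_nonneg_left ?_ hc₁0.le)
            · have e3 : q * a / ν ^ 8 ≤ ε := by
                rw [div_le_iff₀ (by positivity)]
                calc q * a ≤ q * a ^ 2 :=
                      mul_le_mul_of_nonneg_left (le_self_pow₀ ha1 (by norm_num)) (by linarith)
                  _ ≤ ε * ν ^ 2 := hsmall
                  _ ≤ ε * ν ^ 8 :=
                      mul_le_mul_of_nonneg_left (pow_le_pow_right₀ hν1 (by norm_num)) hε0.le
              calc q * a / ν ^ 8 * L ≤ ε * L :=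
                    mul_le_mul_of_nonneg_right e3 (by linarith)
                _ ≤ ε * L ^ 2 :=
                    mul_le_mul_of_nonneg_left (le_self_pow₀ hL1 (by norm_num)) hε0.le
            · rw [div_le_one (by positivity)]; exact one_le_pow₀ ha1
        _ = _ := by ring
    have e2 : Real.exp (2 * R) * (ε * L ^ 2 + c₁) * (2 * 10 ^ 8) ≤ 1 := by
      calc Real.exp (2 * R) * (ε * L ^ 2 + c₁) * (2 * 10 ^ 8) =
            (2 * 10 ^ 8 * Real.exp (2 * R)) * (ε * L ^ 2 + c₁) := by ring
        _ ≤ C₃ * (ε * L ^ 2 + c₁) := by gcongr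
        _ = m / 100 + m / 8 := by rw [mul_add, hCε, hCc]
        _ ≤ 1 := by linarith
    calc 120 * Real.exp (2 * R) * (a / ν ^ 8) * (1 + ‖z‖) =
          120 * (Real.exp (2 * R) * (a / ν ^ 8 * (1 + ‖z‖))) := by ring
      _ ≤ 120 * (Real.exp (2 * R) * (ε * L ^ 2 + c₁)) := by gcongr
      _ ≤ 1 / 8 := by linarith
  constructor
  · intro p c hp0 hp hc hc4
    obtain ⟨-, h2, h3, h4, -⟩ := hp_le p hp0 hp
    have hnorm : ‖(p : ℂ)‖ = p := by rw [Complex.norm_real, Real.norm_of_nonneg hp0]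
    obtain ⟨r, hr, he⟩ := H.exists_integral_exp_eq (z := (p : ℂ)) (c := c) (R := R) hx hxν hR0
      (by rwa [Complex.ofReal_re, abs_of_nonneg hp0]) hc (hc4.trans (by rw [hR]; linarith))
      (hδ p p 0 hp0 hp (by rw [abs_zero]; positivity) (by rw [hnorm, abs_zero, add_zero]))
    rw [← hC₃, ← hD] at hr
    have hr1 : ‖r‖ ≤ 1 := by
      refine hr.trans ?_
      rw [hnorm]
      calc C₃ * (D * (1 + p ^ 2) * (1 + p / ν ^ 4)) ≤ C₃ * (ε * L ^ 2 * (1 + 1)) := by gcongr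
        _ = 2 * (C₃ * (ε * L ^ 2)) := by ring
        _ ≤ 1 := by rw [hCε]; linarith
    have e1 : ((∫ ω, Real.exp (p * linStat ξ μ n ν x ω + c * numExceed ξ n ν ω) ∂μ : ℝ) : ℂ) =
        Complex.exp (κ * (p : ℂ) ^ 2 / 2 + r) := by
      rw [← he, ← integral_complex_ofReal]
      congr 1; ext ω; push_cast; rfl
    have e2 : 0 ≤ ∫ ω, Real.exp (p * linStat ξ μ n ν x ω + c * numExceed ξ n ν ω) ∂μ :=
      integral_nonneg fun ω => (Real.exp_pos _).le
    have e3 := congrArg norm e1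
    rw [Complex.norm_real, Real.norm_of_nonneg e2, Complex.norm_exp, Complex.add_re] at e3
    have e4 : ((κ : ℂ) * (p : ℂ) ^ 2 / 2).re = κ * p ^ 2 / 2 := by
      rw [show (κ : ℂ) * (p : ℂ) ^ 2 / 2 = ((κ * p ^ 2 / 2 : ℝ) : ℂ) by push_cast; rfl,
        Complex.ofReal_re]
    rw [e3, e4, Real.exp_add, mul_comm]
    gcongr
    calc Real.exp r.re ≤ Real.exp 1 := Real.exp_le_exp.2 ((Complex.re_le_norm r).trans hr1)
      _ ≤ 3 := by linarith [Real.exp_one_lt_d9]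
  · intro p hp t ht
    have hp0 : 0 ≤ p := by rw [hp]; positivity
    obtain ⟨h1, h2, h3, h4, h5⟩ := hp_le p hp0 hp.le
    set z : ℂ := p + t * Complex.I with hz
    have hzre : z.re = p := by simp [hz]
    have hznorm : ‖z‖ ≤ p + |t| := by
      refine (norm_add_le _ _).trans (le_of_eq ?_)
      rw [norm_mul, Complex.norm_I, mul_one, Complex.norm_real, Complex.norm_real,
        Real.norm_of_nonneg hp0, Real.norm_eq_abs]
    have hzsq : ‖z‖ ^ 2 = p ^ 2 + t ^ 2 := by
      rw [Complex.sq_norm, Complex.normSq_apply]; simp [hz]; ring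
    obtain ⟨r, hr, he⟩ := H.exists_integral_exp_eq (z := z) (c := 0) (R := R) hx hxν hR0
      (by rwa [hzre, abs_of_nonneg hp0]) le_rfl hR0 (hδ z p t hp0 hp.le ht hznorm)
    simp only [Complex.ofReal_zero, zero_mul, add_zero] at he
    rw [← hC₃, ← hD] at hr
    have hzν : 1 + ‖z‖ / ν ^ 4 ≤ 2 + |t| / ν ^ 4 := by
      have : ‖z‖ / ν ^ 4 ≤ (p + |t|) / ν ^ 4 := by gcongr
      rw [add_div] at this; linarith
    have ht1 : |t| / ν ^ 4 ≤ |t| := div_le_self (abs_nonneg _) (one_le_pow₀ hν1)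
    -- the remainder is dominated by a fraction of the Gaussian exponent
    have hr1 : ‖r‖ ≤ 1 + c₀ / 4 * t ^ 2 := by
      refine hr.trans ?_
      rw [hzsq]
      have b1 : D * |t| / ν ^ 4 ≤ c₁ := by
        rw [hD, div_le_iff₀ (by positivity), div_mul_eq_mul_div, div_le_iff₀ (by positivity)]
        calc a ^ 4 * |t| ≤ a ^ 4 * (c₁ * (ν ^ 8 / a ^ 4)) := by gcongr
          _ = c₁ * ν ^ 4 * ν ^ 4 := by field_simp
      have b2 : |t| ≤ 1 + t ^ 2 := by
        rw [← sq_abs t]; linarith [sq_nonneg (|t| - 1), sub_sq |t| 1, sq_nonneg |t|]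
      have b3 : D ≤ ε * L ^ 2 := by
        refine le_trans ?_ h4
        exact le_mul_of_one_le_right hD0 (by linarith [sq_nonneg p])
      have b4 : D * (1 + (p ^ 2 + t ^ 2)) * (1 + ‖z‖ / ν ^ 4) ≤
          3 * (ε * L ^ 2) + (3 * (ε * L ^ 2) + c₁) * t ^ 2 := by
        calc D * (1 + (p ^ 2 + t ^ 2)) * (1 + ‖z‖ / ν ^ 4) ≤
              D * (1 + (p ^ 2 + t ^ 2)) * (2 + |t| / ν ^ 4) := by gcongr
          _ = 2 * (D * (1 + p ^ 2)) + 2 * (D * t ^ 2) + (D * (1 + p ^ 2)) * (|t| / ν ^ 4) +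
              (D * |t| / ν ^ 4) * t ^ 2 := by ring
          _ ≤ 2 * (ε * L ^ 2) + 2 * (ε * L ^ 2 * t ^ 2) + (ε * L ^ 2) * (1 + t ^ 2) +
              c₁ * t ^ 2 := by
              gcongr; exact ht1.trans b2
          _ = _ := by ring
      have hA : 3 * (C₃ * (ε * L ^ 2)) ≤ 1 := by rw [hCε]; linarith
      have hB : 3 * (C₃ * (ε * L ^ 2)) + C₃ * c₁ ≤ c₀ / 4 := by rw [hCε, hCc]; linarith
      calc C₃ * (D * (1 + (p ^ 2 + t ^ 2)) * (1 + ‖z‖ / ν ^ 4)) ≤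
            C₃ * (3 * (ε * L ^ 2) + (3 * (ε * L ^ 2) + c₁) * t ^ 2) := by gcongr
        _ = 3 * (C₃ * (ε * L ^ 2)) + (3 * (C₃ * (ε * L ^ 2)) + C₃ * c₁) * t ^ 2 := by ring
        _ ≤ _ := by gcongr
    have hr2 : ‖r‖ ≤ 2 * C₃ * L ^ 2 * (D * q ^ 2) * (1 + |t|) ^ 3 := by
      refine hr.trans ?_
      have b1 : 1 + ‖z‖ ^ 2 ≤ (q * L * (1 + |t|)) ^ 2 := by
        have : 1 + ‖z‖ ≤ q * L * (1 + |t|) := by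
          have : 1 ≤ q * L := one_le_mul_of_one_le_of_one_le hq1 hL1
          have := le_mul_of_one_le_left (abs_nonneg t) this
          linarith [mul_add (q * L) 1 |t|]
        exact le_trans (by linarith [add_sq 1 ‖z‖, norm_nonneg z])
          (pow_le_pow_left₀ (by positivity) this 2)
      have b2 : 1 + ‖z‖ / ν ^ 4 ≤ 2 * (1 + |t|) := by linarith [abs_nonneg t]
      calc C₃ * (D * (1 + ‖z‖ ^ 2) * (1 + ‖z‖ / ν ^ 4)) ≤
            C₃ * (D * (q * L * (1 + |t|)) ^ 2 * (2 * (1 + |t|))) := by gcongr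
        _ = _ := by ring
    have hmain : ‖Complex.exp r - 1‖ ≤ ‖r‖ * Real.exp ‖r‖ := by
      simpa using Complex.norm_exp_sub_sum_le_norm_mul_exp r 1
    have hk : ‖Complex.exp (κ * z ^ 2 / 2)‖ ≤
        Real.exp (κ * p ^ 2 / 2) * Real.exp (-(c₀ / 2 * t ^ 2)) := by
      rw [Complex.norm_exp, ← Real.exp_add]
      refine Real.exp_le_exp.2 ?_
      have e4 : ((κ : ℂ) * z ^ 2 / 2).re = κ * (p ^ 2 - t ^ 2) / 2 := by
        rw [show (κ : ℂ) * z ^ 2 / 2 = ((κ / 2 : ℝ) : ℂ) * z ^ 2 by push_cast; ring,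
          Complex.re_ofReal_mul]
        simp [hz, pow_two]; ring
      rw [e4]
      linarith [mul_le_mul_of_nonneg_right hκ0 (sq_nonneg t)]
    have hfin : Complex.exp (κ * z ^ 2 / 2 + r) - Complex.exp (κ * z ^ 2 / 2) =
        Complex.exp (κ * z ^ 2 / 2) * (Complex.exp r - 1) := by rw [Complex.exp_add]; ring
    rw [he, hfin, norm_mul]
    calc ‖Complex.exp (κ * z ^ 2 / 2)‖ * ‖Complex.exp r - 1‖
        ≤ (Real.exp (κ * p ^ 2 / 2) * Real.exp (-(c₀ / 2 * t ^ 2))) *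
          ((2 * C₃ * L ^ 2 * (D * q ^ 2) * (1 + |t|) ^ 3) * Real.exp (1 + c₀ / 4 * t ^ 2)) := by
          gcongr
          exact hmain.trans (by gcongr)
      _ = Real.exp (κ * p ^ 2 / 2) * (2 * C₃ * L ^ 2 * (D * q ^ 2) * Real.exp 1 *
          ((1 + |t|) ^ 3 * Real.exp (-(2 * (c₀ / 8) * t ^ 2)))) := by
          have : Real.exp (-(2 * (c₀ / 8) * t ^ 2)) * Real.exp 1 =
              Real.exp (-(c₀ / 2 * t ^ 2)) * Real.exp (1 + c₀ / 4 * t ^ 2) := by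
            rw [← Real.exp_add, ← Real.exp_add]; congr 1; ring
          linear_combination (-(Real.exp (κ * p ^ 2 / 2) *
            (2 * C₃ * L ^ 2 * (D * q ^ 2) * (1 + |t|) ^ 3))) * this
      _ ≤ Real.exp (κ * p ^ 2 / 2) * (2 * C₃ * L ^ 2 * (D * q ^ 2) * Real.exp 1 *
          (Cg * Real.exp (-(c₀ / 8) * t ^ 2))) := by
          refine mul_le_mul_of_nonneg_left (mul_le_mul_of_nonneg_left (hcube t) ?_) ?_ <;>
            positivity
      _ = _ := by ring

end

/-! ### The smoothed tail of the linearised statistic -/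

section

open scoped NNReal

lemma numExceed_nonneg {Ω : Type*} (ξ : ℕ → Ω → ℝ) (n : ℕ) (ν : ℝ) (ω : Ω) :
    0 ≤ numExceed ξ n ν ω :=
  Finset.sum_nonneg fun _ _ => exceed_nonneg _ _

lemma numExceed_le {Ω : Type*} (ξ : ℕ → Ω → ℝ) (n : ℕ) (ν : ℝ) (ω : Ω) :
    numExceed ξ n ν ω ≤ n := by
  refine (Finset.sum_le_sum fun j _ => exceed_le_one (ν ^ 3)⁻¹ (ξ j ω)).trans_eq ?_
  simp

variable {Ω : Type*} [MeasurableSpace Ω] {μ : Measure Ω}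
  {ξ : ℕ → Ω → ℝ} {n : ℕ} {a ν x c₀ ε : ℝ}

namespace IsNormalized

lemma measurable_linStat (H : IsNormalized ξ μ n a ν) (x : ℝ) :
    Measurable (linStat ξ μ n ν x) :=
  Finset.measurable_fun_sum _ fun j hj =>
    (measurable_linTerm _ _ _).comp (H.measurable j (Finset.mem_Icc.1 hj).1)

lemma measurable_numExceed (H : IsNormalized ξ μ n a ν) : Measurable (numExceed ξ n ν) :=
  Finset.measurable_fun_sum _ fun j hj =>
    (measurable_exceed _).comp (H.measurable j (Finset.mem_Icc.1 hj).1)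

variable [IsProbabilityMeasure μ]

lemma abs_linTerm_le (H : IsNormalized ξ μ n a ν) (hx : 0 ≤ x) (hxν : x ≤ ν ^ 2) {j : ℕ}
    (h1 : 1 ≤ j) (h2 : j ≤ n) (y : ℝ) :
    |linTerm (ν ^ 3)⁻¹ x (∫ ω, ξ j ω ^ 2 ∂μ) y| ≤ 2 * (ν ^ 3)⁻¹ := by
  have hν0 := H.ν_pos
  refine SelfNormalized.abs_linTerm_le (by positivity) (integral_nonneg fun ω => sq_nonneg _)
    (H.sq_le h1 h2) H.scale_pos.le H.scale_le hx ?_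
  rw [← div_eq_mul_inv, div_le_one (by positivity)]
  exact hxν.trans (pow_le_pow_right₀ H.one_le_ν (by norm_num))

lemma abs_linStat_le (H : IsNormalized ξ μ n a ν) (hx : 0 ≤ x) (hxν : x ≤ ν ^ 2) (ω : Ω) :
    |linStat ξ μ n ν x ω| ≤ n * (2 * (ν ^ 3)⁻¹) := by
  refine (Finset.abs_sum_le_sum_abs _ _).trans ?_
  refine (Finset.sum_le_sum fun j hj => H.abs_linTerm_le hx hxν (Finset.mem_Icc.1 hj).1
    (Finset.mem_Icc.1 hj).2 _).trans_eq ?_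
  simp

lemma integrable_exp (H : IsNormalized ξ μ n a ν) (hx : 0 ≤ x) (hxν : x ≤ ν ^ 2) (p c : ℝ) :
    Integrable (fun ω => Real.exp (p * linStat ξ μ n ν x ω + c * numExceed ξ n ν ω)) μ := by
  have m1 := H.measurable_linStat x
  have m2 := H.measurable_numExceed
  refine integrable_of_measurable_of_bound (by fun_prop)
    (K := Real.exp (|p| * (n * (2 * (ν ^ 3)⁻¹)) + |c| * n)) fun ω => ?_
  rw [Real.norm_eq_abs, Real.abs_exp]
  refine Real.exp_le_exp.2 (add_le_add ?_ ?_)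
  · refine (le_abs_self _).trans ?_
    rw [abs_mul]
    exact mul_le_mul_of_nonneg_left (H.abs_linStat_le hx hxν ω) (abs_nonneg _)
  · refine (le_abs_self _).trans ?_
    rw [abs_mul, abs_of_nonneg (numExceed_nonneg ξ n ν ω)]
    exact mul_le_mul_of_nonneg_left (numExceed_le ξ n ν ω) (abs_nonneg _)

end IsNormalized

variable [IsProbabilityMeasure μ]

lemma exp_neg_le_of_pow_three {c₁ ν : ℝ} (hc₁ : 0 < c₁) (hν : 0 < ν) :
    Real.exp (-(c₁ ^ 2 * ν ^ 4 / 4)) ≤ 384 / (c₁ ^ 6 * ν ^ 12) := by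
  have := Real.pow_div_factorial_le_exp (x := c₁ ^ 2 * ν ^ 4 / 4) (by positivity) 3
  rw [Real.exp_neg, inv_le_comm₀ (Real.exp_pos _) (by positivity)]
  refine le_trans (le_of_eq ?_) this
  norm_num [Nat.factorial]
  field_simp
  norm_num

/-- The smoothed tail of the linearised statistic. The vertical line through `p` is cut at height
`T = c₁ ν ^ 8 / a ^ 4`; beyond it, the Gaussian factor of variance `v = (a ^ 4 / ν ^ 6) ^ 2` is
negligible because `v T ^ 2 = c₁ ^ 2 ν ^ 4`. -/
lemma abs_integral_gaussianTail_linStat_sub_le (H : IsNormalized ξ μ n a ν)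
    (hx : 0 ≤ x) (hxν : x ≤ ν ^ 2) {κ v : ℝ≥0}
    (hv : (v : ℝ) = (a ^ 4 / ν ^ 6) ^ 2) {p q c₁ C : ℝ} (hc₀ : 0 < c₀) (hc₁ : 0 < c₁) (hC : 0 < C)
    (hp : 0 < p) (hq : 1 ≤ q) (hvp : v * p ^ 2 ≤ 1)
    (h1 : ∫ ω, Real.exp (p * linStat ξ μ n ν x ω) ∂μ ≤ 3 * Real.exp (κ * p ^ 2 / 2))
    (h2 : ∀ t : ℝ, |t| ≤ c₁ * (ν ^ 8 / a ^ 4) →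
      ‖∫ ω, Complex.exp ((p + t * Complex.I) * linStat ξ μ n ν x ω) ∂μ -
        Complex.exp (κ * (p + t * Complex.I) ^ 2 / 2)‖ ≤
      Real.exp (κ * p ^ 2 / 2) * (C * (a ^ 4 / ν ^ 4 * q ^ 2) * Real.exp (-(c₀ / 8) * t ^ 2)))
    (y : ℝ) :
    |∫ ω, gaussianTail v (y - linStat ξ μ n ν x ω) ∂μ - gaussianTail (κ + v) y| ≤
      Real.exp (-(p * y)) / p * (Real.exp (κ * p ^ 2 / 2) *
        ((2 * C * Real.sqrt (Real.pi / (c₀ / 8)) + 12288 / c₁ ^ 6) * (a ^ 4 / ν ^ 4 * q ^ 2))) := by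
  have hν0 := H.ν_pos
  have hν1 := H.one_le_ν
  have ha0 := H.a_pos
  have ha1 := H.one_le_a
  have hv0 : (0 : ℝ) < v := by rw [hv]; positivity
  set Q := a ^ 4 / ν ^ 4 * q ^ 2 with hQ
  have hQ0 : 0 < Q := by positivity
  set E := Real.exp (κ * p ^ 2 / 2) with hE
  have hE0 : 0 < E := Real.exp_pos _
  set s := Real.exp (-(c₁ ^ 2 * ν ^ 4 / 4)) with hs
  have hs0 : 0 < s := Real.exp_pos _
  have he2 : Real.exp (1 / 2) ≤ 2 := by
    have : Real.exp (1 / 2) ^ 2 ≤ 2 ^ 2 := by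
      rw [← Real.exp_nat_mul]; norm_num; linarith [Real.exp_one_lt_d9]
    exact le_of_sq_le_sq this (by norm_num)
  have hgi1 : Integrable fun t : ℝ => Real.exp (-(c₀ / 8) * t ^ 2) :=
    integrable_exp_neg_mul_sq (by positivity)
  have hgi2 : Integrable fun t : ℝ => Real.exp (-(v / 4 : ℝ) * t ^ 2) :=
    integrable_exp_neg_mul_sq (by positivity)
  have hfac : ∀ t : ℝ, Real.exp (v * (p ^ 2 - t ^ 2) / 2) ≤ 2 * Real.exp (-(v / 2 * t ^ 2)) :=
    fun t => by
    refine le_trans ?_ (mul_le_mul_of_nonneg_right he2 (Real.exp_pos _).le)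
    rw [← Real.exp_add]
    exact Real.exp_le_exp.2 (by linarith)
  have hM := abs_integral_gaussianTail_sub_le (μ := μ) (H.measurable_linStat x)
    (H.abs_linStat_le hx hxν) (κ := κ) (v := v) (by exact_mod_cast hv0) hp
    (H := fun t => E * (2 * C * Q) * Real.exp (-(c₀ / 8) * t ^ 2) +
      E * (8 * s) * Real.exp (-(v / 4 : ℝ) * t ^ 2))
    ((hgi1.const_mul _).add (hgi2.const_mul _)) ?_ y
  · refine hM.trans (mul_le_mul_of_nonneg_left ?_ (by positivity))
    rw [integral_add (hgi1.const_mul _) (hgi2.const_mul _), integral_const_mul, integral_const_mul,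
      integral_gaussian, integral_gaussian]
    have hsv : Real.sqrt (Real.pi / (v / 4)) ≤ 4 * ν ^ 6 := by
      rw [Real.sqrt_le_left (by positivity), hv, div_div_eq_mul_div, div_le_iff₀ (by positivity)]
      have : Real.pi * 4 ≤ 16 := by linarith [Real.pi_lt_four]
      calc Real.pi * 4 ≤ 16 * a ^ 8 := this.trans (by linarith [one_le_pow₀ ha1 (n := 8)])
        _ = _ := by field_simp; norm_num
    have hsQ : 8 * s * Real.sqrt (Real.pi / (v / 4)) ≤ 12288 / c₁ ^ 6 * Q := by
      calc 8 * s * Real.sqrt (Real.pi / (v / 4)) ≤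
            8 * (384 / (c₁ ^ 6 * ν ^ 12)) * (4 * ν ^ 6) :=
            mul_le_mul (mul_le_mul_of_nonneg_left (exp_neg_le_of_pow_three hc₁ hν0) (by norm_num))
              hsv (Real.sqrt_nonneg _) (by positivity)
        _ = 12288 / c₁ ^ 6 * (1 / ν ^ 4 * (1 / ν ^ 2)) := by field_simp; norm_num
        _ ≤ 12288 / c₁ ^ 6 * Q := by
            refine mul_le_mul_of_nonneg_left ?_ (by positivity)
            have b1 : 1 / ν ^ 2 ≤ 1 := by
              rw [div_le_one (by positivity)]; exact one_le_pow₀ hν1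
            have b2 : 1 / ν ^ 4 ≤ a ^ 4 / ν ^ 4 :=
              div_le_div_of_nonneg_right (one_le_pow₀ ha1) (by positivity)
            calc 1 / ν ^ 4 * (1 / ν ^ 2) ≤ a ^ 4 / ν ^ 4 * 1 :=
                  mul_le_mul b2 b1 (by positivity) (by positivity)
              _ ≤ Q := mul_le_mul_of_nonneg_left (one_le_pow₀ hq) (by positivity)
    have hpi : (2 * Real.pi)⁻¹ ≤ 1 := inv_le_one_of_one_le₀ (by linarith [Real.pi_gt_three])
    refine (mul_le_of_le_one_left (by positivity) hpi).trans ?_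
    calc E * (2 * C * Q) * Real.sqrt (Real.pi / (c₀ / 8)) +
          E * (8 * s) * Real.sqrt (Real.pi / (v / 4)) =
          E * (2 * C * Q * Real.sqrt (Real.pi / (c₀ / 8)) +
            8 * s * Real.sqrt (Real.pi / (v / 4))) := by ring
      _ ≤ E * (2 * C * Q * Real.sqrt (Real.pi / (c₀ / 8)) + 12288 / c₁ ^ 6 * Q) :=
          mul_le_mul_of_nonneg_left (add_le_add le_rfl hsQ) hE0.le
      _ = _ := by ring
  · intro t
    have hp1 : 0 < E * (8 * s) * Real.exp (-(v / 4 : ℝ) * t ^ 2) := by positivity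
    have hp2 : 0 < E * (2 * C * Q) * Real.exp (-(c₀ / 8) * t ^ 2) := by positivity
    rcases le_or_gt |t| (c₁ * (ν ^ 8 / a ^ 4)) with ht | ht
    · have hle : Real.exp (v * (p ^ 2 - t ^ 2) / 2) ≤ 2 :=
        (hfac t).trans (mul_le_of_le_one_right (by norm_num)
          (Real.exp_le_one_iff.2 (by have : 0 ≤ v / 2 * t ^ 2 := by positivity
                                     linarith)))
      refine (mul_le_mul (h2 t ht) hle (Real.exp_pos _).le (by positivity)).trans ?_
      refine le_trans (le_of_eq ?_) (le_add_of_nonneg_right hp1.le)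
      ring
    · have hG : ‖Complex.exp (κ * (p + t * Complex.I) ^ 2 / 2)‖ ≤ E := by
        have := norm_exp_vertical κ p t 0
        rw [Complex.ofReal_zero, mul_zero, sub_zero, mul_zero, sub_zero] at this
        have hcast : ((κ : ℝ) : ℂ) = (κ : ℂ) := rfl
        rw [hcast] at this
        rw [this, hE]
        have : 0 ≤ κ * t ^ 2 := by positivity
        exact Real.exp_le_exp.2 (by linarith)
      have hMt : ‖∫ ω, Complex.exp ((p + t * Complex.I) * linStat ξ μ n ν x ω) ∂μ‖ ≤ 3 * E := by
        refine (norm_integral_le_integral_norm _).trans ?_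
        refine le_trans (le_of_eq ?_) h1
        congr 1; ext ω
        rw [Complex.norm_exp]
        simp
      have hT : c₁ ^ 2 * ν ^ 4 ≤ v * t ^ 2 := by
        have : (c₁ * (ν ^ 8 / a ^ 4)) ^ 2 ≤ t ^ 2 := by
          rw [← sq_abs t]; exact pow_le_pow_left₀ (by positivity) ht.le 2
        refine le_trans (le_of_eq ?_) (mul_le_mul_of_nonneg_left this hv0.le)
        rw [hv]; field_simp
      have hle : Real.exp (v * (p ^ 2 - t ^ 2) / 2) ≤
          2 * (s * Real.exp (-(v / 4 : ℝ) * t ^ 2)) := by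
        refine (hfac t).trans (mul_le_mul_of_nonneg_left ?_ (by norm_num))
        rw [hs, ← Real.exp_add]
        exact Real.exp_le_exp.2 (by linarith)
      refine (mul_le_mul ((norm_sub_le _ _).trans (add_le_add hMt hG)) hle (Real.exp_pos _).le
        (by positivity)).trans ?_
      refine le_trans (le_of_eq ?_) (le_add_of_nonneg_left hp2.le)
      ring

end

/-! ### The tail of the linearised statistic -/

section

open scoped NNReal

/-- Perturbation of the variance and of the argument of a Gaussian tail. -/
lemma abs_gaussianTail_add_sub_le {κ v : ℝ≥0} {c₀ x y q D : ℝ} (hc₀ : 0 < c₀) (hκ : c₀ ≤ κ)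
    (hx : 0 ≤ x) (hq : q = 1 + x) (hv : v ≤ D) (hDq : D * q ^ 2 ≤ 1) (hy : |y - x| ≤ 2 * (q * D)) :
    |gaussianTail (κ + v) y - gaussianTail 1 (x / Real.sqrt κ)| ≤
      (2 / Real.sqrt c₀ + 1 / Real.sqrt c₀ ^ 3) *
        Real.exp ((2 / Real.sqrt c₀ + 1 / Real.sqrt c₀ ^ 3) / Real.sqrt c₀) *
        (q * D * Real.exp (-(x ^ 2 / (2 * κ)))) := by
  have hκ0 : (0 : ℝ) < κ := hc₀.trans_le hκ
  have hv0 : (0 : ℝ) ≤ v := v.2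
  have hD0 : 0 ≤ D := hv0.trans hv
  rw [gaussianTail_eq_gaussianTail_one (add_pos_of_pos_of_nonneg (by exact_mod_cast hκ0) (zero_le))]
  rw [NNReal.coe_add]
  set m := Real.sqrt c₀
  set r := Real.sqrt κ with hr
  set r' := Real.sqrt (κ + v) with hr'
  have hm : 0 < m := Real.sqrt_pos.2 hc₀
  have hmr : m ≤ r := Real.sqrt_le_sqrt hκ
  have hrr : r ≤ r' := Real.sqrt_le_sqrt (by linarith)
  have hr0 : 0 < r := hm.trans_le hmr
  have hr0' : 0 < r' := hr0.trans_le hrr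
  have hr2 : r ^ 2 = κ := Real.sq_sqrt hκ0.le
  have hr2' : r' ^ 2 = κ + v := Real.sq_sqrt (by linarith)
  set B := 2 / m + 1 / m ^ 3 with hB
  have hB0 : 0 < B := by positivity
  have hq1 : 1 ≤ q := by linarith
  have e1 : y / r' - x / r = (y - x) / r' - x * (v / (r * r' * (r + r'))) := by
    have : (v : ℝ) = (r' - r) * (r + r') := by
      have : (v : ℝ) = r' ^ 2 - r ^ 2 := by rw [hr2, hr2']; ring
      rw [this]; ring
    rw [this]; field_simp; ring
  have hΔ : |y / r' - x / r| ≤ B * (q * D) := by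
    rw [e1]
    have t1 : |(y - x) / r'| ≤ 2 * (q * D) / m := by
      rw [abs_div, abs_of_pos hr0']
      exact div_le_div₀ (by positivity) hy hm (hmr.trans hrr)
    have t2 : |x * (v / (r * r' * (r + r')))| ≤ q * (D / m ^ 3) := by
      rw [abs_of_nonneg (by positivity)]
      refine mul_le_mul (by linarith) ?_ (by positivity) (by linarith)
      refine div_le_div₀ hD0 hv (by positivity) ?_
      calc m ^ 3 = m * m * m := by ring
        _ ≤ r * r' * (r + r') := mul_le_mul (mul_le_mul hmr (hmr.trans hrr) hm.le hr0.le)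
            (by linarith) hm.le (by positivity)
    refine (abs_sub _ _).trans ((add_le_add t1 t2).trans_eq ?_)
    rw [hB]; ring
  refine (abs_gaussianTail_one_sub_le (x / r) (y / r')).trans ?_
  have hX : |x / r| ≤ q / m := by
    rw [abs_of_nonneg (by positivity)]
    exact div_le_div₀ (by linarith) (by linarith) hm hmr
  have hXΔ : |x / r| * |y / r' - x / r| ≤ B / m := by
    calc |x / r| * |y / r' - x / r| ≤ q / m * (B * (q * D)) :=
          mul_le_mul hX hΔ (abs_nonneg _) (by positivity)
      _ = B / m * (D * q ^ 2) := by ring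
      _ ≤ B / m * 1 := mul_le_mul_of_nonneg_left hDq (by positivity)
      _ = _ := mul_one _
  have e2 : (x / r) ^ 2 / 2 = x ^ 2 / (2 * κ) := by rw [div_pow, hr2]; field_simp
  rw [e2]
  calc _ ≤ B * (q * D) * Real.exp (B / m) * Real.exp (-(x ^ 2 / (2 * κ))) :=
        mul_le_mul_of_nonneg_right (mul_le_mul hΔ (Real.exp_le_exp.2 hXΔ) (Real.exp_pos _).le
          (by positivity)) (Real.exp_pos _).le
    _ = _ := by ring

/-- The exponential tilt `p = (1 + x) / κ` produces the Gaussian factor `exp (-x ^ 2 / (2 κ))` and,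
through `1 / p`, gains one power of `1 + x`. -/
lemma exp_tilt_div_le {κ c₀ x y q D p : ℝ} (hc₀ : 0 < c₀) (hκ : c₀ ≤ κ) (hκ3 : κ ≤ 3)
    (hx : 0 ≤ x) (hq : q = 1 + x) (hD : 0 ≤ D) (hp : p = q / κ) (hDq : D * q ^ 2 ≤ 1)
    (hy : |y - x| ≤ 2 * (q * D)) :
    Real.exp (-(p * y)) * Real.exp (κ * p ^ 2 / 2) ≤
        Real.exp (5 / (2 * c₀)) * Real.exp (-(x ^ 2 / (2 * κ))) ∧
      Real.exp (-(p * y)) / p * (Real.exp (κ * p ^ 2 / 2) * (D * q ^ 2)) ≤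
        3 * Real.exp (5 / (2 * c₀)) * (q * D * Real.exp (-(x ^ 2 / (2 * κ)))) := by
  have hκ0 : 0 < κ := hc₀.trans_le hκ
  have hq1 : 1 ≤ q := by linarith
  have hp0 : 0 < p := by rw [hp]; positivity
  have h1 : Real.exp (-(p * y)) * Real.exp (κ * p ^ 2 / 2) ≤
        Real.exp (5 / (2 * c₀)) * Real.exp (-(x ^ 2 / (2 * κ))) := by
    rw [← Real.exp_add, ← Real.exp_add]
    refine Real.exp_le_exp.2 ?_
    have e1 : -(p * y) + κ * p ^ 2 / 2 = 1 / (2 * κ) + q * (x - y) / κ + -(x ^ 2 / (2 * κ)) := by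
      rw [hp, hq]; field_simp; ring
    have e2 : q * (x - y) ≤ 2 := by
      calc q * (x - y) ≤ q * (2 * (q * D)) :=
            mul_le_mul_of_nonneg_left (by rw [abs_sub_comm] at hy; exact (le_abs_self _).trans hy)
              (by linarith)
        _ = 2 * (D * q ^ 2) := by ring
        _ ≤ 2 := by linarith
    have e3 : 1 / (2 * κ) + q * (x - y) / κ ≤ 5 / (2 * c₀) := by
      calc 1 / (2 * κ) + q * (x - y) / κ ≤ 1 / (2 * κ) + 2 / κ :=
            add_le_add le_rfl (div_le_div_of_nonneg_right e2 hκ0.le)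
        _ = 5 / (2 * κ) := by field_simp; norm_num
        _ ≤ _ := div_le_div_of_nonneg_left (by norm_num) (by positivity) (by linarith)
    rw [e1]; linarith
  refine ⟨h1, ?_⟩
  have h2 : 1 / p * (D * q ^ 2) ≤ 3 * (q * D) := by
    have : 1 / p * (D * q ^ 2) = κ * (q * D) := by rw [hp]; field_simp
    rw [this]
    exact mul_le_mul_of_nonneg_right hκ3 (by positivity)
  calc Real.exp (-(p * y)) / p * (Real.exp (κ * p ^ 2 / 2) * (D * q ^ 2)) =
        (Real.exp (-(p * y)) * Real.exp (κ * p ^ 2 / 2)) * (1 / p * (D * q ^ 2)) := by ring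
    _ ≤ (Real.exp (5 / (2 * c₀)) * Real.exp (-(x ^ 2 / (2 * κ)))) * (3 * (q * D)) :=
        mul_le_mul h1 h2 (by positivity) (by positivity)
    _ = _ := by ring

variable {Ω : Type*} [MeasurableSpace Ω] {μ : Measure Ω}
  {ξ : ℕ → Ω → ℝ} {n : ℕ} {a ν x c₀ ε : ℝ}

namespace IsAdmissible

lemma small_consequences (H : IsAdmissible ξ μ n a ν x c₀ ε) :
    1 + x ≤ ε * ν ^ 2 ∧ a ^ 4 / ν ^ 4 * (1 + x) ^ 2 ≤ ε ^ 2 ∧ a ^ 4 / ν ^ 4 ≤ ε ^ 2 :=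
  smallness_consequences H.one_le_ν H.one_le_a (by linarith [H.x_nonneg]) H.small

lemma sumVar_pos (H : IsAdmissible ξ μ n a ν x c₀ ε) : 0 < sumVar ξ μ n :=
  H.c₀_pos.trans_le H.le_sumVar

lemma ε_sq_le (H : IsAdmissible ξ μ n a ν x c₀ ε) : ε ^ 2 ≤ 1 :=
  pow_le_one₀ H.ε_pos.le (by linarith [H.ε_le_one, H.ε_pos])

lemma x_le (H : IsAdmissible ξ μ n a ν x c₀ ε) : x ≤ ν ^ 2 := by
  have h1 := H.small_consequences.1
  have h2 : ε * ν ^ 2 ≤ 1 * ν ^ 2 :=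
    mul_le_mul_of_nonneg_right (by linarith [H.ε_le_one, H.ε_pos]) (sq_nonneg _)
  linarith

lemma exp_neg_half_pow_four_le (H : IsAdmissible ξ μ n a ν x c₀ ε) :
    Real.exp (-(ν ^ 4 / 2)) ≤
      4 * ((1 + x) * (a ^ 4 / ν ^ 4) * Real.exp (-(x ^ 2 / (2 * sumVar ξ μ n)))) := by
  have hν0 := H.ν_pos
  have hκ := H.sumVar_pos
  have hx := H.x_nonneg
  have hc := H.c₀_pos
  have h1 : x ^ 2 / (2 * sumVar ξ μ n) ≤ ν ^ 4 / 4 := by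
    rw [div_le_iff₀ (by positivity)]
    have e1 : x ^ 2 ≤ (ε * ν ^ 2) ^ 2 :=
      pow_le_pow_left₀ hx (by linarith [H.small_consequences.1]) 2
    have e2 : ε ^ 2 ≤ 1 * c₀ := by
      rw [pow_two]
      exact mul_le_mul (by linarith [H.ε_le_one, H.ε_pos]) (by linarith [H.ε_le, H.ε_pos])
        H.ε_pos.le zero_le_one
    have e3 : ε ≤ 1 / 100 := by linarith [H.ε_le_one]
    have e4 : ε ^ 2 ≤ sumVar ξ μ n / 2 := by
      have : ε * ε ≤ 1 / 100 * c₀ := mul_le_mul e3 (by linarith [H.ε_le, H.ε_pos])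
        H.ε_pos.le (by norm_num)
      rw [pow_two]; linarith [H.le_sumVar]
    calc x ^ 2 ≤ ε ^ 2 * ν ^ 4 := e1.trans_eq (by ring)
      _ ≤ sumVar ξ μ n / 2 * ν ^ 4 := mul_le_mul_of_nonneg_right e4 (by positivity)
      _ = _ := by ring
  have h2 : Real.exp (-(ν ^ 4 / 4)) ≤ 4 * ((1 + x) * (a ^ 4 / ν ^ 4)) := by
    have : ν ^ 4 / 4 ≤ Real.exp (ν ^ 4 / 4) := by linarith [Real.add_one_le_exp (ν ^ 4 / 4)]
    rw [Real.exp_neg, inv_le_comm₀ (Real.exp_pos _) (by have := H.a_pos; positivity)]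
    refine le_trans ?_ this
    rw [inv_le_comm₀ (by have := H.a_pos; positivity) (by positivity), inv_div]
    have e1 : 1 ≤ (1 + x) * a ^ 4 :=
      one_le_mul_of_one_le_of_one_le (by linarith) (one_le_pow₀ H.one_le_a)
    calc 4 / ν ^ 4 ≤ 4 * ((1 + x) * a ^ 4) / ν ^ 4 :=
          div_le_div_of_nonneg_right (by linarith) (by positivity)
      _ = _ := by ring
  calc Real.exp (-(ν ^ 4 / 2)) = Real.exp (-(ν ^ 4 / 4)) * Real.exp (-(ν ^ 4 / 4)) := by
        rw [← Real.exp_add]; congr 1; ring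
    _ ≤ 4 * ((1 + x) * (a ^ 4 / ν ^ 4)) * Real.exp (-(x ^ 2 / (2 * sumVar ξ μ n))) :=
        mul_le_mul h2 (Real.exp_le_exp.2 (by linarith)) (Real.exp_pos _).le
          (by have := H.a_pos; positivity)
    _ = _ := by ring

end IsAdmissible

/-- The tail of the linearised statistic at any level within `(1 + x) a ^ 4 / ν ^ 4` of `x`. -/
theorem exists_abs_measureReal_linStat_sub_le {c₁ C : ℝ} (hc₀ : 0 < c₀) (hc₁ : 0 < c₁)
    (hC : 0 < C) :
    ∃ C' : ℝ, 0 < C' ∧ ∀ {Ω : Type*} [MeasurableSpace Ω] {μ : Measure Ω} [IsProbabilityMeasure μ]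
      {ξ : ℕ → Ω → ℝ} {n : ℕ} {a ν x ε : ℝ}, IsAdmissible ξ μ n a ν x c₀ ε →
      (∀ p c : ℝ, 0 ≤ p → p ≤ (1 + x) / sumVar ξ μ n → 0 ≤ c → c ≤ 4 / c₀ →
          ∫ ω, Real.exp (p * linStat ξ μ n ν x ω + c * numExceed ξ n ν ω) ∂μ ≤
            3 * Real.exp (sumVar ξ μ n * p ^ 2 / 2)) →
      (∀ p : ℝ, p = (1 + x) / sumVar ξ μ n → ∀ t : ℝ, |t| ≤ c₁ * (ν ^ 8 / a ^ 4) →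
          ‖∫ ω, Complex.exp ((p + t * Complex.I) * linStat ξ μ n ν x ω) ∂μ -
            Complex.exp (sumVar ξ μ n * (p + t * Complex.I) ^ 2 / 2)‖ ≤
          Real.exp (sumVar ξ μ n * p ^ 2 / 2) *
            (C * (a ^ 4 / ν ^ 4 * (1 + x) ^ 2) * Real.exp (-(c₀ / 8) * t ^ 2))) →
      ∀ y : ℝ, |y - x| ≤ (1 + x) * (a ^ 4 / ν ^ 4) →
        |μ.real {ω | y < linStat ξ μ n ν x ω} - gaussianTail 1 (x / Real.sqrt (sumVar ξ μ n))| ≤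
          C' * ((1 + x) * (a ^ 4 / ν ^ 4) * Real.exp (-(x ^ 2 / (2 * sumVar ξ μ n)))) := by
  set K : ℝ := 2 * C * Real.sqrt (Real.pi / (c₀ / 8)) + 12288 / c₁ ^ 6 with hK
  set B : ℝ := (2 / Real.sqrt c₀ + 1 / Real.sqrt c₀ ^ 3) *
        Real.exp ((2 / Real.sqrt c₀ + 1 / Real.sqrt c₀ ^ 3) / Real.sqrt c₀) with hB
  have hK0 : 0 < K := by positivity
  have hB0 : 0 < B := by positivity
  refine ⟨K * (3 * Real.exp (5 / (2 * c₀))) + B + 4, by positivity, ?_⟩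
  intro Ω _ μ _ ξ n a ν x ε H h1 h2 y hy
  have hν0 := H.ν_pos
  have hν1 := H.one_le_ν
  have ha0 := H.a_pos
  have ha1 := H.one_le_a
  have hx := H.x_nonneg
  have hκ0 := H.sumVar_pos
  obtain ⟨hqν, hDq, hDε⟩ := H.small_consequences
  have hε1 := H.ε_sq_le
  have hq1 : 1 ≤ 1 + x := by linarith
  obtain ⟨κ, hκ⟩ : ∃ κ : ℝ≥0, (κ : ℝ) = sumVar ξ μ n := ⟨⟨_, hκ0.le⟩, rfl⟩
  obtain ⟨v, hv⟩ : ∃ v : ℝ≥0, (v : ℝ) = (a ^ 4 / ν ^ 6) ^ 2 := ⟨⟨_, sq_nonneg _⟩, rfl⟩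
  have hκC : ((sumVar ξ μ n : ℝ) : ℂ) = (κ : ℂ) := by rw [← hκ]
  have hv0 : (0 : ℝ) < v := by rw [hv]; positivity
  have hκc := H.le_sumVar
  have hκ3 := H.sumVar_le
  have hexp := H.exp_neg_half_pow_four_le
  have hsmall := H.small
  have hεc := H.ε_le
  have hε0 := H.ε_pos
  have hxν := H.x_le
  have a1 := h1
  simp only [hκC] at h2
  rw [← hκ] at h1 h2 hκc hκ3 hexp hκ0 ⊢
  set q := 1 + x with hq
  set D := a ^ 4 / ν ^ 4 with hD
  have hD0 : 0 < D := by positivity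
  obtain ⟨p, hp⟩ : ∃ p, p = q / (κ : ℝ) := ⟨_, rfl⟩
  have hp0 : 0 < p := by rw [hp]; positivity
  have haν : a ^ 2 ≤ ν ^ 2 := pow_le_pow_left₀ ha0.le H.a_le 2
  have hvp : v * p ^ 2 ≤ 1 := by
    have e1 : q * a ^ 2 ≤ κ * ν ^ 2 := hsmall.trans
      (mul_le_mul_of_nonneg_right (by linarith) (sq_nonneg _))
    have e2 : a ^ 4 / ν ^ 6 * p ≤ 1 := by
      rw [hp, div_mul_div_comm, div_le_one (by positivity)]
      calc a ^ 4 * q = (q * a ^ 2) * a ^ 2 := by ring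
        _ ≤ (κ * ν ^ 2) * ν ^ 2 := mul_le_mul e1 haν (by positivity) (by positivity)
        _ = κ * ν ^ 4 := by ring
        _ ≤ κ * ν ^ 6 := mul_le_mul_of_nonneg_left (pow_le_pow_right₀ hν1 (by norm_num)) hκ0.le
        _ = _ := mul_comm _ _
    rw [hv, ← mul_pow]
    exact pow_le_one₀ (by positivity) e2
  have hvD : (v : ℝ) ≤ D := by
    have : (v : ℝ) = D * (a ^ 4 / ν ^ 8) := by rw [hv, hD]; field_simp
    rw [this]
    refine mul_le_of_le_one_right hD0.le ?_
    rw [div_le_one (by positivity)]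
    calc a ^ 4 ≤ ν ^ 4 := pow_le_pow_left₀ ha0.le H.a_le 4
      _ ≤ ν ^ 8 := pow_le_pow_right₀ hν1 (by norm_num)
  have hDq1 : D * q ^ 2 ≤ 1 := hDq.trans hε1
  -- the regularised tail is Gaussian at all levels close to `x`
  have hsm : ∀ y', |y' - x| ≤ 2 * (q * D) →
      |∫ ω, gaussianTail v (y' - linStat ξ μ n ν x ω) ∂μ - gaussianTail 1 (x / Real.sqrt κ)| ≤
        (K * (3 * Real.exp (5 / (2 * c₀))) + B) * (q * D * Real.exp (-(x ^ 2 / (2 * κ)))) := by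
    intro y' hy'
    have s1 := abs_integral_gaussianTail_linStat_sub_le H.toIsNormalized hx hxν
      (κ := κ) hv hc₀ hc₁ hC hp0 hq1 hvp
      (by simpa using h1 p 0 hp0.le hp.le le_rfl (by positivity)) (h2 p hp) y'
    have s2 := abs_gaussianTail_add_sub_le hc₀ hκc hx hq hvD hDq1 hy'
    have s3 := (exp_tilt_div_le hc₀ hκc hκ3 hx hq hD0.le hp hDq1 hy').2
    rw [← hK] at s1
    rw [← hB] at s2
    refine (abs_sub_le _ (gaussianTail (κ + v) y') _).trans ?_
    rw [add_mul]
    refine add_le_add (s1.trans ?_) s2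
    calc Real.exp (-(p * y')) / p * (Real.exp (κ * p ^ 2 / 2) * (K * (D * q ^ 2))) =
          K * (Real.exp (-(p * y')) / p * (Real.exp (κ * p ^ 2 / 2) * (D * q ^ 2))) := by ring
      _ ≤ K * (3 * Real.exp (5 / (2 * c₀)) * (q * D * Real.exp (-(x ^ 2 / (2 * κ))))) :=
          mul_le_mul_of_nonneg_left s3 hK0.le
      _ = _ := by ring
  have htail : gaussianTail v D ≤ 4 * (q * D * Real.exp (-(x ^ 2 / (2 * κ)))) := by
    refine (gaussianTail_le_exp (by exact_mod_cast hv0) hD0.le).trans (le_trans (le_of_eq ?_) hexp)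
    congr 2
    rw [hv, hD]; field_simp
  have hDqD : D ≤ q * D := le_mul_of_one_le_left hD0.le hq1
  obtain ⟨u1, u2⟩ := measureReal_gt_smoothing (μ := μ) (H.measurable_linStat x)
    (v := v) (by exact_mod_cast hv0) D y
  have w1 := abs_le.1 (hsm (y - D) (by rw [abs_le] at hy ⊢; constructor <;> linarith))
  have w2 := abs_le.1 (hsm (y + D) (by rw [abs_le] at hy ⊢; constructor <;> linarith))
  rw [add_mul _ 4, abs_le]
  constructor <;> linarith

end

/-! ### Sums of squares and exceedances -/

section

/-- The sum of the truncated variables. -/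
noncomputable def truncSum {Ω : Type*} (ξ : ℕ → Ω → ℝ) (n : ℕ) (ν : ℝ) (ω : Ω) : ℝ :=
  ∑ j ∈ Finset.Icc 1 n, trunc (ν ^ 3)⁻¹ (ξ j ω)

/-- The sum of the squares of the truncated variables. -/
noncomputable def truncSumSq {Ω : Type*} (ξ : ℕ → Ω → ℝ) (n : ℕ) (ν : ℝ) (ω : Ω) : ℝ :=
  ∑ j ∈ Finset.Icc 1 n, trunc (ν ^ 3)⁻¹ (ξ j ω) ^ 2

section Deterministic

lemma one_add_half_sub_le_sqrt {Q : ℝ} (hQ : 0 ≤ Q) :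
    1 + (Q - 1) / 2 - (Q - 1) ^ 2 / 2 ≤ Real.sqrt Q ∧ Real.sqrt Q ≤ 1 + (Q - 1) / 2 := by
  obtain ⟨s, hs, rfl⟩ : ∃ s : ℝ, 0 ≤ s ∧ s ^ 2 = Q := ⟨_, Real.sqrt_nonneg Q, Real.sq_sqrt hQ⟩
  rw [Real.sqrt_sq hs]
  have h1 : 0 ≤ s * (s - 1) ^ 2 * (s + 2) / 2 := by positivity
  constructor
  · linarith [show s * (s - 1) ^ 2 * (s + 2) / 2 =
      s - (1 + (s ^ 2 - 1) / 2 - (s ^ 2 - 1) ^ 2 / 2) by ring]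
  · linarith [sq_nonneg (s - 1), sub_sq s 1]

lemma exceed_eq_zero_or_one (τ y : ℝ) : exceed τ y = 0 ∨ exceed τ y = 1 := by
  unfold exceed; split_ifs <;> simp

lemma trunc_add_exceed_mul (τ y : ℝ) : trunc τ y + exceed τ y * y = y := by
  unfold exceed trunc; split_ifs <;> simp

lemma trunc_sq_add_exceed_mul (τ y : ℝ) : trunc τ y ^ 2 + exceed τ y * y ^ 2 = y ^ 2 := by
  unfold exceed trunc; split_ifs <;> simp

/-- If a self-normalised sum exceeds `x`, then the sum truncated at level `τ` exceeds
`(x ^ 2 - N) ^ (1 / 2)` times its own normalisation, `N` being the number of terms removed: by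
Cauchy-Schwarz, these contribute at most `N ^ (1 / 2)` times their quadratic norm. -/
lemma sqrt_sub_mul_sqrt_lt_sum_trunc {ι : Type*} (s : Finset ι) (y : ι → ℝ) (τ : ℝ) {x : ℝ}
    (hx : 0 ≤ x) (h : x * Real.sqrt (∑ i ∈ s, y i ^ 2) < ∑ i ∈ s, y i)
    (hN : ∑ i ∈ s, exceed τ (y i) ≤ x ^ 2) :
    Real.sqrt (x ^ 2 - ∑ i ∈ s, exceed τ (y i)) * Real.sqrt (∑ i ∈ s, trunc τ (y i) ^ 2) <
      ∑ i ∈ s, trunc τ (y i) := by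
  set N := ∑ i ∈ s, exceed τ (y i) with hNdef
  set Q := ∑ i ∈ s, trunc τ (y i) ^ 2 with hQ
  set P := ∑ i ∈ s, exceed τ (y i) * y i ^ 2 with hP
  set L := ∑ i ∈ s, exceed τ (y i) * y i with hL
  have e1 : ∑ i ∈ s, y i = ∑ i ∈ s, trunc τ (y i) + L := by
    rw [hL, ← Finset.sum_add_distrib]
    exact Finset.sum_congr rfl fun i _ => (trunc_add_exceed_mul τ (y i)).symm
  have e2 : ∑ i ∈ s, y i ^ 2 = Q + P := by
    rw [hQ, hP, ← Finset.sum_add_distrib]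
    exact Finset.sum_congr rfl fun i _ => (trunc_sq_add_exceed_mul τ (y i)).symm
  have hN0 : 0 ≤ N := Finset.sum_nonneg fun _ _ => exceed_nonneg _ _
  have hQ0 : 0 ≤ Q := Finset.sum_nonneg fun _ _ => sq_nonneg _
  have hP0 : 0 ≤ P := Finset.sum_nonneg fun _ _ => mul_nonneg (exceed_nonneg _ _) (sq_nonneg _)
  have hLP : L ^ 2 ≤ N * P := by
    have := Finset.sum_mul_sq_le_sq_mul_sq s (fun i => exceed τ (y i))
      (fun i => exceed τ (y i) * y i)
    have f1 : ∀ i, exceed τ (y i) ^ 2 = exceed τ (y i) := fun i => by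
      rcases exceed_eq_zero_or_one τ (y i) with h | h <;> rw [h] <;> norm_num
    have f2 : ∀ i, exceed τ (y i) * (exceed τ (y i) * y i) = exceed τ (y i) * y i := fun i => by
      rw [← mul_assoc, ← pow_two, f1]
    simp only [mul_pow, f1, f2] at this
    exact this
  have hL1 : L ≤ Real.sqrt N * Real.sqrt P := by
    rw [← Real.sqrt_mul hN0]; exact Real.le_sqrt_of_sq_le hLP
  have hcs : Real.sqrt (x ^ 2 - N) * Real.sqrt Q + Real.sqrt N * Real.sqrt P ≤
      x * Real.sqrt (Q + P) := by
    have g1 : Real.sqrt (x ^ 2 - N) ^ 2 = x ^ 2 - N := Real.sq_sqrt (by linarith)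
    have g2 := Real.sq_sqrt hQ0
    have g3 := Real.sq_sqrt hN0
    have g4 := Real.sq_sqrt hP0
    have g5 : Real.sqrt (Q + P) ^ 2 = Q + P := Real.sq_sqrt (by linarith)
    refine le_of_sq_le_sq ?_ (by positivity)
    rw [mul_pow x, g5]
    have : x ^ 2 * (Q + P) = (Real.sqrt (x ^ 2 - N) ^ 2 + Real.sqrt N ^ 2) *
        (Real.sqrt Q ^ 2 + Real.sqrt P ^ 2) := by rw [g1, g2, g3, g4]; ring
    rw [this]
    linarith [sq_nonneg (Real.sqrt (x ^ 2 - N) * Real.sqrt P - Real.sqrt N * Real.sqrt Q),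
      show (Real.sqrt (x ^ 2 - N) ^ 2 + Real.sqrt N ^ 2) * (Real.sqrt Q ^ 2 + Real.sqrt P ^ 2) -
        (Real.sqrt (x ^ 2 - N) * Real.sqrt Q + Real.sqrt N * Real.sqrt P) ^ 2 =
        (Real.sqrt (x ^ 2 - N) * Real.sqrt P - Real.sqrt N * Real.sqrt Q) ^ 2 by ring]
  rw [e1, e2] at h
  linarith

/-- Each removed term costs at most `4 / (1 + x)` on the linear scale. -/
lemma sub_le_of_sqrt_sub_mul_sqrt_le {x N Q T e : ℝ} (hx : 0 ≤ x) (hN : 1 ≤ N) (hNx : N ≤ x ^ 2)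
    (hQ : 0 ≤ Q) (hv : |Q - 1| ≤ e) (he : e ≤ 1)
    (h : Real.sqrt (x ^ 2 - N) * Real.sqrt Q ≤ T) :
    x - x * e ^ 2 / 2 ≤ T - x / 2 * (Q - 1) + 4 * N / (1 + x) := by
  obtain ⟨s1, s2⟩ := one_add_half_sub_le_sqrt hQ
  have hx1 : 1 ≤ x := le_of_sq_le_sq (by linarith) hx
  have hx0 : 0 < x := by linarith
  have h1 : x - N / x ≤ Real.sqrt (x ^ 2 - N) := by
    refine Real.le_sqrt_of_sq_le ?_
    have e1 : (x - N / x) ^ 2 = x ^ 2 - N - N * (1 - N / x ^ 2) := by field_simp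
    have e2 : N / x ^ 2 ≤ 1 := (div_le_one (by positivity)).2 hNx
    have : 0 ≤ N * (1 - N / x ^ 2) := mul_nonneg (by linarith) (by linarith)
    linarith
  have h2 : Real.sqrt Q ≤ 3 / 2 := by linarith [(abs_le.1 hv).2]
  have h3 : (x - N / x) * Real.sqrt Q ≤ T :=
    (mul_le_mul_of_nonneg_right h1 (Real.sqrt_nonneg _)).trans h
  have h4 : N / x * Real.sqrt Q ≤ N / x * (3 / 2) :=
    mul_le_mul_of_nonneg_left h2 (by positivity)
  have h5 : x * (1 + (Q - 1) / 2 - (Q - 1) ^ 2 / 2) ≤ x * Real.sqrt Q :=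
    mul_le_mul_of_nonneg_left s1 hx
  have h6 : N / x * (3 / 2) ≤ 4 * N / (1 + x) := by
    rw [div_mul_eq_mul_div, div_le_div_iff₀ hx0 (by linarith)]
    linarith [mul_le_mul_of_nonneg_left hx1 (by linarith : (0 : ℝ) ≤ N)]
  have h7 : x * (Q - 1) ^ 2 ≤ x * e ^ 2 :=
    mul_le_mul_of_nonneg_left (sq_le_sq' (abs_le.1 hv).1 (abs_le.1 hv).2) hx
  linarith [sub_mul x (N / x) (Real.sqrt Q)]

end Deterministic

variable {Ω : Type*} [MeasurableSpace Ω] {μ : Measure Ω}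

lemma measureReal_le_integral_of_one_le [IsFiniteMeasure μ] {s : Set Ω} (hs : MeasurableSet s)
    {f : Ω → ℝ} (hf : Integrable f μ) (h0 : ∀ ω, 0 ≤ f ω) (h1 : ∀ ω ∈ s, 1 ≤ f ω) :
    μ.real s ≤ ∫ ω, f ω ∂μ := by
  rw [← integral_indicator_one hs]
  refine integral_mono ((integrable_indicator_iff hs).2 (integrable_const _).integrableOn) hf
    fun ω => ?_
  by_cases h : ω ∈ s
  · simpa [h] using h1 ω h
  · simpa [h] using h0 ω

variable {ξ : ℕ → Ω → ℝ} {n : ℕ} {a ν x : ℝ}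

namespace IsNormalized

lemma measurable_truncSumSq (H : IsNormalized ξ μ n a ν) : Measurable (truncSumSq ξ n ν) :=
  Finset.measurable_fun_sum _ fun j hj =>
    ((measurable_trunc _).comp (H.measurable j (Finset.mem_Icc.1 hj).1)).pow_const 2

lemma linStat_eq (H : IsNormalized ξ μ n a ν) (x : ℝ) (ω : Ω) :
    linStat ξ μ n ν x ω = truncSum ξ n ν ω - x / 2 * (truncSumSq ξ n ν ω - 1) := by
  rw [← H.sum_sq]
  unfold linStat linTerm truncSum truncSumSq
  rw [Finset.sum_sub_distrib, ← Finset.mul_sum, Finset.sum_sub_distrib]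

variable [IsProbabilityMeasure μ]

/-- Exponential moments of the sum of squares of the truncated variables. -/
lemma integral_exp_truncSumSq_le (H : IsNormalized ξ μ n a ν) (ha : 32 * a ^ 2 ≤ ν ^ 10) {s : ℝ}
    (hs : |s| ≤ 1) :
    ∫ ω, Real.exp (s * ν ^ 6 * (truncSumSq ξ n ν ω - 1)) ∂μ ≤
      Real.exp (112 * (a ^ 4 / ν ^ 4)) := by
  have hν0 := H.ν_pos
  have hν1 := H.one_le_ν
  have ha0 := H.a_pos
  have hα := H.scale_pos
  have hατ := H.scale_le
  have hτ : 0 < (ν ^ 3)⁻¹ := by positivity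
  set τ := (ν ^ 3)⁻¹ with hτdef
  set α := a / ν ^ 8 with hαdef
  have hντ : ν ^ 6 * τ ^ 2 = 1 := by rw [hτdef]; field_simp
  set σ : ℕ → ℝ := fun j => ∫ ω, ξ j ω ^ 2 ∂μ with hσ
  have hσ0 : ∀ j, 0 ≤ σ j := fun j => integral_nonneg fun ω => sq_nonneg _
  set u : ℕ → ℝ → ℝ := fun j y => s * ν ^ 6 * (trunc τ y ^ 2 - σ j) with hu
  have hum : ∀ j, Measurable (u j) := fun j =>
    (((measurable_trunc τ).pow_const 2).sub_const _).const_mul _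
  have hσα : ∀ {j}, 1 ≤ j → j ≤ n → σ j ≤ α ^ 2 := fun h1 h2 => H.sq_le h1 h2
  have htr : ∀ y, trunc τ y ^ 2 ≤ τ ^ 2 := fun y => by
    rw [← sq_abs]; exact pow_le_pow_left₀ (abs_nonneg _) (abs_trunc_le hτ.le y) 2
  have htry : ∀ y, trunc τ y ^ 2 ≤ y ^ 2 := fun y => by
    have := trunc_sq_add_exceed_mul τ y
    linarith [mul_nonneg (exceed_nonneg τ y) (sq_nonneg y)]
  have hu1 : ∀ {j}, 1 ≤ j → j ≤ n → ∀ y, |u j y| ≤ 1 := fun {j} h1 h2 y => by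
    have e1 : |trunc τ y ^ 2 - σ j| ≤ τ ^ 2 := by
      have := htr y
      have := hσα h1 h2
      have := pow_le_pow_left₀ hα.le hατ 2
      have := sq_nonneg (trunc τ y)
      rw [abs_le]; constructor <;> linarith [hσ0 j]
    rw [hu]
    simp only
    rw [abs_mul, abs_mul, abs_of_pos (by positivity : 0 < ν ^ 6)]
    calc |s| * ν ^ 6 * |trunc τ y ^ 2 - σ j| ≤ 1 * ν ^ 6 * τ ^ 2 :=
          mul_le_mul (mul_le_mul_of_nonneg_right hs (by positivity)) e1 (abs_nonneg _)
            (by positivity)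
      _ = 1 := by rw [one_mul, hντ]
  have hs2 : s ^ 2 ≤ 1 := by rw [← sq_abs]; exact pow_le_one₀ (abs_nonneg _) hs
  have hu2 : ∀ {j}, 1 ≤ j → j ≤ n → ∀ y, u j y ^ 2 ≤ ν ^ 12 * (y ^ 4 + α ^ 4) :=
    fun {j} h1 h2 y => by
    have e1 : (trunc τ y ^ 2 - σ j) ^ 2 ≤ y ^ 4 + α ^ 4 := by
      have f1 : (trunc τ y ^ 2) ^ 2 ≤ y ^ 4 := by
        rw [show y ^ 4 = (y ^ 2) ^ 2 by ring]
        exact pow_le_pow_left₀ (sq_nonneg _) (htry y) 2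
      have f2 : σ j ^ 2 ≤ α ^ 4 := by
        rw [show α ^ 4 = (α ^ 2) ^ 2 by ring]
        exact pow_le_pow_left₀ (hσ0 j) (hσα h1 h2) 2
      have f3 : 0 ≤ trunc τ y ^ 2 * σ j := mul_nonneg (sq_nonneg _) (hσ0 j)
      linarith [sub_sq (trunc τ y ^ 2) (σ j)]
    calc u j y ^ 2 = s ^ 2 * (ν ^ 12 * (trunc τ y ^ 2 - σ j) ^ 2) := by rw [hu]; ring
      _ ≤ 1 * (ν ^ 12 * (y ^ 4 + α ^ 4)) :=
          mul_le_mul hs2 (mul_le_mul_of_nonneg_left e1 (by positivity)) (by positivity) zero_le_one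
      _ = _ := one_mul _
  set F : ℕ → ℝ → ℂ := fun j => if 1 ≤ j ∧ j ≤ n then fun y => ((Real.exp (u j y) - 1 : ℝ) : ℂ)
    else fun _ => 0 with hFdef
  have hFj : ∀ {j}, 1 ≤ j → j ≤ n → F j = fun y => ((Real.exp (u j y) - 1 : ℝ) : ℂ) :=
    fun h1 h2 => if_pos ⟨h1, h2⟩
  have hF : ∀ j, Measurable (F j) := fun j => by
    by_cases hj : 1 ≤ j ∧ j ≤ n
    · rw [hFj hj.1 hj.2]
      exact Complex.measurable_ofReal.comp ((Real.measurable_exp.comp (hum j)).sub_const 1)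
    · simp only [hFdef, if_neg hj]; exact measurable_const
  have hFn : ∀ {j}, 1 ≤ j → j ≤ n → ∀ y, ‖F j y‖ ≤ 2 * |u j y| := fun h1 h2 y => by
    rw [hFj h1 h2, Complex.norm_real, Real.norm_eq_abs]
    exact Real.abs_exp_sub_one_le (hu1 h1 h2 y)
  have hb : ∀ j, ∃ K, ∀ y, ‖F j y‖ ≤ K := fun j => by
    by_cases hj : 1 ≤ j ∧ j ≤ n
    · exact ⟨2, fun y => (hFn hj.1 hj.2 y).trans (by linarith [hu1 hj.1 hj.2 y])⟩
    · exact ⟨0, fun y => by simp [hFdef, if_neg hj]⟩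
  have hdom : ∀ {j}, 1 ≤ j → j ≤ n → Integrable (fun ω => ξ j ω ^ 4 + α ^ 4) μ ∧
      ∫ ω, (ξ j ω ^ 4 + α ^ 4) ∂μ ≤ 2 * α ^ 4 := fun h1 h2 => by
    refine ⟨(H.integrable _ h1 h2).add (integrable_const _), ?_⟩
    rw [integral_add (H.integrable _ h1 h2) (integrable_const _)]
    simp only [integral_const, probReal_univ, smul_eq_mul, one_mul]
    linarith [H.fourth _ h1 h2]
  have hδ2 : (4 * ν ^ 6 * α ^ 2) ^ 2 = 16 * (ν ^ 12 * α ^ 4) := by ring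
  have hpos : 0 ≤ ν ^ 12 * α ^ 4 := by positivity
  have h2 : ∀ i, 1 ≤ i → i ≤ n → ∫ ω, ‖F i (ξ i ω)‖ ^ 2 ∂μ ≤ (4 * ν ^ 6 * α ^ 2) ^ 2 := by
    intro i h1 h2
    obtain ⟨d1, d2⟩ := hdom h1 h2
    calc ∫ ω, ‖F i (ξ i ω)‖ ^ 2 ∂μ ≤ ∫ ω, 4 * ν ^ 12 * (ξ i ω ^ 4 + α ^ 4) ∂μ := by
          refine integral_mono_of_nonneg (ae_of_all _ fun ω => by positivity) (d1.const_mul _)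
            (ae_of_all _ fun ω => ?_)
          calc ‖F i (ξ i ω)‖ ^ 2 ≤ (2 * |u i (ξ i ω)|) ^ 2 :=
                pow_le_pow_left₀ (norm_nonneg _) (hFn h1 h2 _) 2
            _ = 4 * u i (ξ i ω) ^ 2 := by rw [mul_pow, sq_abs]; norm_num
            _ ≤ 4 * (ν ^ 12 * (ξ i ω ^ 4 + α ^ 4)) :=
                mul_le_mul_of_nonneg_left (hu2 h1 h2 _) (by norm_num)
            _ = _ := by ring
      _ ≤ 4 * ν ^ 12 * (2 * α ^ 4) := by
          rw [integral_const_mul]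
          exact mul_le_mul_of_nonneg_left d2 (by positivity)
      _ ≤ _ := by rw [hδ2]; linarith
  have h1 : ∀ i, 1 ≤ i → i ≤ n → ‖∫ ω, F i (ξ i ω) ∂μ‖ ≤ (4 * ν ^ 6 * α ^ 2) ^ 2 := by
    intro i h1 h2
    obtain ⟨d1, d2⟩ := hdom h1 h2
    have i2 := integrable_pow_of_integrable_pow_four (H.measurable i h1) (H.integrable i h1 h2)
      (k := 2) (by norm_num)
    have il : Integrable (fun ω => s * ν ^ 6 * (ξ i ω ^ 2 - σ i)) μ :=
      (i2.sub (integrable_const _)).const_mul _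
    have e0 : ∫ ω, s * ν ^ 6 * (ξ i ω ^ 2 - σ i) ∂μ = 0 := by
      rw [integral_const_mul, integral_sub i2 (integrable_const _)]
      simp [hσ]
    have iw : Integrable (fun ω => Real.exp (u i (ξ i ω)) - 1) μ :=
      integrable_of_measurable_of_bound
        ((Real.measurable_exp.comp ((hum i).comp (H.measurable i h1))).sub_const 1) (K := 2)
        fun ω => (Real.abs_exp_sub_one_le (hu1 h1 h2 _)).trans (by linarith [hu1 h1 h2 (ξ i ω)])
    rw [hFj h1 h2, integral_complex_ofReal, Complex.norm_real,
      ← sub_zero (∫ ω, (Real.exp (u i (ξ i ω)) - 1) ∂μ), ← e0, ← integral_sub iw il]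
    calc _ ≤ ∫ ω, 2 * ν ^ 12 * (ξ i ω ^ 4 + α ^ 4) ∂μ := by
          refine norm_integral_le_of_norm_le (d1.const_mul _) (ae_of_all _ fun ω => ?_)
          have g1 := Real.abs_exp_sub_one_sub_id_le (hu1 h1 h2 (ξ i ω))
          have g2 : |u i (ξ i ω) - s * ν ^ 6 * (ξ i ω ^ 2 - σ i)| ≤ ν ^ 12 * ξ i ω ^ 4 := by
            have := abs_trunc_sq_sub_le hτ (le_refl |ξ i ω|)
            rw [show |ξ i ω| ^ 4 = ξ i ω ^ 4 by rw [← abs_pow, abs_of_nonneg (by positivity)],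
              hτdef, show ξ i ω ^ 4 / (ν ^ 3)⁻¹ ^ 2 = ν ^ 6 * ξ i ω ^ 4 by field_simp] at this
            rw [hu, show s * ν ^ 6 * (trunc τ (ξ i ω) ^ 2 - σ i) - s * ν ^ 6 * (ξ i ω ^ 2 - σ i) =
              s * ν ^ 6 * (trunc τ (ξ i ω) ^ 2 - ξ i ω ^ 2) by ring, abs_mul, abs_mul,
              abs_of_pos (by positivity : 0 < ν ^ 6)]
            calc |s| * ν ^ 6 * |trunc τ (ξ i ω) ^ 2 - ξ i ω ^ 2| ≤
                  1 * ν ^ 6 * (ν ^ 6 * ξ i ω ^ 4) :=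
                  mul_le_mul (mul_le_mul_of_nonneg_right hs (by positivity)) this (abs_nonneg _)
                    (by positivity)
              _ = _ := by ring
          have g3 := hu2 h1 h2 (ξ i ω)
          have g4 : 0 ≤ ν ^ 12 * α ^ 4 := by positivity
          rw [Real.norm_eq_abs]
          rw [abs_le] at g1 g2 ⊢
          constructor <;> linarith
      _ ≤ 2 * ν ^ 12 * (2 * α ^ 4) := by
          rw [integral_const_mul]
          exact mul_le_mul_of_nonneg_left d2 (by positivity)
      _ ≤ _ := by rw [hδ2]; linarith
  have hδ : 4 * ν ^ 6 * α ^ 2 ≤ 1 / 8 := by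
    have : 4 * ν ^ 6 * α ^ 2 = 4 * a ^ 2 / ν ^ 10 := by rw [hαdef]; field_simp
    rw [this, div_le_iff₀ (by positivity)]
    linarith
  have hmain := H.dep.norm_integral_prod_one_add_le H.measurable hF hb (by positivity) hδ h2 h1
  have e1 : ∀ ω, ∏ j ∈ Finset.Icc 1 n, (1 + F j (ξ j ω)) =
      ((Real.exp (s * ν ^ 6 * (truncSumSq ξ n ν ω - 1)) : ℝ) : ℂ) := fun ω => by
    rw [← H.sum_sq, truncSumSq, ← Finset.sum_sub_distrib, Finset.mul_sum, Real.exp_sum,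
      Complex.ofReal_prod]
    refine Finset.prod_congr rfl fun j hj => ?_
    rw [Finset.mem_Icc] at hj
    rw [hFj hj.1 hj.2]
    rw [show (1 : ℂ) + ((Real.exp (u j (ξ j ω)) - 1 : ℝ) : ℂ) =
      ((Real.exp (u j (ξ j ω)) : ℝ) : ℂ) by push_cast; ring]
  simp only [e1] at hmain
  rw [integral_complex_ofReal, Complex.norm_real,
    Real.norm_of_nonneg (integral_nonneg fun ω => (Real.exp_pos _).le)] at hmain
  refine hmain.trans_eq ?_
  congr 1
  rw [hδ2, ← H.ν_pow, hαdef]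
  field_simp
  norm_num

/-- The factor `N` inside an exponential expectation costs only the expectation of `N`, up to a
constant: by one-dependence, inserting the indicator of `|ξ i| > τ` interacts with the factors of
index `i - 1`, `i`, `i + 1` only. -/
lemma integral_numExceed_mul_exp_le (H : IsNormalized ξ μ n a ν) (hx : 0 ≤ x) (hxν : x ≤ ν ^ 2)
    {p c R : ℝ} (hp0 : 0 ≤ p) (hp : p * (2 * (ν ^ 3)⁻¹) ≤ R) (hc : 0 ≤ c) (hcR : c ≤ R) :
    ∫ ω, numExceed ξ n ν ω *
        Real.exp (p * linStat ξ μ n ν x ω + c * numExceed ξ n ν ω) ∂μ ≤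
      Real.exp (2 * R) ^ 6 * (a ^ 4 / ν ^ 4) *
        ∫ ω, Real.exp (p * linStat ξ μ n ν x ω + c * numExceed ξ n ν ω) ∂μ := by
  have hν0 := H.ν_pos
  have ha0 := H.a_pos
  have hα := H.scale_pos
  have hτ : 0 < (ν ^ 3)⁻¹ := by positivity
  set τ := (ν ^ 3)⁻¹ with hτdef
  have hR : 0 ≤ R := hc.trans hcR
  set F : ℕ → ℝ → ℝ := fun j => if 1 ≤ j ∧ j ≤ n then
    fun y => Real.exp (p * linTerm τ x (∫ ω, ξ j ω ^ 2 ∂μ) y + c * exceed τ y) else fun _ => 1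
    with hFdef
  have hFj : ∀ {j}, 1 ≤ j → j ≤ n → F j = fun y =>
      Real.exp (p * linTerm τ x (∫ ω, ξ j ω ^ 2 ∂μ) y + c * exceed τ y) :=
    fun h1 h2 => if_pos ⟨h1, h2⟩
  have hF : ∀ j, Measurable (F j) := fun j => by
    by_cases hj : 1 ≤ j ∧ j ≤ n
    · rw [hFj hj.1 hj.2]
      exact Real.measurable_exp.comp (((measurable_linTerm _ _ _).const_mul _).add
        ((measurable_exceed _).const_mul _))
    · simp only [hFdef, if_neg hj]; exact measurable_const
  have hK : 1 ≤ Real.exp (2 * R) := Real.one_le_exp (by linarith)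
  have habs : ∀ {j}, 1 ≤ j → j ≤ n → ∀ y,
      |p * linTerm τ x (∫ ω, ξ j ω ^ 2 ∂μ) y + c * exceed τ y| ≤ 2 * R := fun h1 h2 y => by
    refine (abs_add_le _ _).trans ?_
    rw [abs_mul, abs_mul, abs_of_nonneg hp0, abs_of_nonneg hc, abs_of_nonneg (exceed_nonneg _ _)]
    have e1 : p * |linTerm τ x (∫ ω, ξ _ ω ^ 2 ∂μ) y| ≤ p * (2 * τ) :=
      mul_le_mul_of_nonneg_left (H.abs_linTerm_le hx hxν h1 h2 y) hp0
    have e2 : c * exceed τ y ≤ c * 1 := mul_le_mul_of_nonneg_left (exceed_le_one _ _) hc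
    linarith
  have hF1 : ∀ j y, (Real.exp (2 * R))⁻¹ ≤ F j y := fun j y => by
    by_cases hj : 1 ≤ j ∧ j ≤ n
    · rw [hFj hj.1 hj.2, ← Real.exp_neg]
      exact Real.exp_le_exp.2 (abs_le.1 (habs hj.1 hj.2 y)).1
    · simp only [hFdef, if_neg hj]; exact inv_le_one_of_one_le₀ hK
  have hF2 : ∀ j y, F j y ≤ Real.exp (2 * R) := fun j y => by
    by_cases hj : 1 ≤ j ∧ j ≤ n
    · rw [hFj hj.1 hj.2]
      exact Real.exp_le_exp.2 (abs_le.1 (habs hj.1 hj.2 y)).2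
    · simp only [hFdef, if_neg hj]; exact hK
  have e1 : ∀ ω, Real.exp (p * linStat ξ μ n ν x ω + c * numExceed ξ n ν ω) =
      ∏ j ∈ Finset.Icc 1 n, F j (ξ j ω) := fun ω => by
    unfold linStat numExceed
    rw [Finset.mul_sum, Finset.mul_sum, ← Finset.sum_add_distrib, Real.exp_sum]
    refine Finset.prod_congr rfl fun j hj => ?_
    rw [Finset.mem_Icc] at hj
    rw [hFj hj.1 hj.2]
  have hint := H.integrable_exp hx hxν p c
  simp only [e1] at hint ⊢
  set I := ∫ ω, ∏ j ∈ Finset.Icc 1 n, F j (ξ j ω) ∂μ with hI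
  have hI0 : 0 ≤ I := integral_nonneg fun ω => Finset.prod_nonneg fun j _ =>
    (inv_pos.2 (Real.exp_pos _)).le.trans (hF1 j _)
  have hP : ∀ i, 1 ≤ i → i ≤ n → ∫ ω, exceed τ (ξ i ω) ∂μ ≤ (a / ν ^ 8) ^ 4 / τ ^ 4 := by
    intro i h1 h2
    calc ∫ ω, exceed τ (ξ i ω) ∂μ ≤ ∫ ω, ξ i ω ^ 4 / τ ^ 4 ∂μ := by
          refine integral_mono_of_nonneg (ae_of_all _ fun ω => exceed_nonneg _ _)
            ((H.integrable i h1 h2).div_const _) (ae_of_all _ fun ω => ?_)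
          have := exceed_le_div hτ (le_refl |ξ i ω|) 4
          rwa [← abs_pow, abs_of_nonneg (by positivity : 0 ≤ ξ i ω ^ 4)] at this
      _ ≤ _ := by
          rw [integral_div]
          exact div_le_div_of_nonneg_right (H.fourth i h1 h2) (by positivity)
  have hii : ∀ i ∈ Finset.Icc 1 n, Integrable
      (fun ω => exceed τ (ξ i ω) * ∏ j ∈ Finset.Icc 1 n, F j (ξ j ω)) μ := fun i hi => by
    refine hint.bdd_mul (c := 1) ((measurable_exceed τ).comp
      (H.measurable i (Finset.mem_Icc.1 hi).1)).aestronglyMeasurable (ae_of_all _ fun ω => ?_)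
    rw [Real.norm_of_nonneg (exceed_nonneg _ _)]; exact exceed_le_one _ _
  have e2 : ∀ ω, numExceed ξ n ν ω * ∏ j ∈ Finset.Icc 1 n, F j (ξ j ω) =
      ∑ i ∈ Finset.Icc 1 n, exceed τ (ξ i ω) * ∏ j ∈ Finset.Icc 1 n, F j (ξ j ω) := fun ω => by
    rw [numExceed, Finset.sum_mul]
  simp only [e2]
  rw [integral_finsetSum _ hii]
  calc _ ≤ ∑ i ∈ Finset.Icc 1 n, Real.exp (2 * R) ^ 6 * ((a / ν ^ 8) ^ 4 / τ ^ 4) * I := by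
        refine Finset.sum_le_sum fun i hi => ?_
        rw [Finset.mem_Icc] at hi
        refine (H.dep.integral_mul_prod_le H.measurable hF hK hF1 hF2 (measurable_exceed τ)
          (exceed_nonneg τ) (exceed_le_one τ) hi.1).trans ?_
        exact mul_le_mul_of_nonneg_right (mul_le_mul_of_nonneg_left (hP i hi.1 hi.2)
          (by positivity)) hI0
    _ = _ := by
        rw [Finset.sum_const, Nat.card_Icc, nsmul_eq_mul, Nat.add_sub_cancel, ← H.ν_pow, hτdef]
        field_simp

end IsNormalized

end

/-! ### Comparison of the self-normalised sum with the linearised statistic -/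

section

variable {Ω : Type*} {ξ : ℕ → Ω → ℝ} {n : ℕ} {ν : ℝ}

lemma truncSumSq_nonneg (ω : Ω) : 0 ≤ truncSumSq ξ n ν ω :=
  Finset.sum_nonneg fun _ _ => sq_nonneg _

/-- Without exceedances, truncation does nothing. -/
lemma numExceed_eq_zero_or (ω : Ω) :
    (S ξ n ω = truncSum ξ n ν ω ∧ V ξ n ω = Real.sqrt (truncSumSq ξ n ν ω)) ∨
      1 ≤ numExceed ξ n ν ω := by
  by_cases h : ∃ j ∈ Finset.Icc 1 n, exceed (ν ^ 3)⁻¹ (ξ j ω) = 1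
  · obtain ⟨j, hj, h1⟩ := h
    right
    rw [← h1]
    exact Finset.single_le_sum (f := fun j => exceed (ν ^ 3)⁻¹ (ξ j ω))
      (fun _ _ => exceed_nonneg _ _) hj
  · left
    have h0 : ∀ j ∈ Finset.Icc 1 n, trunc (ν ^ 3)⁻¹ (ξ j ω) = ξ j ω := fun j hj => by
      have h1 := (exceed_eq_zero_or_one (ν ^ 3)⁻¹ (ξ j ω)).resolve_right fun h1 => h ⟨j, hj, h1⟩
      have := trunc_add_exceed_mul (ν ^ 3)⁻¹ (ξ j ω)
      rwa [h1, zero_mul, add_zero] at this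
    constructor
    · exact Finset.sum_congr rfl fun j hj => (h0 j hj).symm
    · unfold V truncSumSq
      congr 1
      exact Finset.sum_congr rfl fun j hj => by rw [h0 j hj]

variable [MeasurableSpace Ω] {μ : Measure Ω} {a x c₀ ε : ℝ}

namespace IsAdmissible

/-- The event on which the linearised statistic is not a faithful approximation of the
self-normalised sum at level `x`. -/
def badEvent (ξ : ℕ → Ω → ℝ) (μ : Measure Ω) (n : ℕ) (a ν x : ℝ) : Set Ω :=
  {ω | a ^ 2 / ν ^ 2 < |truncSumSq ξ n ν ω - 1|} ∪
    ({ω | 1 ≤ numExceed ξ n ν ω ∧ x - x * (a ^ 2 / ν ^ 2) ^ 2 / 2 ≤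
        linStat ξ μ n ν x ω + 4 * numExceed ξ n ν ω / (1 + x)} ∪
      {ω | 1 ≤ numExceed ξ n ν ω ∧ x ^ 2 ≤ numExceed ξ n ν ω})

lemma sq_div_sq_le (H : IsAdmissible ξ μ n a ν x c₀ ε) : a ^ 2 / ν ^ 2 ≤ ε := by
  rw [div_le_iff₀ (pow_pos H.ν_pos 2)]
  exact le_trans (le_mul_of_one_le_left (sq_nonneg a) (by linarith [H.x_nonneg])) H.small

lemma setOf_subset (H : IsAdmissible ξ μ n a ν x c₀ ε) :
    {ω | x * V ξ n ω < S ξ n ω} ⊆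
        {ω | x - x * (a ^ 2 / ν ^ 2) ^ 2 / 2 < linStat ξ μ n ν x ω} ∪ badEvent ξ μ n a ν x ∧
      {ω | x < linStat ξ μ n ν x ω} ⊆ {ω | x * V ξ n ω < S ξ n ω} ∪ badEvent ξ μ n a ν x := by
  have hx := H.x_nonneg
  have he : a ^ 2 / ν ^ 2 ≤ 1 := H.sq_div_sq_le.trans (by linarith [H.ε_le_one, H.ε_pos])
  -- outside the first part of the bad event, one exceedance puts a point of either event in
  -- one of the other two parts
  have key : ∀ ω, ¬ a ^ 2 / ν ^ 2 < |truncSumSq ξ n ν ω - 1| → 1 ≤ numExceed ξ n ν ω →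
      (numExceed ξ n ν ω ≤ x ^ 2 → Real.sqrt (x ^ 2 - numExceed ξ n ν ω) *
        Real.sqrt (truncSumSq ξ n ν ω) ≤ truncSum ξ n ν ω) → ω ∈ badEvent ξ μ n a ν x := by
    intro ω hv hN h
    right
    rcases le_total (numExceed ξ n ν ω) (x ^ 2) with hNx | hNx
    · left
      refine ⟨hN, ?_⟩
      rw [H.linStat_eq]
      exact sub_le_of_sqrt_sub_mul_sqrt_le hx hN hNx (truncSumSq_nonneg ω) (not_lt.1 hv) he (h hNx)
    · right
      exact ⟨hN, hNx⟩
  constructor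
  · intro ω hω
    simp only [Set.mem_ofPred_eq] at hω
    by_cases hv : a ^ 2 / ν ^ 2 < |truncSumSq ξ n ν ω - 1|
    · exact Or.inr (Or.inl hv)
    rcases numExceed_eq_zero_or (ξ := ξ) (n := n) (ν := ν) ω with ⟨h1, h2⟩ | hN
    · left
      rw [h1, h2] at hω
      rw [Set.mem_ofPred_eq, H.linStat_eq]
      have e1 := mul_le_mul_of_nonneg_left
        (one_add_half_sub_le_sqrt (truncSumSq_nonneg (ξ := ξ) (n := n) (ν := ν) ω)).1 hx
      have e2 : x * (truncSumSq ξ n ν ω - 1) ^ 2 ≤ x * (a ^ 2 / ν ^ 2) ^ 2 := by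
        rw [← sq_abs (truncSumSq ξ n ν ω - 1)]
        exact mul_le_mul_of_nonneg_left
          (pow_le_pow_left₀ (abs_nonneg _) (not_lt.1 hv) 2) hx
      linarith
    · exact Or.inr (key ω hv hN fun hNx =>
        (sqrt_sub_mul_sqrt_lt_sum_trunc (Finset.Icc 1 n) (fun j => ξ j ω) (ν ^ 3)⁻¹ hx hω hNx).le)
  · intro ω hω
    simp only [Set.mem_ofPred_eq] at hω
    by_cases hv : a ^ 2 / ν ^ 2 < |truncSumSq ξ n ν ω - 1|
    · exact Or.inr (Or.inl hv)
    have h3 : x * Real.sqrt (truncSumSq ξ n ν ω) < truncSum ξ n ν ω := by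
      rw [H.linStat_eq] at hω
      have e1 := mul_le_mul_of_nonneg_left
        (one_add_half_sub_le_sqrt (truncSumSq_nonneg (ξ := ξ) (n := n) (ν := ν) ω)).2 hx
      linarith
    rcases numExceed_eq_zero_or (ξ := ξ) (n := n) (ν := ν) ω with ⟨h1, h2⟩ | hN
    · left
      rw [Set.mem_ofPred_eq, h1, h2]
      exact h3
    · refine Or.inr (key ω hv hN fun _ => le_trans ?_ h3.le)
      refine mul_le_mul_of_nonneg_right ?_ (Real.sqrt_nonneg _)
      rw [Real.sqrt_le_left hx]
      linarith

lemma abs_sub_level_le (H : IsAdmissible ξ μ n a ν x c₀ ε) :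
    |x - x * (a ^ 2 / ν ^ 2) ^ 2 / 2 - x| ≤ (1 + x) * (a ^ 4 / ν ^ 4) := by
  have hx := H.x_nonneg
  have e : (a ^ 2 / ν ^ 2) ^ 2 = a ^ 4 / ν ^ 4 := by rw [div_pow]; ring
  have hD0 : 0 ≤ a ^ 4 / ν ^ 4 := by positivity
  have : 0 ≤ x * (a ^ 4 / ν ^ 4) := mul_nonneg hx hD0
  rw [e, abs_le]
  constructor <;> linarith

variable [IsProbabilityMeasure μ]

/-- The sum of squares concentrates. -/
lemma measureReal_truncSumSq_le (H : IsAdmissible ξ μ n a ν x c₀ ε) :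
    μ.real {ω | a ^ 2 / ν ^ 2 < |truncSumSq ξ n ν ω - 1|} ≤
      24 * ((1 + x) * (a ^ 4 / ν ^ 4) * Real.exp (-(x ^ 2 / (2 * sumVar ξ μ n)))) := by
  have hν0 := H.ν_pos
  have hν1 := H.one_le_ν
  have ha1 := H.one_le_a
  have hm := H.measurable_truncSumSq
  have ha : 32 * a ^ 2 ≤ ν ^ 10 := by
    have h1 := H.sq_div_sq_le
    rw [div_le_iff₀ (pow_pos hν0 2)] at h1
    have h2 : 32 * (ε * ν ^ 2) ≤ 1 * ν ^ 2 := by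
      rw [← mul_assoc]
      exact mul_le_mul_of_nonneg_right (by linarith [H.ε_le_one, H.ε_pos]) (sq_nonneg _)
    have h3 : ν ^ 2 ≤ ν ^ 10 := pow_le_pow_right₀ hν1 (by norm_num)
    linarith
  have h112 : Real.exp (112 * (a ^ 4 / ν ^ 4)) ≤ 3 := by
    have h1 : a ^ 4 / ν ^ 4 ≤ 1 / 112 := by
      refine H.small_consequences.2.2.trans ?_
      have : ε ^ 2 ≤ (1 / 100) ^ 2 := pow_le_pow_left₀ H.ε_pos.le (by linarith [H.ε_le_one]) 2
      linarith
    calc Real.exp (112 * (a ^ 4 / ν ^ 4)) ≤ Real.exp 1 := Real.exp_le_exp.2 (by linarith)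
      _ ≤ 3 := by linarith [Real.exp_one_lt_d9]
  have hint : ∀ s : ℝ, Integrable
      (fun ω => Real.exp (s * ν ^ 6 * (truncSumSq ξ n ν ω - 1))) μ := fun s => by
    have hle : ∀ ω, |truncSumSq ξ n ν ω - 1| ≤ n * (ν ^ 3)⁻¹ ^ 2 + 1 := fun ω => by
      have e1 : truncSumSq ξ n ν ω ≤ n * (ν ^ 3)⁻¹ ^ 2 := by
        refine (Finset.sum_le_sum fun j _ => ?_).trans (b := ∑ j ∈ Finset.Icc 1 n,
          (ν ^ 3)⁻¹ ^ 2) (le_of_eq (by simp))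
        rw [← sq_abs]
        exact pow_le_pow_left₀ (abs_nonneg _) (abs_trunc_le (by positivity) _) 2
      have e2 := truncSumSq_nonneg (ξ := ξ) (n := n) (ν := ν) ω
      rw [abs_le]; constructor <;> linarith
    refine integrable_of_measurable_of_bound (by fun_prop)
      (K := Real.exp (|s * ν ^ 6| * (n * (ν ^ 3)⁻¹ ^ 2 + 1))) fun ω => ?_
    rw [Real.norm_eq_abs, Real.abs_exp]
    refine Real.exp_le_exp.2 ((le_abs_self _).trans ?_)
    rw [abs_mul]
    exact mul_le_mul_of_nonneg_left (hle ω) (abs_nonneg _)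
  have hE1 := (H.integral_exp_truncSumSq_le ha (s := 1) (by simp)).trans h112
  have hE2 := (H.integral_exp_truncSumSq_le ha (s := -1) (by simp)).trans h112
  have hmark : μ.real {ω | a ^ 2 / ν ^ 2 < |truncSumSq ξ n ν ω - 1|} ≤
      ∫ ω, Real.exp (-(a ^ 2 * ν ^ 4)) * (Real.exp (1 * ν ^ 6 * (truncSumSq ξ n ν ω - 1)) +
        Real.exp (-1 * ν ^ 6 * (truncSumSq ξ n ν ω - 1))) ∂μ := by
    refine measureReal_le_integral_of_one_le
      (measurableSet_lt measurable_const (hm.sub_const 1).abs)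
      (((hint 1).add (hint (-1))).const_mul _) (fun ω => by positivity) fun ω hω => ?_
    rw [Set.mem_ofPred_eq, div_lt_iff₀ (by positivity)] at hω
    have h6 : a ^ 2 * ν ^ 4 ≤ ν ^ 6 * |truncSumSq ξ n ν ω - 1| := by
      calc a ^ 2 * ν ^ 4 ≤ (|truncSumSq ξ n ν ω - 1| * ν ^ 2) * ν ^ 4 :=
            mul_le_mul_of_nonneg_right hω.le (by positivity)
        _ = _ := by ring
    rw [mul_add, ← Real.exp_add, ← Real.exp_add]
    rcases abs_choice (truncSumSq ξ n ν ω - 1) with h | h <;> rw [h] at h6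
    · have : 1 ≤ Real.exp (-(a ^ 2 * ν ^ 4) + 1 * ν ^ 6 * (truncSumSq ξ n ν ω - 1)) :=
        Real.one_le_exp (by linarith)
      exact le_add_of_le_of_nonneg this (Real.exp_pos _).le
    · have : 1 ≤ Real.exp (-(a ^ 2 * ν ^ 4) + -1 * ν ^ 6 * (truncSumSq ξ n ν ω - 1)) :=
        Real.one_le_exp (by linarith)
      exact le_add_of_nonneg_of_le (Real.exp_pos _).le this
  rw [integral_const_mul, integral_add (hint 1) (hint (-1))] at hmark
  have h4 : Real.exp (-(a ^ 2 * ν ^ 4)) ≤ Real.exp (-(ν ^ 4 / 2)) := by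
    have : ν ^ 4 ≤ a ^ 2 * ν ^ 4 := le_mul_of_one_le_left (by positivity) (one_le_pow₀ ha1)
    have : 0 ≤ ν ^ 4 := by positivity
    exact Real.exp_le_exp.2 (by linarith)
  have h5 := H.exp_neg_half_pow_four_le
  calc _ ≤ Real.exp (-(ν ^ 4 / 2)) * 6 := hmark.trans
        (mul_le_mul h4 (by linarith) (add_nonneg (integral_nonneg fun _ => (Real.exp_pos _).le)
          (integral_nonneg fun _ => (Real.exp_pos _).le)) (Real.exp_pos _).le)
    _ ≤ _ := by linarith

/-- Exponential Chebyshev inequality on the event that some variable exceeds the truncation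
level. -/
lemma measureReal_numExceed_le (H : IsAdmissible ξ μ n a ν x c₀ ε)
    (h1 : ∀ p c : ℝ, 0 ≤ p → p ≤ (1 + x) / sumVar ξ μ n → 0 ≤ c → c ≤ 4 / c₀ →
      ∫ ω, Real.exp (p * linStat ξ μ n ν x ω + c * numExceed ξ n ν ω) ∂μ ≤
        3 * Real.exp (sumVar ξ μ n * p ^ 2 / 2))
    {p c w : ℝ} (hp0 : 0 ≤ p) (hp : p ≤ (1 + x) / sumVar ξ μ n) (hc : 0 ≤ c) (hc4 : c ≤ 4 / c₀)
    {s : Set Ω} (hs : MeasurableSet s) (hs1 : ∀ ω ∈ s, 1 ≤ numExceed ξ n ν ω ∧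
      w ≤ p * linStat ξ μ n ν x ω + c * numExceed ξ n ν ω) :
    μ.real s ≤ 3 * Real.exp (2 * (2 + 4 / c₀)) ^ 6 * (a ^ 4 / ν ^ 4) *
      (Real.exp (-w) * Real.exp (sumVar ξ μ n * p ^ 2 / 2)) := by
  have hν0 := H.ν_pos
  have hν1 := H.one_le_ν
  have ha0 := H.a_pos
  have hκ := H.sumVar_pos
  have hc₀ := H.c₀_pos
  have h4 : 0 < 4 / c₀ := by positivity
  have hpν : p * (2 * (ν ^ 3)⁻¹) ≤ 2 := by
    have e1 : p ≤ ν ^ 2 := by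
      refine hp.trans ((div_le_iff₀ hκ).2 (H.small_consequences.1.trans ?_))
      rw [mul_comm]
      exact mul_le_mul_of_nonneg_left (by linarith [H.ε_le, H.ε_pos, H.le_sumVar]) (sq_nonneg _)
    have : p * (ν ^ 3)⁻¹ ≤ 1 := by
      rw [← div_eq_mul_inv, div_le_one (by positivity)]
      exact e1.trans (pow_le_pow_right₀ hν1 (by norm_num))
    linarith
  have hN := H.integral_numExceed_mul_exp_le H.x_nonneg H.x_le (R := 2 + 4 / c₀) hp0
    (by linarith) hc (by linarith)
  have hint : Integrable (fun ω => numExceed ξ n ν ω *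
      Real.exp (p * linStat ξ μ n ν x ω + c * numExceed ξ n ν ω)) μ := by
    refine (H.integrable_exp H.x_nonneg H.x_le p c).bdd_mul (c := n)
      H.measurable_numExceed.aestronglyMeasurable (ae_of_all _ fun ω => ?_)
    rw [Real.norm_of_nonneg (numExceed_nonneg _ _ _ _)]
    exact numExceed_le _ _ _ _
  have hmark : μ.real s ≤ ∫ ω, Real.exp (-w) * (numExceed ξ n ν ω *
      Real.exp (p * linStat ξ μ n ν x ω + c * numExceed ξ n ν ω)) ∂μ := by
    refine measureReal_le_integral_of_one_le hs (hint.const_mul _) (fun ω => ?_) fun ω hω => ?_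
    · exact mul_nonneg (Real.exp_pos _).le
        (mul_nonneg (numExceed_nonneg _ _ _ _) (Real.exp_pos _).le)
    · obtain ⟨g1, g2⟩ := hs1 ω hω
      rw [mul_left_comm, ← Real.exp_add]
      exact one_le_mul_of_one_le_of_one_le g1 (Real.one_le_exp (by linarith))
  rw [integral_const_mul] at hmark
  have hD0 : 0 ≤ a ^ 4 / ν ^ 4 := by positivity
  calc μ.real s ≤ Real.exp (-w) * (Real.exp (2 * (2 + 4 / c₀)) ^ 6 * (a ^ 4 / ν ^ 4) *
        (3 * Real.exp (sumVar ξ μ n * p ^ 2 / 2))) :=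
        hmark.trans (mul_le_mul_of_nonneg_left (hN.trans (mul_le_mul_of_nonneg_left
          (h1 p c hp0 hp hc hc4) (by positivity))) (Real.exp_pos _).le)
    _ = _ := by ring

lemma measureReal_badEvent_le (H : IsAdmissible ξ μ n a ν x c₀ ε)
    (h1 : ∀ p c : ℝ, 0 ≤ p → p ≤ (1 + x) / sumVar ξ μ n → 0 ≤ c → c ≤ 4 / c₀ →
      ∫ ω, Real.exp (p * linStat ξ μ n ν x ω + c * numExceed ξ n ν ω) ∂μ ≤
        3 * Real.exp (sumVar ξ μ n * p ^ 2 / 2)) :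
    μ.real (badEvent ξ μ n a ν x) ≤
      (24 + 6 * Real.exp (2 * (2 + 4 / c₀)) ^ 6 * Real.exp (5 / (2 * c₀))) *
        ((1 + x) * (a ^ 4 / ν ^ 4) * Real.exp (-(x ^ 2 / (2 * sumVar ξ μ n)))) := by
  have hx := H.x_nonneg
  have hκ := H.sumVar_pos
  have hc₀ := H.c₀_pos
  have hW := H.measurable_linStat x
  have hNm := H.measurable_numExceed
  set κ := sumVar ξ μ n with hκdef
  set D := a ^ 4 / ν ^ 4 with hD
  set G := Real.exp (-(x ^ 2 / (2 * κ))) with hG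
  set M := 3 * Real.exp (2 * (2 + 4 / c₀)) ^ 6 with hM
  have hD0 : 0 ≤ D := by positivity
  have hG0 : 0 < G := Real.exp_pos _
  have hM0 : 0 < M := by positivity
  have hb1 : 1 ≤ Real.exp (5 / (2 * c₀)) := Real.one_le_exp (by positivity)
  have hDq : D ≤ (1 + x) * D := le_mul_of_one_le_left hD0 (by linarith)
  have hκinv : 1 / κ ≤ 1 / c₀ := one_div_le_one_div_of_le hc₀ H.le_sumVar
  have ht := (exp_tilt_div_le hc₀ H.le_sumVar H.sumVar_le hx rfl hD0 rfl
    (H.small_consequences.2.1.trans H.ε_sq_le)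
    (y := x - x * (a ^ 2 / ν ^ 2) ^ 2 / 2)
    (H.abs_sub_level_le.trans (by have := mul_nonneg (by linarith : 0 ≤ 1 + x) hD0; linarith))).1
  have p1 := H.measureReal_truncSumSq_le
  have hfin : ∀ r : ℝ, r ≤ Real.exp (5 / (2 * c₀)) * G →
      M * D * r ≤ M * Real.exp (5 / (2 * c₀)) * ((1 + x) * D * G) := fun r hr => by
    calc M * D * r ≤ M * ((1 + x) * D) * (Real.exp (5 / (2 * c₀)) * G) :=
          (mul_le_mul_of_nonneg_left hr (by positivity)).trans
            (mul_le_mul_of_nonneg_right (mul_le_mul_of_nonneg_left hDq hM0.le) (by positivity))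
      _ = _ := by ring
  have p2 : μ.real {ω | 1 ≤ numExceed ξ n ν ω ∧ x - x * (a ^ 2 / ν ^ 2) ^ 2 / 2 ≤
        linStat ξ μ n ν x ω + 4 * numExceed ξ n ν ω / (1 + x)} ≤
      M * Real.exp (5 / (2 * c₀)) * ((1 + x) * D * G) := by
    refine (H.measureReal_numExceed_le h1 (p := (1 + x) / κ) (c := 4 / κ)
      (w := (1 + x) / κ * (x - x * (a ^ 2 / ν ^ 2) ^ 2 / 2)) (by positivity) le_rfl
      (by positivity) (by rw [← mul_one_div, ← mul_one_div 4 c₀]; linarith) ?_ ?_).trans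
      (hfin _ ht)
    · exact (measurableSet_le measurable_const hNm).inter (measurableSet_le measurable_const
        (hW.add ((hNm.const_mul 4).div_const (1 + x))))
    · rintro ω ⟨g1, g2⟩
      refine ⟨g1, ?_⟩
      have hx1 : 0 < 1 + x := by linarith
      refine (mul_le_mul_of_nonneg_left g2 (by positivity)).trans_eq ?_
      field_simp
  have p3 : μ.real {ω | 1 ≤ numExceed ξ n ν ω ∧ x ^ 2 ≤ numExceed ξ n ν ω} ≤
      M * Real.exp (5 / (2 * c₀)) * ((1 + x) * D * G) := by
    refine (H.measureReal_numExceed_le h1 (p := 0) (c := 1 / κ)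
      (w := x ^ 2 / κ) le_rfl (by positivity) (by positivity) ?_ ?_ ?_).trans (hfin _ ?_)
    · have : 0 < 1 / c₀ := by positivity
      rw [← mul_one_div 4 c₀]; linarith
    · exact (measurableSet_le measurable_const hNm).inter (measurableSet_le measurable_const hNm)
    · rintro ω ⟨g1, g2⟩
      refine ⟨g1, ?_⟩
      rw [zero_mul, zero_add, div_eq_mul_one_div, mul_comm]
      exact mul_le_mul_of_nonneg_left g2 (by positivity)
    · have e1 : Real.exp (-(x ^ 2 / κ)) ≤ G := by
        refine Real.exp_le_exp.2 (neg_le_neg ?_)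
        exact div_le_div_of_nonneg_left (sq_nonneg x) hκ (by linarith)
      have e2 : Real.exp (κ * 0 ^ 2 / 2) = 1 := by simp
      rw [e2, mul_one]
      exact e1.trans (le_mul_of_one_le_left hG0.le hb1)
  refine (measureReal_union_le _ _).trans ((add_le_add p1 ((measureReal_union_le _ _).trans
    (add_le_add p2 p3))).trans_eq ?_)
  rw [hM]; ring

end IsAdmissible

universe u

/-- The Cramér-type estimate for normalised sequences: the error is a small multiple of the
exponential part of the Gaussian tail. -/
theorem exists_abs_measureReal_sub_le {c₀ : ℝ} (hc₀ : 0 < c₀) :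
    ∃ ε C : ℝ, 0 < ε ∧ 100 * ε ≤ 1 ∧ 100 * ε ≤ c₀ ∧ 0 < C ∧
      ∀ {Ω : Type u} [MeasurableSpace Ω] {μ : Measure Ω} [IsProbabilityMeasure μ]
        {ξ : ℕ → Ω → ℝ} {n : ℕ} {a ν x : ℝ}, IsAdmissible ξ μ n a ν x c₀ ε →
        |μ.real {ω | x * V ξ n ω < S ξ n ω} - gaussianTail 1 (x / Real.sqrt (sumVar ξ μ n))| ≤
          C * ((1 + x) * (a ^ 4 / ν ^ 4) * Real.exp (-(x ^ 2 / (2 * sumVar ξ μ n)))) := by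
  obtain ⟨ε, c₁, C, hε0, hε1, hεc, hc₁, hC, hlap⟩ := exists_laplace_bounds.{u} hc₀
  obtain ⟨C', hC', htail⟩ := exists_abs_measureReal_linStat_sub_le.{u} hc₀ hc₁ hC
  refine ⟨ε, C' + (24 + 6 * Real.exp (2 * (2 + 4 / c₀)) ^ 6 * Real.exp (5 / (2 * c₀))), hε0, hε1,
    hεc, by positivity, ?_⟩
  intro Ω _ μ _ ξ n a ν x H
  obtain ⟨l1, l2⟩ := hlap H
  have hbad := H.measureReal_badEvent_le l1
  obtain ⟨s1, s2⟩ := H.setOf_subset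
  have m1 := (measureReal_mono s1 (measure_ne_top μ _)).trans (measureReal_union_le _ _)
  have m2 := (measureReal_mono s2 (measure_ne_top μ _)).trans (measureReal_union_le _ _)
  have t1 := abs_le.1 (htail H l1 l2 _ H.abs_sub_level_le)
  have t2 := abs_le.1 (htail H l1 l2 x (by
    rw [sub_self, abs_zero]
    have := H.x_nonneg
    positivity))
  rw [add_mul, abs_le]
  constructor <;> linarith

end

/-! ### Scaling -/

section

lemma setOf_mul_V_lt_S_div_const {Ω : Type*} (ξ : ℕ → Ω → ℝ) {B : ℝ} (hB : 0 < B) (n : ℕ) (x : ℝ) :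
    {ω | x * V (fun i ω => ξ i ω / B) n ω < S (fun i ω => ξ i ω / B) n ω} =
      {ω | x * V ξ n ω < S ξ n ω} := by
  ext ω
  have h1 : S (fun i ω => ξ i ω / B) n ω = S ξ n ω / B := by
    unfold S; rw [Finset.sum_div]
  have h2 : V (fun i ω => ξ i ω / B) n ω = V ξ n ω / B := by
    unfold V
    simp only [div_pow]
    rw [← Finset.sum_div, Real.sqrt_div' _ (sq_nonneg B), Real.sqrt_sq hB.le]
  simp only [Set.mem_ofPred_eq]
  rw [h1, h2, ← mul_div_assoc, div_lt_div_iff_of_pos_right hB]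

variable {Ω : Type*} [MeasurableSpace Ω] {μ : Measure Ω} {ξ : ℕ → Ω → ℝ}

lemma OneDependent.div_const (h : OneDependent ξ μ) (B : ℝ) :
    OneDependent (fun i ω => ξ i ω / B) μ := by
  have hle : ∀ i, MeasurableSpace.comap (fun ω => ξ i ω / B) inferInstance ≤
      MeasurableSpace.comap (ξ i) inferInstance := fun i => by
    rw [show (fun ω => ξ i ω / B) = (fun y : ℝ => y / B) ∘ ξ i from rfl,
      ← MeasurableSpace.comap_comp]
    exact MeasurableSpace.comap_mono (measurable_id.div_const B).comap_le
  intro k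
  exact indep_of_indep_of_le_left (indep_of_indep_of_le_right (h k)
    (iSup₂_mono fun i _ => hle i)) (iSup₂_mono fun i _ => hle i)

lemma sumVar_div_const {B : ℝ} {n : ℕ}
    (hB : B ^ 2 = ∑ i ∈ Finset.Icc 1 n, ∫ ω, ξ i ω ^ 2 ∂μ) :
    sumVar (fun i ω => ξ i ω / B) μ n = 1 + 2 * rho ξ μ n := by
  unfold sumVar rho
  rw [← hB, Finset.sum_div]
  congr 2
  refine Finset.sum_congr rfl fun i _ => ?_
  rw [← integral_div]
  congr 1; ext ω; ring

lemma IsNormalized.sumVar_le {n : ℕ} {a ν : ℝ} [IsProbabilityMeasure μ]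
    (H : IsNormalized ξ μ n a ν) : sumVar ξ μ n ≤ 3 := by
  have hi2 : ∀ i, 1 ≤ i → i ≤ n → Integrable (fun ω => ξ i ω ^ 2) μ := fun i h1 h2 =>
    integrable_pow_of_integrable_pow_four (H.measurable i h1) (H.integrable i h1 h2) (by norm_num)
  set s : ℕ → ℝ := fun i => ∫ ω, ξ i ω ^ 2 ∂μ with hs
  have hs0 : ∀ i, 0 ≤ s i := fun i => integral_nonneg fun ω => sq_nonneg _
  have h1 : ∑ i ∈ Finset.Ico 1 n, s i ≤ 1 := by
    rw [← H.sum_sq]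
    refine Finset.sum_le_sum_of_subset_of_nonneg (fun i hi => ?_) fun i _ _ => hs0 i
    rw [Finset.mem_Ico] at hi; rw [Finset.mem_Icc]; omega
  have h2 : ∑ i ∈ Finset.Ico 1 n, s (i + 1) ≤ 1 := by
    rw [← H.sum_sq, Finset.sum_Ico_add' s 1 n 1]
    refine Finset.sum_le_sum_of_subset_of_nonneg (fun i hi => ?_) fun i _ _ => hs0 i
    rw [Finset.mem_Ico] at hi; rw [Finset.mem_Icc]; omega
  have h3 : ∑ i ∈ Finset.Ico 1 n, ∫ ω, ξ i ω * ξ (i + 1) ω ∂μ ≤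
      ∑ i ∈ Finset.Ico 1 n, (s i + s (i + 1)) / 2 := by
    refine Finset.sum_le_sum fun i hi => ?_
    rw [Finset.mem_Ico] at hi
    have j1 := hi2 i hi.1 hi.2.le
    have j2 := hi2 (i + 1) (by omega) hi.2
    have e : (s i + s (i + 1)) / 2 = ∫ ω, (ξ i ω ^ 2 + ξ (i + 1) ω ^ 2) / 2 ∂μ := by
      rw [integral_div, integral_add j1 j2]
    have j3 : Integrable (fun ω => (ξ i ω ^ 2 + ξ (i + 1) ω ^ 2) / 2) μ := (j1.add j2).div_const 2
    rw [e]
    refine integral_mono (j3.mono' ((H.measurable i hi.1).mul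
      (H.measurable (i + 1) (by omega))).aestronglyMeasurable (ae_of_all _ fun ω => ?_)) j3
      fun ω => ?_
    · rw [Real.norm_eq_abs, abs_le]
      constructor <;> linarith [sq_nonneg (ξ i ω + ξ (i + 1) ω), sq_nonneg (ξ i ω - ξ (i + 1) ω),
        add_sq (ξ i ω) (ξ (i + 1) ω), sub_sq (ξ i ω) (ξ (i + 1) ω)]
    · simp only
      linarith [sq_nonneg (ξ i ω - ξ (i + 1) ω), sub_sq (ξ i ω) (ξ (i + 1) ω)]
  rw [← Finset.sum_div, Finset.sum_add_distrib] at h3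
  unfold sumVar
  linarith

lemma isNormalized_div_const [IsProbabilityMeasure μ] {n : ℕ} {a₁ a₂ ν B : ℝ}
    (hξ : ∀ i, 1 ≤ i → Measurable (ξ i)) (hdep : OneDependent ξ μ) (ha₂ : 0 < a₂)
    (hmom : ∀ i, 1 ≤ i → i ≤ n → Integrable (fun ω => ξ i ω ^ 4) μ ∧ ∫ ω, ξ i ω ∂μ = 0 ∧
      ∫ ω, ξ i ω ^ 4 ∂μ ≤ a₁ ^ 4 ∧ a₂ ^ 2 ≤ ∫ ω, ξ i ω ^ 2 ∂μ)
    (hν : 1 ≤ ν) (hνn : ν ^ 16 = n) (ha : 1 ≤ a₁ / a₂) (haν : a₁ / a₂ ≤ ν) (hB0 : 0 < B)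
    (hB : B ^ 2 = ∑ i ∈ Finset.Icc 1 n, ∫ ω, ξ i ω ^ 2 ∂μ) :
    IsNormalized (fun i ω => ξ i ω / B) μ n (a₁ / a₂) ν where
  measurable i hi := (hξ i hi).div_const B
  dep := hdep.div_const B
  one_le_ν := hν
  ν_pow := hνn
  one_le_a := ha
  a_le := haν
  integrable i h1 h2 := by
    simp only [div_pow]
    exact (hmom i h1 h2).1.div_const _
  mean i h1 h2 := by rw [integral_div, (hmom i h1 h2).2.1, zero_div]
  fourth i h1 h2 := by
    simp only [div_pow _ B]
    rw [integral_div]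
    have hν0 : 0 < ν := by linarith
    have hnB : ν ^ 16 * a₂ ^ 2 ≤ B ^ 2 := by
      rw [hB, hνn]
      have := Finset.card_nsmul_le_sum (Finset.Icc 1 n) (fun i => ∫ ω, ξ i ω ^ 2 ∂μ) (a₂ ^ 2)
        fun i hi => (hmom i (Finset.mem_Icc.1 hi).1 (Finset.mem_Icc.1 hi).2).2.2.2
      simpa using this
    have hB4 : ν ^ 32 * a₂ ^ 4 ≤ B ^ 4 := by
      calc ν ^ 32 * a₂ ^ 4 = (ν ^ 16 * a₂ ^ 2) ^ 2 := by ring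
        _ ≤ (B ^ 2) ^ 2 := pow_le_pow_left₀ (by positivity) hnB 2
        _ = _ := by ring
    refine (div_le_div_of_nonneg_right (hmom i h1 h2).2.2.1 (by positivity)).trans ?_
    rw [show (a₁ / a₂ / ν ^ 8) ^ 4 = a₁ ^ 4 / (ν ^ 32 * a₂ ^ 4) by field_simp]
    exact div_le_div_of_nonneg_left (by positivity) (by positivity) hB4
  sum_sq := by
    simp only [div_pow, integral_div]
    rw [← Finset.sum_div, ← hB, div_self (by positivity)]

lemma exists_eq_mul_one_add {P Ψ b A : ℝ} (hΨ : 0 < Ψ) (hb : 0 < b)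
    (h : |P - Ψ| ≤ A * b * Ψ) : ∃ O : ℝ, |O| ≤ A ∧ P = Ψ * (1 + O * b) := by
  refine ⟨(P - Ψ) / (b * Ψ), ?_, by field_simp; ring⟩
  rw [abs_div, abs_of_pos (by positivity : 0 < b * Ψ), div_le_iff₀ (by positivity)]
  linarith

/-- A lower bound for the Gaussian tail at `x / κ ^ (1 / 2)` in terms of `x` alone, apart from the
exponential factor. -/
lemma le_gaussianTail_one_div_sqrt {κ c₀ x : ℝ} (hc₀ : 0 < c₀) (hκ : c₀ ≤ κ) (hx : 0 ≤ x) :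
    Real.exp (-(x ^ 2 / (2 * κ))) ≤
      15 * ((1 + 1 / Real.sqrt c₀) * (1 + x)) * gaussianTail 1 (x / Real.sqrt κ) := by
  have hκ0 : 0 < κ := hc₀.trans_le hκ
  have hm : 0 < Real.sqrt c₀ := Real.sqrt_pos.2 hc₀
  have hr : 0 < Real.sqrt κ := Real.sqrt_pos.2 hκ0
  have h := le_gaussianTail_one (X := x / Real.sqrt κ) (by positivity)
  rw [div_pow, Real.sq_sqrt hκ0.le, div_div, mul_comm κ 2] at h
  have hX : x / Real.sqrt κ ≤ x / Real.sqrt c₀ :=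
    div_le_div_of_nonneg_left hx hm (Real.sqrt_le_sqrt hκ)
  have hX0 : 0 ≤ x / Real.sqrt κ := by positivity
  have h1 : 1 + x / Real.sqrt κ ≤ (1 + 1 / Real.sqrt c₀) * (1 + x) := by
    have : (1 + 1 / Real.sqrt c₀) * (1 + x) = 1 + x / Real.sqrt c₀ + (x + 1 / Real.sqrt c₀) := by
      ring
    have : 0 ≤ x + 1 / Real.sqrt c₀ := by positivity
    linarith
  rw [← mul_div_assoc, div_le_iff₀ (by linarith)] at h
  have h2 := mul_le_mul_of_nonneg_left h1 (gaussianTail_nonneg 1 (x / Real.sqrt κ))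
  linarith

end

end SelfNormalized

theorem theorem3p1 (ρ : ℝ) (hρ : -(1 / 2 : ℝ) < ρ) :
    ∃ a₀ A : ℝ, 0 < a₀ ∧ 0 < A ∧
      ∀ (Ω : Type*) [MeasurableSpace Ω] (μ : Measure Ω) [IsProbabilityMeasure μ]
        (ξ : ℕ → Ω → ℝ) (n : ℕ) (a₁ a₂ : ℝ),
        (∀ i, 1 ≤ i → Measurable (ξ i)) →
        SelfNormalized.OneDependent ξ μ →
        1 ≤ n → 0 < a₁ → 0 < a₂ →
        (∀ i, 1 ≤ i → i ≤ n →
          Integrable (fun ω => ξ i ω ^ 4) μ ∧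
          ∫ ω, ξ i ω ∂μ = 0 ∧
          ∫ ω, ξ i ω ^ 4 ∂μ ≤ a₁ ^ 4 ∧
          a₂ ^ 2 ≤ ∫ ω, ξ i ω ^ 2 ∂μ) →
        ρ ≤ SelfNormalized.rho ξ μ n →
        ∀ x : ℝ, 0 < x → x < a₀ * ((a₁ / a₂) ^ 2)⁻¹ * (n : ℝ) ^ (1 / 8 : ℝ) →
          ∃ O₁ : ℝ, |O₁| ≤ A ∧
            μ.real {ω | SelfNormalized.S ξ n ω > x * SelfNormalized.V ξ n ω} =
              (1 - SelfNormalized.Phi (x / Real.sqrt (1 + 2 * SelfNormalized.rho ξ μ n))) *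
                (1 + O₁ * (a₁ / a₂) ^ 4 * ((1 + x) ^ 2 / (n : ℝ) ^ (1 / 4 : ℝ))) := by
  have hc₀ : 0 < 1 + 2 * ρ := by linarith
  set c₀ := 1 + 2 * ρ with hc₀def
  obtain ⟨ε, C, hε0, hε1, hεc, hC, hmain⟩ := SelfNormalized.exists_abs_measureReal_sub_le hc₀
  set L := 1 + 1 / Real.sqrt c₀ with hL
  have hL0 : 0 < L := by positivity
  refine ⟨ε / 2, 15 * L * C + 60 * L / ε ^ 2 * Real.exp (1 / (2 * c₀)), by positivity,
    by positivity, ?_⟩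
  intro Ω _ μ _ ξ n a₁ a₂ hξ hdep hn ha₁ ha₂ hmom hρn x hx hxlt
  have hn0 : (1 : ℝ) ≤ n := by exact_mod_cast hn
  -- all scales are powers of `ν = n ^ (1 / 16)`
  obtain ⟨ν, hν⟩ : ∃ ν : ℝ, ν = (n : ℝ) ^ (1 / 16 : ℝ) := ⟨_, rfl⟩
  have hν1 : 1 ≤ ν := by rw [hν]; exact Real.one_le_rpow hn0 (by norm_num)
  have hνpow : ∀ k : ℕ, ν ^ k = (n : ℝ) ^ (k / 16 : ℝ) := fun k => by
    rw [hν, ← Real.rpow_natCast, ← Real.rpow_mul (by linarith)]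
    congr 1; ring
  have hν16 : ν ^ 16 = n := by rw [hνpow]; norm_num
  have hν2 : (n : ℝ) ^ (1 / 8 : ℝ) = ν ^ 2 := by rw [hνpow]; norm_num
  have hν4 : (n : ℝ) ^ (1 / 4 : ℝ) = ν ^ 4 := by rw [hνpow]; norm_num
  rw [hν2] at hxlt
  rw [hν4, ← SelfNormalized.gaussianTail_one_eq]
  have hν0 : 0 < ν := by linarith
  obtain ⟨a, ha⟩ : ∃ a : ℝ, a = a₁ / a₂ := ⟨_, rfl⟩
  have ha0 : 0 < a := by rw [ha]; positivity
  have ha1 : 1 ≤ a := by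
    obtain ⟨m1, -, m3, m4⟩ := hmom 1 le_rfl hn
    have := m4.trans (SelfNormalized.integral_sq_le_of_integral_pow_four_le ha₁ (hξ 1 le_rfl)
      m1 m3)
    rw [ha, one_le_div ha₂]
    exact le_of_sq_le_sq this ha₁.le
  have hκ : c₀ ≤ 1 + 2 * SelfNormalized.rho ξ μ n := by linarith
  have hΨ := SelfNormalized.le_gaussianTail_one_div_sqrt hc₀ hκ hx.le
  rw [← ha] at hxlt ⊢
  have hxa : x * a ^ 2 < ε / 2 * ν ^ 2 := by
    have := mul_lt_mul_of_pos_right hxlt (pow_pos ha0 2)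
    refine this.trans_eq ?_
    field_simp
  set κ := 1 + 2 * SelfNormalized.rho ξ μ n with hκdef
  have hκ0 : 0 < κ := hc₀.trans_le hκ
  set Ψ := SelfNormalized.gaussianTail 1 (x / Real.sqrt κ) with hΨdef
  have hΨ0 : 0 < Ψ := by
    by_contra hneg
    have : 15 * (L * (1 + x)) * Ψ ≤ 0 :=
      mul_nonpos_of_nonneg_of_nonpos (by positivity) (not_lt.1 hneg)
    linarith [Real.exp_pos (-(x ^ 2 / (2 * κ)))]
  set D := a ^ 4 / ν ^ 4 with hD
  have hD0 : 0 < D := by positivity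
  suffices h : |μ.real {ω | x * SelfNormalized.V ξ n ω < SelfNormalized.S ξ n ω} - Ψ| ≤
      (15 * L * C + 60 * L / ε ^ 2 * Real.exp (1 / (2 * c₀))) * (D * (1 + x) ^ 2) * Ψ by
    obtain ⟨O, hO, hP⟩ := SelfNormalized.exists_eq_mul_one_add hΨ0 (by positivity) h
    refine ⟨O, hO, hP.trans ?_⟩
    rw [hD]; ring
  rcases le_or_gt ((1 + x) * a ^ 2) (ε * ν ^ 2) with hsm | hlg
  · have hBpos : 0 < ∑ i ∈ Finset.Icc 1 n, ∫ ω, ξ i ω ^ 2 ∂μ :=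
      Finset.sum_pos (fun i hi => (pow_pos ha₂ 2).trans_le
        (hmom i (Finset.mem_Icc.1 hi).1 (Finset.mem_Icc.1 hi).2).2.2.2)
        ⟨1, Finset.mem_Icc.2 ⟨le_rfl, hn⟩⟩
    obtain ⟨B, hB0, hB⟩ : ∃ B : ℝ, 0 < B ∧ B ^ 2 = ∑ i ∈ Finset.Icc 1 n, ∫ ω, ξ i ω ^ 2 ∂μ :=
      ⟨_, Real.sqrt_pos.2 hBpos, Real.sq_sqrt hBpos.le⟩
    have haν : a ≤ ν := by
      have h1 : a ^ 2 ≤ (1 + x) * a ^ 2 := le_mul_of_one_le_left (sq_nonneg a) (by linarith)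
      have h2 : ε * ν ^ 2 ≤ 1 * ν ^ 2 := mul_le_mul_of_nonneg_right (by linarith) (sq_nonneg ν)
      exact le_of_sq_le_sq (by linarith) hν0.le
    have hnorm := SelfNormalized.isNormalized_div_const hξ hdep ha₂ hmom hν1 hν16
      (ha ▸ ha1) (ha ▸ haν) hB0 hB
    rw [← ha] at hnorm
    have hvar := SelfNormalized.sumVar_div_const (μ := μ) hB
    rw [← hκdef] at hvar
    have := hmain (x := x) ⟨hnorm, hc₀, by rw [hvar]; exact hκ, hnorm.sumVar_le, hx.le, hsm, hε0,
      hε1, hεc⟩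
    rw [hvar, SelfNormalized.setOf_mul_V_lt_S_div_const ξ hB0, ← hΨdef, ← hD] at this
    calc _ ≤ C * ((1 + x) * D * Real.exp (-(x ^ 2 / (2 * κ)))) := this
      _ ≤ C * ((1 + x) * D * (15 * (L * (1 + x)) * Ψ)) :=
          mul_le_mul_of_nonneg_left (mul_le_mul_of_nonneg_left hΨ (by positivity)) hC.le
      _ = 15 * L * C * (D * (1 + x) ^ 2) * Ψ := by ring
      _ ≤ _ := by
          refine mul_le_mul_of_nonneg_right (mul_le_mul_of_nonneg_right
            (le_add_of_nonneg_right (by positivity)) (by positivity)) hΨ0.le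
  · -- here `x < 1` and `a ^ 4 / ν ^ 4` is bounded below, so that there is nothing to prove
    have h1 : ε / 2 * ν ^ 2 < a ^ 2 := by linarith
    have hx1 : x ≤ 1 := by
      by_contra hneg
      have : a ^ 2 ≤ x * a ^ 2 := le_mul_of_one_le_left (sq_nonneg a) (not_le.1 hneg).le
      linarith
    have hDε : ε ^ 2 / 4 ≤ D := by
      rw [hD, le_div_iff₀ (by positivity)]
      calc ε ^ 2 / 4 * ν ^ 4 = (ε / 2 * ν ^ 2) ^ 2 := by ring
        _ ≤ (a ^ 2) ^ 2 := pow_le_pow_left₀ (by positivity) h1.le 2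
        _ = a ^ 4 := by ring
    have hΨ1 : Ψ ≤ 1 := by
      rw [hΨdef, SelfNormalized.gaussianTail_eq_real one_ne_zero]; exact measureReal_le_one
    have hG : 1 ≤ Real.exp (1 / (2 * c₀)) * Real.exp (-(x ^ 2 / (2 * κ))) := by
      rw [← Real.exp_add]
      refine Real.one_le_exp ?_
      have : x ^ 2 / (2 * κ) ≤ 1 / (2 * c₀) :=
        div_le_div₀ zero_le_one (pow_le_one₀ hx.le hx1) (by positivity) (by linarith)
      linarith
    have hle : |μ.real {ω | x * SelfNormalized.V ξ n ω < SelfNormalized.S ξ n ω} - Ψ| ≤ 1 := by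
      rw [abs_le]
      have hP0 : 0 ≤ μ.real {ω | x * SelfNormalized.V ξ n ω < SelfNormalized.S ξ n ω} :=
        measureReal_nonneg
      have hP1 : μ.real {ω | x * SelfNormalized.V ξ n ω < SelfNormalized.S ξ n ω} ≤ 1 :=
        measureReal_le_one
      constructor <;> linarith
    have hDq : ε ^ 2 / 4 * (1 + x) ≤ D * (1 + x) ^ 2 :=
      mul_le_mul hDε (le_self_pow₀ (by linarith) two_ne_zero) (by positivity) hD0.le
    have hx2 : 1 ≤ 1 + x := by linarith
    have hEpos := Real.exp_pos (1 / (2 * c₀))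
    calc _ ≤ Real.exp (1 / (2 * c₀)) * (15 * (L * (1 + x)) * Ψ) :=
          hle.trans (hG.trans (mul_le_mul_of_nonneg_left hΨ hEpos.le))
      _ = 60 * L / ε ^ 2 * Real.exp (1 / (2 * c₀)) * (ε ^ 2 / 4 * (1 + x)) * Ψ := by
          field_simp; ring
      _ ≤ (15 * L * C + 60 * L / ε ^ 2 * Real.exp (1 / (2 * c₀))) * (D * (1 + x) ^ 2) * Ψ := by
          refine mul_le_mul_of_nonneg_right (mul_le_mul ?_ hDq (by positivity) (by positivity))
            hΨ0.le
          exact le_add_of_nonneg_left (by positivity)
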